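/- Let $2\le k<\ell$, $p\ge k$, $n=p\ell$ and $N=(k-1)(\ell-1)$. For a $k\times n$ matrix $X$ of rank $k$ (representing a point of $\mathrm{Gr}(k,n)$ over $\mathbb C$) let $\Delta_I(X)$ be its Plücker coordinates, with index sets read modulo $n$ and columns taken in increasing order in $\{1,\dots,n\}$. Let $\rho$ be the cyclic shift, induced by the signed circulant matrix with corner entry $(-1)^{k-1}$, so that $\Delta_I(\rho X)=\Delta_{I+1}(X)$. Let $\mathcal D=\mathcal D_n(k,\ell)$ be the distinguished component: the connected component of the fixed locus $\mathrm{Gr}(k,n)^{\rho^\ell}$ that contains the $\rho^\ell$-fixed points whose Plücker coordinates are all nonnegative. Identities between functions on $\mathcal D$ are understood in its homogeneous coordinate ring, i.e. on the affine cone. *Index sets.* For $1\le j\le k-1$, $1\le r\le \ell-1$ and $i=(j-1)(\ell-1)+r$ let $I_i=\{i,i+1,\dots,i+j-1\}\cup\{1+j\ell,1+(j+1)\ell,\dots,1+(k-1)\ell\}$, and let $I_{N+i}=\{i-k+1,\dots,i\}$ for $1\le i\le\ell$. For $0<s<k$ let $\eta_s$ be the $q$-binomial coefficient ${k \brack s}_q=\frac{[k]_q!}{[s]_q!\,[k-s]_q!}$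 with $[m]_q=\frac{q^{m/2}-q^{-m/2}}{q^{1/2}-q^{-1/2}}$, at $q^{1/2}=e^{\pi i/p}$. For $a\in\mathbb Z$ let $\langle a\rangle\in\{1,\dots,\ell\}$ be its residue modulo $\ell$. *Band matrices.* $\mathrm{Band}(k,\ell)$ is the space of matrices $M=(M_{i,j})_{i,j\in\mathbb Z}$ with $M_{i,j}=0$ unless $0\le j-i\le k$ and $M_{i+\ell,j+\ell}=M_{i,j}$. For $1\le i\le N$ let $x_i$ be the minor of $M$ with column set $\{k+i,\dots,(k-1)\ell+1\}$ and row set the $N-i+1$ largest elements of $\{j\in\{1,\dots,(k-1)\ell\}: j\not\equiv1 \bmod \ell\}$. Let $A,B$ be the $\ell\times\ell$ matrices with entries $A_{ij}=M_{i,j-\ell+k}$ if $j-\ell+k\ge1$ and $0$ otherwise, and $B_{ij}=M_{i,j+k}$; put $\tilde c_s=(-1)^{s(\ell-s)}[t^{\ell-s}]\det(tB+A)$. Define $\phi(X)_{i,j}=\Delta_{[i,i+k]\setminus j}(X)$ (zero when the index set is not a $k$-subset), $\tau(M)_{i,j}=M_{j,i+k}$, and $\phi'=\tau\circ\phi\circ\rho^{-k}$.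 **Part 1 (every $k$).** $\phi'$ maps $\mathcal D$ to $\mathrm{Band}(k,\ell)$, and on $\mathcal D$ $$(\phi')^*x_i=\Delta_{I_i}\prod_{b=i}^{N-1}\Delta_{I_{N+\langle b+k\rangle}}\quad(1\le i\le N),\qquad (\phi')^*M_{i,i}=(\phi')^*M_{i-k-1,i-1}=\Delta_{I_{N+\langle i-1\rangle}}\quad(i\in\mathbb Z).$$ **Part 2 ($k=2$ or $3$).** On $\mathcal D$, for $1\le s\le k-1$, $\;(\phi')^*\tilde c_s=\eta_s\prod_{i=1}^{\ell}\Delta_{I_{N+i}}.$ **Part 3 ($k=2$ or $3$).** Consider the following two seeds; in both, the mutable part is given by the quiver with arrows $\overline x_{i+1}\to \overline x_i\to \overline x_{i+\ell}\to \overline x_{i+1}$ ($1\le i\le N$), the vertices $1,\dots,N$ are mutable, vertex $1$ has exchange degree $k$, and the others have degree $1$; $B=(b_{ij})$ with $b_{ij}$ the number of arrows $i\to j$ minus the number of arrows $j\to i$. * $\Sigma_{\rm cyc}$: indeterminates $\overline x_1,\dots,\overline x_N$ (mutable), $\overline x_{N+1},\dots,\overline x_{N+\ell}$ (frozen vertices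 of the same quiver), and coefficient string variables $z_1,\dots,z_{k-1}$ with $z_s=z_{k-s}$ ($z_0=z_k=1$) at vertex $1$. The coefficient of $u^sv^{d-s}$ in the exchange polynomial at vertex $i$ of degree $d$ is $p_{i;s}=\zeta\prod_{j=N+1}^{N+\ell}\overline x_j^{\,s[b_{ji}]_++(d-s)[-b_{ji}]_+}$, where $\zeta=z_s$ if $i=1$ and $\zeta=1$ if $i\ge2$. Its coefficient group $\mathbb P_{\rm cyc}$ is generated by the $\overline x_{N+j}$ and the $z_s$. * $\Sigma_{\rm GSV}$ (Gekhtman–Shapiro–Vainshtein): mutable variables $x_1,\dots,x_N$, frozen variables $M_{i,i}$ and $M_{i,i+k}$ ($i$ modulo $\ell$), and $\tilde c_1,\dots,\tilde c_{k-1}$, all treated as independent indeterminates which are evaluated on $\mathrm{Band}(k,\ell)$ as above; $\mathbb P_{\rm GSV}$ is generated by the variables other than the $x_i$. The coefficients of the exchange polynomials are, at vertex $1$ and for $k\ge3$: $p_{1;0}=\prod_{i=1}^\ell M_{i,i}\prod_{i=2}^\ell M_{i,i+k}^{k-1}$, $p_{1;s}=\tilde c_{k-s}\prod_{i=2}^\ell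 M_{i,i+k}^{k-1-s}$ for $0<s<k$, $p_{1;k}=M_{1,k+1}$; at vertex $1$ and for $k=2$: $p_{1;0}=\prod_{1\le i\le\ell,\,i\ne2}M_{i,i}\prod_{i=2}^\ell M_{i,i+2}$, $p_{1;1}=\tilde c_1$, $p_{1;2}=M_{1,3}M_{2,2}$; at vertex $i\ge2$: $p_{i;0}=1$ and $p_{i;1}$ is the product of $M_{i,i+k}$ (if $i\le\ell$) and $M_{i+k-1,i+k-1}$ (if $i\ge N-\ell+2$). For a seed $\Sigma$ with coefficient group $\mathbb P$ let $\mathcal F_{>0}$ be the semifield of subtraction-free rational expressions in the cluster variables with coefficients in $\mathbb P$, and let $\hat y_{i;s}=\frac{p_{i;s}}{p_{i;0}}\big(\prod_{j\le N}x_j^{b_{ji}}\big)^s$. Then there is a homomorphism of semifields $\psi^*:\mathcal F_{>0,\rm GSV}\to\mathcal F_{>0,\rm cyc}$ with $$\psi^*(x_i)=\overline x_i\prod_{b=i}^{N-1}\overline x_{N+\langle b+k\rangle},\qquad \psi^*(M_{i,i})=\psi^*(M_{i-k-1,i-1})=\overline x_{N+\langle i-1\rangle},\qquad \psi^*(\tilde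 c_s)=z_s\prod_{i=1}^\ell\overline x_{N+i},$$ which is a quasi-homomorphism from $\Sigma_{\rm GSV}$ to $\Sigma_{\rm cyc}$, i.e. $\psi^*(\mathbb P_{\rm GSV})\subseteq\mathbb P_{\rm cyc}$, the exchange degrees agree, $\psi^*(x_i)/\overline x_i\in\mathbb P_{\rm cyc}$, and $\psi^*$ sends $\Sigma_{\rm GSV}$ to a seed with the same $\hat y_{i;s}$ as $\Sigma_{\rm cyc}$ for all $1\le i\le N$ and $1\le s\le d_i$ (where $d_i$ is the exchange degree of vertex $i$). Moreover it is realized by $\phi'$: for every $f\in\mathcal F_{>0,\rm GSV}$, the pullback $(\phi')^*f$ equals the specialization of $\psi^*(f)$ at $\overline x_i=\Delta_{I_i}$, $z_s=\eta_s$, at every point of $\mathcal D$ where $f$, as a rational function of the initial variables of $\Sigma_{\rm GSV}$, is defined at the image under $\phi'$. -/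

import Mathlib

noncomputable section

namespace CyclicLocus

open Finset Polynomial

/-! ### Grassmannian, cyclic shift, distinguished component

A point of the Grassmannian `Gr(k,n)` is represented by a `k × n` matrix of rank `k` (rows = a basis
of the subspace), so that Plücker coordinates become honest functions of the matrix and identities in
a homogeneous coordinate ring become identities of functions on the affine cone. The column with
number `i ∈ {1,…,n}` is the one indexed by the element `i - 1` of `Fin n`. -/

/-- The subset of `{1,…,n}` (as columns) obtained by reducing a set of integers modulo `n`. -/
def residues (n : ℕ) (I : Finset ℤ) : Finset (Fin n) :=
  univ.filter fun c => ∃ i ∈ I, ((c : ℕ) : ℤ) + 1 ≡ i [ZMOD n]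

/-- The maximal minor of `X` with column set `I` (columns in increasing order);
`0` when `I` is not a `k`-subset. -/
def maxMinor {k n : ℕ} (X : Matrix (Fin k) (Fin n) ℂ) (I : Finset (Fin n)) : ℂ :=
  if h : I.card = k then (X.submatrix id (I.orderEmbOfFin h)).det else 0

/-- The Plücker coordinate `Δ_I` with indices treated modulo `n`. -/
def plucker {k n : ℕ} (X : Matrix (Fin k) (Fin n) ℂ) (I : Finset ℤ) : ℂ :=
  maxMinor X (residues n I)

/-- The signed circulant matrix `ρ`. It acts on row vectors from the right, so that
`Δ_I (X * ρ) = Δ_{I+1} (X)`. -/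
def rho (k n : ℕ) : Matrix (Fin n) (Fin n) ℂ :=
  Matrix.of fun i j =>
    if (i : ℕ) = j + 1 then 1
    else if (i : ℕ) = 0 ∧ (j : ℕ) + 1 = n then (-1) ^ (k - 1)
    else 0

/-- The subspace represented by a matrix. -/
def rowSpan {k n : ℕ} (X : Matrix (Fin k) (Fin n) ℂ) : Submodule ℂ (Fin n → ℂ) :=
  Submodule.span ℂ (Set.range X.row)

/-- Matrices representing the points of `Gr(k,n)` that are fixed by `ρ ^ ℓ`. -/
def fixedLocus (k n ℓ : ℕ) : Set (Matrix (Fin k) (Fin n) ℂ) :=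
  {X | X.rank = k ∧ rowSpan (X * rho k n ^ ℓ) = rowSpan X}

/-- The point represented by `X` is totally nonnegative: up to a common nonzero factor, all its
Plücker coordinates are nonnegative reals. -/
def IsTNN {k n : ℕ} (X : Matrix (Fin k) (Fin n) ℂ) : Prop :=
  ∃ c : ℂ, c ≠ 0 ∧ ∀ I : Finset (Fin n), I.card = k → ∃ r : ℝ, 0 ≤ r ∧ maxMinor X I = c * r

/-- Matrices representing the points of the distinguished component `𝒟_n(k,ℓ)`: the connected
component of the `ρ ^ ℓ`-fixed locus that contains the totally nonnegative fixed points. (The space of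
matrices of rank `k` is a principal bundle over `Gr(k,n)` with connected fibre `GL_k(ℂ)`, so connected
components upstairs are the preimages of those downstairs.) -/
def distinguished (k n ℓ : ℕ) : Set (Matrix (Fin k) (Fin n) ℂ) :=
  {X | ∃ X₀ ∈ fixedLocus k n ℓ, IsTNN X₀ ∧ X ∈ connectedComponentIn (fixedLocus k n ℓ) X₀}

/-- The number `N = (k-1)(ℓ-1)` of mutable variables. -/
def numMutable (k ℓ : ℕ) : ℕ := (k - 1) * (ℓ - 1)

/-- The index sets `I_1, I_2, …`. For `i = (j-1)(ℓ-1) + r` with `1 ≤ j ≤ k-1`, `1 ≤ r ≤ ℓ-1`, one has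
`I_i = {i, …, i+j-1} ∪ {1+jℓ, 1+(j+1)ℓ, …, 1+(k-1)ℓ}`, and `I_{N+i} = {i-k+1, …, i}`. -/
def initSet (k ℓ i : ℕ) : Finset ℤ :=
  if i ≤ numMutable k ℓ then
    let j : ℕ := (i - 1) / (ℓ - 1) + 1
    Icc (i : ℤ) (i + j - 1) ∪ (Ico j k).image fun t : ℕ => 1 + (t : ℤ) * ℓ
  else
    Icc ((i : ℤ) - numMutable k ℓ - k + 1) ((i : ℤ) - numMutable k ℓ)

/-- The representative in `{1,…,ℓ}` of an integer modulo `ℓ`. -/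
def resIcc (ℓ : ℕ) (a : ℤ) : ℕ := ((a - 1) % ℓ).toNat + 1

/-- The number `[m]_q = (q^{m/2} - q^{-m/2}) / (q^{1/2} - q^{-1/2})` at `q = exp(2πi/p)`. -/
def qInt (p m : ℕ) : ℂ :=
  let h : ℂ := Complex.exp (Real.pi * Complex.I / p)
  (h ^ m - (h ^ m)⁻¹) / (h - h⁻¹)

/-- The `q`-factorial at `q = exp(2πi/p)`. -/
def qFactorial (p m : ℕ) : ℂ := ∏ j ∈ Icc 1 m, qInt p j

/-- The number `η_s`, the `q`-binomial coefficient `[k choose s]_q` at `q = exp(2πi/p)`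
(used for `0 < s < k ≤ p`, where the denominator does not vanish). -/
def eta (k p s : ℕ) : ℂ := qFactorial p k / (qFactorial p s * qFactorial p (k - s))

/-! ### Periodic band matrices -/

/-- The space `Band(k,ℓ)`. -/
def band (k ℓ : ℕ) : Set (Matrix ℤ ℤ ℂ) :=
  {M | (∀ i j : ℤ, ¬(0 ≤ j - i ∧ j - i ≤ k) → M i j = 0) ∧
    ∀ i j : ℤ, M (i + ℓ) (j + ℓ) = M i j}

/-- The map `φ`, `X ↦ (Δ_{[i,i+k] ∖ j}(X))_{i,j}`. -/
def phi {k n : ℕ} (X : Matrix (Fin k) (Fin n) ℂ) : Matrix ℤ ℤ ℂ :=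
  fun i j => plucker X ((Icc i (i + k)).erase j)

/-- The transpose of band matrices, `τ(M)_{i,j} = M_{j,i+k}`. -/
def tau (k : ℕ) (M : Matrix ℤ ℤ ℂ) : Matrix ℤ ℤ ℂ := fun i j => M j (i + k)

/-- The map `φ' = τ ∘ φ ∘ ρ^{-k}`. -/
def phi' {k n : ℕ} (X : Matrix (Fin k) (Fin n) ℂ) : Matrix ℤ ℤ ℂ :=
  tau k (phi (X * ((rho k n)⁻¹) ^ k))

/-- The minor of `M` with row set `R` and column set `C` (`0` if the sizes differ). -/
def minor (M : Matrix ℤ ℤ ℂ) (R C : Finset ℤ) : ℂ :=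
  if h : C.card = R.card then
    (M.submatrix (R.orderEmbOfFin rfl) (C.orderEmbOfFin h)).det
  else 0

/-- The `m` largest elements of a finite set of integers. -/
def largest (m : ℕ) (S : Finset ℤ) : Finset ℤ :=
  S.filter fun a => (S.filter fun b => a < b).card < m

/-- The row set `R_i`: the `N-i+1` largest elements of
`{j ∈ {1,…,(k-1)ℓ} : j ≢ 1 mod ℓ}`. -/
def initRows (k ℓ i : ℕ) : Finset ℤ :=
  largest (numMutable k ℓ - i + 1)
    ((Icc (1 : ℤ) (((k - 1 : ℕ) : ℤ) * ℓ)).filter fun j => ¬ j ≡ 1 [ZMOD ℓ])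

/-- The column set `C_i = {k+i, …, (k-1)ℓ+1}`. -/
def initCols (k ℓ i : ℕ) : Finset ℤ := Icc ((k : ℤ) + i) (((k - 1 : ℕ) : ℤ) * ℓ + 1)

/-- The value at `M` of the initial mutable variable `x_i` of the structure on band matrices. -/
def initMinor (k ℓ i : ℕ) (M : Matrix ℤ ℤ ℂ) : ℂ := minor M (initRows k ℓ i) (initCols k ℓ i)

/-- The matrix `A`: its entry in row `i`, column `j` (`1 ≤ i, j ≤ ℓ`) is `M_{i,j-ℓ+k}` if
`j - ℓ + k ≥ 1`, and `0` otherwise. -/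
def matA (k ℓ : ℕ) (M : Matrix ℤ ℤ ℂ) : Matrix (Fin ℓ) (Fin ℓ) ℂ :=
  Matrix.of fun a b =>
    let i : ℤ := (a : ℕ) + 1
    let j : ℤ := (b : ℕ) + 1
    if 1 ≤ j - ℓ + k then M i (j - ℓ + k) else 0

/-- The matrix `B`: its entry in row `i`, column `j` (`1 ≤ i, j ≤ ℓ`) is `M_{i,j+k}`. -/
def matB (k ℓ : ℕ) (M : Matrix ℤ ℤ ℂ) : Matrix (Fin ℓ) (Fin ℓ) ℂ :=
  Matrix.of fun a b => M ((a : ℕ) + 1) ((b : ℕ) + 1 + k)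

/-- The regular function `c_s = [t^{ℓ-s}] det(tB + A)`. -/
def charCoeff (k ℓ s : ℕ) (M : Matrix ℤ ℤ ℂ) : ℂ :=
  (((X : ℂ[X]) • (matB k ℓ M).map C + (matA k ℓ M).map C).det).coeff (ℓ - s)

/-- The coefficient string variable `c̃_s = (-1)^{s(ℓ-s)} c_s`. -/
def coeffString (k ℓ s : ℕ) (M : Matrix ℤ ℤ ℂ) : ℂ :=
  (-1) ^ (s * (ℓ - s)) * charCoeff k ℓ s M

/-! ### Non-normalized generalized seeds and quasi-homomorphisms -/

/-- The data of a non-normalized generalized seed of rank `N` with elements in a field `K`; only the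
indices in `{1,…,N}`, and `p i s` with `0 ≤ s ≤ d i`, matter. -/
structure CSSeed (K : Type) where
  /-- the cluster -/
  x : ℕ → K
  /-- the exchange matrix -/
  B : ℕ → ℕ → ℤ
  /-- the exchange degrees -/
  d : ℕ → ℕ
  /-- the coefficient strings -/
  p : ℕ → ℕ → K

namespace CSSeed

variable {K K' : Type} [Field K] [Field K']

/-- The exchange degrees are positive, the coefficients lie in the coefficient group, and the exchange
matrix is skew-symmetrizable. -/
def IsSeedOver (N : ℕ) (P : Set K) (S : CSSeed K) : Prop :=
  (∀ i ∈ Icc 1 N, 1 ≤ S.d i ∧ ∀ s ≤ S.d i, S.p i s ∈ P) ∧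
  ∃ r : ℕ → ℤ, (∀ i, 0 < r i) ∧ ∀ i ∈ Icc 1 N, ∀ j ∈ Icc 1 N, r i * S.B i j = -(r j * S.B j i)

/-- The exchange monomial `M_i^+`. -/
def monPos (N : ℕ) (S : CSSeed K) (i : ℕ) : K := ∏ j ∈ Icc 1 N, S.x j ^ (S.B j i).toNat

/-- The exchange monomial `M_i^-`. -/
def monNeg (N : ℕ) (S : CSSeed K) (i : ℕ) : K := ∏ j ∈ Icc 1 N, S.x j ^ (-S.B j i).toNat

/-- `ŷ_{i;s} = (p_{i;s} / p_{i;0}) (M_i^+ / M_i^-)^s`. -/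
def yhat (N : ℕ) (S : CSSeed K) (i s : ℕ) : K :=
  S.p i s / S.p i 0 * (S.monPos N i / S.monNeg N i) ^ s

/-- The relation `S ∼ S'` over the coefficient group `P`. -/
def Equivalent (N : ℕ) (P : Set K) (S S' : CSSeed K) : Prop :=
  ∀ i ∈ Icc 1 N, S.d i = S'.d i ∧ S.x i / S'.x i ∈ P ∧
    ∀ s ∈ Icc 1 (S.d i), S.yhat N i s = S'.yhat N i s

/-- The image of a seed under a map of ambient (semi)fields. -/
def map (ψ : K → K') (S : CSSeed K) : CSSeed K' where
  x i := ψ (S.x i)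
  B := S.B
  d := S.d
  p i s := ψ (S.p i s)

end CSSeed

section

variable {K K' : Type} [Field K] [Field K']

/-- The multiplicative group of Laurent monomials in a set of (nonzero) elements of a field. -/
def laurentMonomials (G : Set K) : Set K :=
  {f | ∃ u ∈ Subgroup.closure {u : Kˣ | (u : K) ∈ G}, f = u}

/-- Subtraction-free rational expressions in a set of elements of a field. -/
inductive SubtractionFree (G : Set K) : K → Prop
  | of {f : K} : f ∈ G → SubtractionFree G f
  | add {f g : K} : SubtractionFree G f → SubtractionFree G g → SubtractionFree G (f + g)
  | mul {f g : K} : SubtractionFree G f → SubtractionFree G g → SubtractionFree G (f * g)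
  | div {f g : K} : SubtractionFree G f → SubtractionFree G g → SubtractionFree G (f / g)

/-- The ambient semifield `F_{>0}` of a seed `S` over the coefficient group `P`: subtraction-free
rational expressions in the cluster variables with coefficients in `P`. -/
def ambient (N : ℕ) (P : Set K) (S : CSSeed K) : Set K :=
  {f | SubtractionFree ({g | ∃ i ∈ Icc 1 N, g = S.x i} ∪ P) f}

/-- `ψ` (of which only the values on the ambient semifield of `S` matter) is a quasi-homomorphism from
the generalized cluster algebra of the seed `S` over `P` to that of the seed `S'` over `P'`:
a homomorphism of ambient semifields with `ψ(P) ⊆ P'` and `ψ(S) ∼ S'`. -/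
structure IsQuasiHom (N : ℕ) (P : Set K) (S : CSSeed K) (P' : Set K') (S' : CSSeed K')
    (ψ : K → K') : Prop where
  source : S.IsSeedOver N P
  target : S'.IsSeedOver N P'
  mapsTo : ∀ f ∈ ambient N P S, ψ f ∈ ambient N P' S'
  map_add : ∀ f ∈ ambient N P S, ∀ g ∈ ambient N P S, ψ (f + g) = ψ f + ψ g
  map_mul : ∀ f ∈ ambient N P S, ∀ g ∈ ambient N P S, ψ (f * g) = ψ f * ψ g
  map_coeff : ∀ f ∈ P, ψ f ∈ P'
  equivalent : (S.map ψ).Equivalent N P' S'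

end

/-- The rational function `f` in indeterminates `V` is defined at the point `a`, with value `c`. -/
def HasValueAt {V : Type} (a : V → ℂ) (f : FractionRing (MvPolynomial V ℂ)) (c : ℂ) : Prop :=
  ∃ g h : MvPolynomial V ℂ, MvPolynomial.eval a h ≠ 0 ∧
    f * algebraMap _ _ h = algebraMap _ _ g ∧
    c = MvPolynomial.eval a g / MvPolynomial.eval a h

/-! ### The two seeds -/

/-- The extended quiver with arrows `x_{i+1} → x_i → x_{i+ℓ} → x_{i+1}`, `1 ≤ i ≤ N`:
number of arrows from `a` to `b`. -/
def arrows (k ℓ a b : ℕ) : ℤ :=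
  ∑ i ∈ Icc 1 (numMutable k ℓ),
    ((if a = i + 1 ∧ b = i then 1 else 0) + (if a = i ∧ b = i + ℓ then 1 else 0)
      + (if a = i + ℓ ∧ b = i + 1 then 1 else 0))

/-- The extended exchange matrix of that quiver. -/
def exchange (k ℓ a b : ℕ) : ℤ := arrows k ℓ a b - arrows k ℓ b a

/-- The exchange degrees: `x_1` is the only special variable, of degree `k`. -/
def degree (k i : ℕ) : ℕ := if i = 1 then k else 1

/-- Initial variables of `𝒜_cyc(k,ℓ)`: mutable `x̄_1,…,x̄_N`, frozen `x̄_{N+j}` with `j` modulo `ℓ`, and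
coefficient string variables `z_1,…,z_{⌊k/2⌋}` (the others are `z_s = z_{k-s}`). -/
inductive CycVar (k ℓ : ℕ) : Type
  | x (i : Set.Icc 1 (numMutable k ℓ))
  | frozen (j : ZMod ℓ)
  | z (s : Set.Icc 1 (k / 2))

/-- The field generated by the initial variables of `𝒜_cyc(k,ℓ)`. -/
abbrev CycField (k ℓ : ℕ) : Type := FractionRing (MvPolynomial (CycVar k ℓ) ℂ)

/-- An initial variable as an element of the field. -/
def cycVar {k ℓ : ℕ} (v : CycVar k ℓ) : CycField k ℓ :=
  algebraMap (MvPolynomial (CycVar k ℓ) ℂ) _ (MvPolynomial.X v)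

/-- The extended cluster variable `x̄_i`, `1 ≤ i ≤ N + ℓ`. -/
def cycX (k ℓ i : ℕ) : CycField k ℓ :=
  if h : 1 ≤ i ∧ i ≤ numMutable k ℓ then cycVar (.x ⟨i, h⟩)
  else cycVar (.frozen ((i - numMutable k ℓ : ℕ) : ZMod ℓ))

/-- The coefficient string variable `z_s`, with `z_0 = z_k = 1` and `z_s = z_{k-s}`. -/
def cycZ (k ℓ s : ℕ) : CycField k ℓ :=
  if h : 1 ≤ min s (k - s) ∧ min s (k - s) ≤ k / 2 then cycVar (.z ⟨min s (k - s), h⟩) else 1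

/-- The coefficient group of `𝒜_cyc(k,ℓ)`. -/
def cycCoeff (k ℓ : ℕ) : Set (CycField k ℓ) :=
  laurentMonomials (Set.range (fun j => cycVar (.frozen j)) ∪ Set.range (fun s => cycVar (.z s)))

/-- The initial seed of `𝒜_cyc(k,ℓ)`, viewed as a non-normalized seed by absorbing the frozen
variables in the coefficient strings. -/
def cycSeed (k ℓ : ℕ) : CSSeed (CycField k ℓ) where
  x := cycX k ℓ
  B := exchange k ℓ
  d := degree k
  p i s := (if i = 1 then cycZ k ℓ s else 1) *
    ∏ j ∈ Icc (numMutable k ℓ + 1) (numMutable k ℓ + ℓ),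
      cycX k ℓ j ^ (s * (exchange k ℓ j i).toNat + (degree k i - s) * (-exchange k ℓ j i).toNat)

/-- Initial variables of `𝒜_GSV(k,ℓ)`: mutable `x_1,…,x_N`, frozen entries `M_{j,j}` and `M_{j,j+k}` with
`j` modulo `ℓ`, and coefficient string variables `c̃_1,…,c̃_{k-1}`. -/
inductive GSVVar (k ℓ : ℕ) : Type
  | x (i : Set.Icc 1 (numMutable k ℓ))
  | diag (j : ZMod ℓ)
  | outer (j : ZMod ℓ)
  | c (s : Set.Icc 1 (k - 1))

/-- The field generated by the initial variables of `𝒜_GSV(k,ℓ)`. -/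
abbrev GSVField (k ℓ : ℕ) : Type := FractionRing (MvPolynomial (GSVVar k ℓ) ℂ)

/-- An initial variable as an element of the field. -/
def gsvVar {k ℓ : ℕ} (v : GSVVar k ℓ) : GSVField k ℓ :=
  algebraMap (MvPolynomial (GSVVar k ℓ) ℂ) _ (MvPolynomial.X v)

/-- The mutable variable `x_i`, `1 ≤ i ≤ N`. -/
def gsvX (k ℓ i : ℕ) : GSVField k ℓ :=
  if h : 1 ≤ i ∧ i ≤ numMutable k ℓ then gsvVar (.x ⟨i, h⟩) else 1

/-- The frozen variable `M_{i,i}`. -/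
def gsvDiag (k ℓ : ℕ) (i : ℤ) : GSVField k ℓ := gsvVar (.diag (i : ZMod ℓ))

/-- The frozen variable `M_{i,i+k}`. -/
def gsvOuter (k ℓ : ℕ) (i : ℤ) : GSVField k ℓ := gsvVar (.outer (i : ZMod ℓ))

/-- The coefficient string variable `c̃_s`, `1 ≤ s ≤ k - 1`. -/
def gsvC (k ℓ s : ℕ) : GSVField k ℓ :=
  if h : 1 ≤ s ∧ s ≤ k - 1 then gsvVar (.c ⟨s, h⟩) else 1

/-- The coefficient group of `𝒜_GSV(k,ℓ)`. -/
def gsvCoeff (k ℓ : ℕ) : Set (GSVField k ℓ) :=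
  laurentMonomials (Set.range (fun j => gsvVar (.diag j)) ∪ Set.range (fun j => gsvVar (.outer j)) ∪
    Set.range (fun s => gsvVar (.c s)))

/-- The coefficients of the initial exchange polynomials of `𝒜_GSV(k,ℓ)`. For the special variable and
`k ≥ 3` the exchange relation is
`x_1 x_1' = ∏_{1≤i≤ℓ} M_{i,i} ∏_{2≤i≤ℓ} M_{i,i+k}^{k-1} x_{ℓ+1}^k
  + ∑_{0<s<k} c̃_{k-s} ∏_{2≤i≤ℓ} M_{i,i+k}^{k-1-s} x_2^s x_{ℓ+1}^{k-s} + M_{1,k+1} x_2^k`;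
for `k = 2`, where there is no mutable `x_{ℓ+1}`, it is
`x_1 x_1' = ∏_{i≠2} M_{i,i} ∏_{2≤i≤ℓ} M_{i,i+2} + c̃_1 x_2 + M_{1,3} M_{2,2} x_2^2`.
For `2 ≤ i ≤ N` it is `x_i x_i' = M_i^- + p M_i^+`, where `p` is the product of `M_{i,i+k}` (present when
`i ≤ ℓ`) and of `M_{i+k-1,i+k-1}` (present when `N - ℓ + 2 ≤ i`). -/
def gsvP (k ℓ i s : ℕ) : GSVField k ℓ :=
  if i = 1 then
    if k = 2 then
      if s = 0 then
        (∏ a ∈ (Icc 1 ℓ).erase 2, gsvDiag k ℓ a) * ∏ a ∈ Icc 2 ℓ, gsvOuter k ℓ a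
      else if s = 1 then gsvC k ℓ 1
      else gsvOuter k ℓ 1 * gsvDiag k ℓ 2
    else
      if s = 0 then
        (∏ a ∈ Icc 1 ℓ, gsvDiag k ℓ a) * ∏ a ∈ Icc 2 ℓ, gsvOuter k ℓ a ^ (k - 1)
      else if s < k then gsvC k ℓ (k - s) * ∏ a ∈ Icc 2 ℓ, gsvOuter k ℓ a ^ (k - 1 - s)
      else gsvOuter k ℓ 1
  else if s = 0 then 1
  else (if i ≤ ℓ then gsvOuter k ℓ i else 1) *
    (if numMutable k ℓ + 2 ≤ i + ℓ then gsvDiag k ℓ (i + k - 1) else 1)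

/-- The initial seed of `𝒜_GSV(k,ℓ)`. -/
def gsvSeed (k ℓ : ℕ) : CSSeed (GSVField k ℓ) where
  x := gsvX k ℓ
  B := exchange k ℓ
  d := degree k
  p := gsvP k ℓ

/-- The values at a band matrix of the initial variables of `𝒜_GSV(k,ℓ)`. -/
def gsvPoint (k ℓ : ℕ) (M : Matrix ℤ ℤ ℂ) : GSVVar k ℓ → ℂ
  | .x i => initMinor k ℓ i M
  | .diag j => M j.val j.val
  | .outer j => M j.val (j.val + k)
  | .c s => coeffString k ℓ s M

/-- The values of the initial variables of `𝒜_cyc(k,ℓ)` after the identification `x̄_i = Δ_{I_i}` and the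
specialization `z_s = η_s`. -/
def cycPoint {k n : ℕ} (ℓ p : ℕ) (X : Matrix (Fin k) (Fin n) ℂ) : CycVar k ℓ → ℂ
  | .x i => plucker X (initSet k ℓ i)
  | .frozen j => plucker X (initSet k ℓ (numMutable k ℓ + resIcc ℓ j.val))
  | .z s => eta k p s

/-- The defining formulas of `ψ^*` on the cluster variables and the frozen entries. -/
def PsiOnVariables (k ℓ : ℕ) (ψ : GSVField k ℓ → CycField k ℓ) : Prop :=
  (∀ i ∈ Icc 1 (numMutable k ℓ), ψ (gsvX k ℓ i) =
    cycX k ℓ i * ∏ b ∈ Ico i (numMutable k ℓ), cycX k ℓ (numMutable k ℓ + resIcc ℓ (b + k))) ∧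
  ∀ i : ℤ, ψ (gsvDiag k ℓ i) = cycX k ℓ (numMutable k ℓ + resIcc ℓ (i - 1)) ∧
    ψ (gsvOuter k ℓ (i - k - 1)) = cycX k ℓ (numMutable k ℓ + resIcc ℓ (i - 1))

/-- The defining formulas of `ψ^*` on the coefficient string variables. -/
def PsiOnCoefficients (k ℓ : ℕ) (ψ : GSVField k ℓ → CycField k ℓ) : Prop :=
  ∀ s ∈ Icc 1 (k - 1), ψ (gsvC k ℓ s) =
    cycZ k ℓ s * ∏ i ∈ Icc 1 ℓ, cycX k ℓ (numMutable k ℓ + i)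

end CyclicLocus

end

open CyclicLocus

/-! A point of the fixed locus is a full-rank `X` with `X * ρ ^ ℓ = T * X` for a unique `k × k`
matrix `T`. Extended by the sign rule v_{a+n} = (-1)^(k-1) v_a, its columns satisfy v_{a+ℓ} = T v_a,
and column j of `phi' X` lists the minors of k+1 consecutive vectors with one omitted. Up to signs
these are the coefficients of the Cramer relation between the k+1 vectors.

Spectrum of T. The shift ρ has k eigenvectors forming a projective Vandermonde matrix W whose
maximal minors are positive up to a common factor. If X is totally nonnegative, Cauchy–Binet makes X
W invertible, and X W conjugates T to the diagonal matrix of the numbers exp(πi(k-1-2j)/p). Since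
T^p is the scalar (-1)^(k-1), each value of the characteristic polynomial is restricted to a finite
set, so it is constant on a connected component (`det_sub_of_mem_distinguished`). In particular det
T = 1 on 𝒟, so Plücker coordinates are ℓ-periodic and `phi' X` is a periodic band matrix.

Minors. Maximal minors of a matrix of relations are proportional to the complementary minors of the
vectors; here the factor is a product of minors of consecutive vectors (`det_bandEntry`). The rows
used by x_i are exactly the complement of I_i in {i,…,(k-1)ℓ+1}, which gives Part 1 (`initRows_eq`,
`initMinor_phi'`).

Coefficient strings. For a left eigenvector u of T with eigenvalue λ, the sequence (-1)^a u·v_a is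
annihilated by all relations and is quasi-periodic under a ↦ a+ℓ. One period of it lies in the left
kernel of tB + A when tλ = (-1)^ℓ. This supplies k distinct nonzero roots of det(tB + A); the factor
t^(ℓ-k) and the leading coefficient det B determine the rest (`det_smul_matB_add_matA_eq`). The
coefficients are elementary symmetric functions of the eigenvalues of T, identified with η_s when k
is 2 or 3.

Quasi-homomorphism. ψ* is induced by a substitution of monomials. The substitution is not injective
(M_{i,i} and M_{i-k-1,i-1} have the same image), so it does not extend to the fraction field.
Setting all variables equal to 1 is compatible with it, however, and subtraction-free expressions
have positive numerator and denominator there, so their denominators survive. The frozen factors of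
the ψ*(x_i) telescope, which reduces the comparison of the ŷ to monomials in frozen variables.
Realization by φ' is then Parts 1 and 2 read variable by variable (`eval_cycPoint_psiVar`). -/

noncomputable section

namespace CyclicLocus

open Finset Polynomial

/-! ### Columns under the signed cyclic shift. -/

section Shift

variable {k n : ℕ}

/-- The columns of `X`, numbered by natural numbers starting with `0` and extended by
`v_{a+n} = (-1)^{k-1} v_a`. -/
def extCol [NeZero n] (X : Matrix (Fin k) (Fin n) ℂ) (a : ℕ) (i : Fin k) : ℂ :=
  ((-1) ^ (k - 1)) ^ (a / n) * X i (Fin.ofNat n a)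

theorem extCol_of_lt [NeZero n] (X : Matrix (Fin k) (Fin n) ℂ) (c : Fin n) (i : Fin k) :
    extCol X c i = X i c := by
  simp [extCol, Nat.div_eq_of_lt c.2]

/-- The corner entry of ρ is the sign in the rule v_{a+n} = (-1)^(k-1) v_a, so the shift is uniform
on extended columns, including the one that wraps. -/
theorem mul_rho_apply [NeZero n] (X : Matrix (Fin k) (Fin n) ℂ) (i : Fin k) (c : Fin n) :
    (X * rho k n) i c = extCol X (c + 1) i := by
  have hn : 0 < n := Nat.pos_of_ne_zero (NeZero.ne n)
  rw [Matrix.mul_apply]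
  rcases Nat.lt_or_ge ((c : ℕ) + 1) n with h | h
  · rw [Finset.sum_eq_single (⟨c + 1, h⟩ : Fin n)]
    · have := extCol_of_lt X ⟨c + 1, h⟩ i
      simp only at this
      rw [this]
      simp [rho]
    · intro b _ hb
      have h1 : ¬ (b : ℕ) = c + 1 := fun h' => hb (Fin.ext h')
      have h2 : ¬ ((c : ℕ) + 1 = n) := by omega
      simp [rho, h1, h2]
    · simp
  · have hc : (c : ℕ) + 1 = n := by have := c.2; omega
    rw [Finset.sum_eq_single (⟨0, hn⟩ : Fin n)]
    · have h1 : Fin.ofNat n n = ⟨0, hn⟩ := Fin.ext (Nat.mod_self n)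
      simp only [rho, Matrix.of_apply, hc, extCol, h1, Nat.div_self hn, pow_one, hn.ne, if_false,
        true_and, if_true]
      exact mul_comm _ _
    · intro b _ hb
      have h1 : ¬ (b : ℕ) = c + 1 := by have := b.2; omega
      have h2 : ¬ ((b : ℕ) = 0) := fun h' => hb (Fin.ext h')
      rw [hc] at h1
      simp only [rho, Matrix.of_apply, hc, h1, h2, if_false, false_and, mul_zero]
    · simp

theorem extCol_mul_rho [NeZero n] (X : Matrix (Fin k) (Fin n) ℂ) (a : ℕ) (i : Fin k) :
    extCol (X * rho k n) a i = extCol X (a + 1) i := by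
  have hn : 0 < n := Nat.pos_of_ne_zero (NeZero.ne n)
  rw [extCol, mul_rho_apply, extCol, extCol, ← mul_assoc, ← pow_add]
  have h1 : ((Fin.ofNat n a : Fin n) : ℕ) = a % n := rfl
  rw [h1]
  have h2 : (a + 1) = (a % n + 1) + n * (a / n) := by have := Nat.mod_add_div a n; omega
  congr 2
  · conv_rhs => rw [h2]
    rw [Nat.add_mul_div_left _ _ hn, add_comm]
  · ext
    simp

theorem extCol_mul_rho_pow [NeZero n] (X : Matrix (Fin k) (Fin n) ℂ) (m a : ℕ) (i : Fin k) :
    extCol (X * rho k n ^ m) a i = extCol X (a + m) i := by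
  induction m generalizing a with
  | zero => simp
  | succ m ih => rw [pow_succ, ← Matrix.mul_assoc, extCol_mul_rho, ih, add_assoc, add_comm 1]

theorem mul_rho_pow_apply [NeZero n] (X : Matrix (Fin k) (Fin n) ℂ) (m : ℕ) (i : Fin k)
    (c : Fin n) : (X * rho k n ^ m) i c = extCol X (c + m) i := by
  rw [← extCol_of_lt (X * rho k n ^ m) c i, extCol_mul_rho_pow]

theorem mul_rho_pow_self [NeZero n] (X : Matrix (Fin k) (Fin n) ℂ) :
    X * rho k n ^ n = ((-1 : ℂ) ^ (k - 1)) • X := by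
  have hn : 0 < n := Nat.pos_of_ne_zero (NeZero.ne n)
  ext i c
  have hc : ((c : ℕ) + n) / n = 1 := by
    rw [Nat.add_div_right _ hn, Nat.div_eq_of_lt c.2]
  have h2 : Fin.ofNat n (c + n) = c := by ext; simp [Nat.mod_eq_of_lt c.2]
  rw [mul_rho_pow_apply, extCol, hc, h2, pow_one, Matrix.smul_apply, smul_eq_mul]

/-- Right multiplication by `ρ` is invertible. -/
theorem mul_inv_rho_mul_rho [NeZero n] (hk : 0 < k) (X : Matrix (Fin k) (Fin n) ℂ) (m : ℕ) :
    X * (rho k n)⁻¹ ^ m * rho k n ^ m = X := by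
  -- The entries are read off from `mul_rho_pow_self` applied to a matrix all of whose rows are the
  -- basis vector e_a; `hk` provides a row to look at.
  have hρ : rho k n ^ n = ((-1 : ℂ) ^ (k - 1)) • 1 := by
    ext a b
    have := congrFun (congrFun (mul_rho_pow_self (k := k) (n := n)
      (Matrix.of fun _ c => if c = a then 1 else 0)) ⟨0, hk⟩) b
    simpa [Matrix.mul_apply, Matrix.one_apply, eq_comm] using this
  have hu : IsUnit (rho k n).det := by
    have : IsUnit ((rho k n) ^ n).det := by
      rw [hρ]
      simp
    rw [Matrix.det_pow] at this
    exact (isUnit_pow_iff (NeZero.ne n)).1 this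
  rw [Matrix.mul_assoc, ← (Commute.mul_pow ((Matrix.nonsing_inv_mul _ hu).trans
    (Matrix.mul_nonsing_inv _ hu).symm)), Matrix.nonsing_inv_mul _ hu, one_pow, Matrix.mul_one]

end Shift

/-! ### Minors as determinants of strictly increasing families of columns -/

theorem maxMinor_eq_det {k n : ℕ} (X : Matrix (Fin k) (Fin n) ℂ) {I : Finset (Fin n)}
    {f : Fin k → Fin n} (hf : StrictMono f) (hI : ∀ x, x ∈ I ↔ ∃ t, f t = x) :
    maxMinor X I = (X.submatrix id f).det := by
  have hI' : I = univ.image f := by ext x; simp [hI]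
  have hc : I.card = k := by rw [hI', card_image_of_injective _ hf.injective]; simp
  rw [maxMinor, dif_pos hc, ← orderEmbOfFin_unique hc (fun t => (hI _).2 ⟨t, rfl⟩) hf]

theorem maxMinor_mul_left {k n : ℕ} (T : Matrix (Fin k) (Fin k) ℂ) (X : Matrix (Fin k) (Fin n) ℂ)
    (I : Finset (Fin n)) : maxMinor (T * X) I = T.det * maxMinor X I := by
  unfold maxMinor
  split_ifs with h
  · rw [← Matrix.det_mul]
    congr 1
  · simp

/-- The cyclic successor of a column. -/
def nextCol {n : ℕ} [NeZero n] (c : Fin n) : Fin n := Fin.ofNat n ((c : ℕ) + 1)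

theorem nextCol_injective {n : ℕ} [NeZero n] : Function.Injective (nextCol (n := n)) := by
  intro a b h
  have h' : ((a : ℕ) + 1) ≡ (b + 1) [MOD n] := congrArg Fin.val h
  have h2 := Nat.ModEq.add_right_cancel' 1 h'
  exact Fin.ext (by rw [← Nat.mod_eq_of_lt a.2, ← Nat.mod_eq_of_lt b.2]; exact h2)

/-- If the last column of I wraps around, restoring increasing order costs a k-cycle of sign
(-1)^(k-1), which cancels the sign of the corner entry. Otherwise there is no sign at all. -/
theorem maxMinor_mul_rho {k n : ℕ} (hk : 0 < k) [NeZero n] (X : Matrix (Fin k) (Fin n) ℂ)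
    (I : Finset (Fin n)) :
    maxMinor (X * rho k n) I = maxMinor X (I.image nextCol) := by
  have hn : 0 < n := Nat.pos_of_ne_zero (NeZero.ne n)
  by_cases hI : I.card = k
  swap
  · rw [maxMinor, maxMinor, dif_neg hI, dif_neg (by rwa [card_image_of_injective _ nextCol_injective])]
  obtain ⟨k, rfl⟩ : ∃ m, k = m + 1 := ⟨k - 1, by omega⟩
  set e := I.orderEmbOfFin hI with he
  have hmono : StrictMono e := (I.orderEmbOfFin hI).strictMono
  have hmem : ∀ x, x ∈ I ↔ ∃ t, e t = x := by
    intro x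
    rw [← mem_coe, ← range_orderEmbOfFin I hI]; rfl
  rw [maxMinor_eq_det _ hmono hmem]
  by_cases hl : ((e (Fin.last k) : Fin n) : ℕ) + 1 < n
  · have hlt : ∀ t, (e t : ℕ) + 1 < n := fun t =>
      lt_of_le_of_lt (Nat.add_le_add_right (hmono.monotone (Fin.le_last t)) 1) hl
    rw [maxMinor_eq_det X (f := fun t => nextCol (e t))]
    · congr 1
      ext i t
      simp only [Matrix.submatrix_apply, id]
      rw [mul_rho_apply, extCol, Nat.div_eq_of_lt (hlt t)]; simp [nextCol]
    · intro s t hst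
      have := hmono hst
      rw [Fin.lt_def] at this ⊢
      simp only [nextCol, Fin.ofNat, Nat.mod_eq_of_lt (hlt _)]
      omega
    · intro x
      simp only [mem_image, hmem]
      constructor
      · rintro ⟨_, ⟨t, rfl⟩, rfl⟩; exact ⟨t, rfl⟩
      · rintro ⟨t, rfl⟩; exact ⟨_, ⟨t, rfl⟩, rfl⟩
  · have hlast : ((e (Fin.last k) : Fin n) : ℕ) + 1 = n := by
      have := (e (Fin.last k)).2; omega
    have hlt : ∀ t : Fin k, (e t.castSucc : ℕ) + 1 < n := by
      intro t
      have := hmono (Fin.castSucc_lt_last t)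
      rw [Fin.lt_def] at this; omega
    -- The shifted columns in increasing order: the wrapped column comes first.
    let f : Fin (k + 1) → Fin n := Fin.cons ⟨0, hn⟩ fun t => nextCol (e t.castSucc)
    have hf : StrictMono f := by
      have hv : ∀ t : Fin k, (nextCol (e t.castSucc) : ℕ) = e t.castSucc + 1 := fun t => by
        simp [nextCol, Nat.mod_eq_of_lt (hlt t)]
      intro s t hst
      rw [Fin.lt_def]
      obtain ⟨t, rfl⟩ := Fin.exists_succ_eq.2 (Fin.ne_zero_of_lt hst)
      refine Fin.cases ?_ (fun s => ?_) s hst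
      · intro; simp [f, hv]
      · intro hst
        have := hmono (Fin.castSucc_lt_castSucc_iff.2 (Fin.succ_lt_succ_iff.1 hst))
        rw [Fin.lt_def] at this
        simpa [f, hv] using this
    have hfe : ∀ t, f (finRotate (k + 1) t) = nextCol (e t) := by
      intro t
      refine Fin.lastCases ?_ (fun t => ?_) t
      · rw [finRotate_last]
        ext
        simp [f, nextCol, hlast]
      · have : finRotate (k+1) t.castSucc = t.succ := by
          simp
        rw [this]
        simp [f]
    rw [maxMinor_eq_det X hf]
    -- The diagonal factor carries the corner sign of the wrapped column. Its determinant and the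
    -- sign of the rotation are both (-1)^k, with k now one less than the number of rows.
    · have h1 : (X * rho (k + 1) n).submatrix id e =
          ((X.submatrix id f).submatrix id (finRotate (k + 1))) *
            Matrix.diagonal (fun t => if t = Fin.last k then (-1 : ℂ) ^ k else 1) := by
        ext i t
        rw [Matrix.mul_diagonal]
        simp only [Matrix.submatrix_apply, id, hfe]
        rw [mul_rho_apply, extCol, nextCol]
        refine Fin.lastCases ?_ (fun t => ?_) t
        · rw [hlast]; simp [mul_comm, hn]
        · rw [Nat.div_eq_of_lt (hlt t)]
          simp [(Fin.castSucc_lt_last t).ne]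
      rw [h1, Matrix.det_mul, Matrix.det_permute', Matrix.det_diagonal, sign_finRotate]
      rw [Finset.prod_ite_eq' ]
      simp only [mem_univ, if_true]
      push_cast
      rw [mul_right_comm, ← mul_pow]
      simp
    · intro x
      simp only [mem_image, hmem]
      constructor
      · rintro ⟨_, ⟨t, rfl⟩, rfl⟩; exact ⟨finRotate _ t, hfe t⟩
      · rintro ⟨t, rfl⟩
        exact ⟨_, ⟨(finRotate _).symm t, rfl⟩, by rw [← hfe]; simp⟩

theorem residues_image_add_one {n : ℕ} [NeZero n] (I : Finset ℤ) :
    residues n (I.image (· + 1)) = (residues n I).image nextCol := by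
  have hn : 0 < n := Nat.pos_of_ne_zero (NeZero.ne n)
  have hnext : ∀ c : Fin n, ((nextCol c : ℕ) : ℤ) ≡ (c : ℕ) + 1 [ZMOD n] := by
    intro c
    have : ((nextCol c : ℕ)) = ((c : ℕ) + 1) % n := rfl
    rw [this]; push_cast
    exact Int.mod_modEq _ _
  have hsurj : Function.Surjective (nextCol (n := n)) :=
    Finite.surjective_of_injective nextCol_injective
  ext c
  obtain ⟨c, rfl⟩ := hsurj c
  simp only [residues, mem_filter, mem_univ, true_and, mem_image]
  constructor
  · rintro ⟨_, ⟨i, hi, rfl⟩, h⟩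
    exact ⟨c, ⟨i, hi, (hnext c).symm.trans (Int.ModEq.add_right_cancel' 1 h)⟩, rfl⟩
  · rintro ⟨c', ⟨i, hi, h⟩, hc⟩
    rw [nextCol_injective hc] at h
    exact ⟨_, ⟨i, hi, rfl⟩, ((hnext c).trans h).add_right 1⟩

theorem plucker_mul_rho {k n : ℕ} (hk : 0 < k) [NeZero n] (X : Matrix (Fin k) (Fin n) ℂ)
    (I : Finset ℤ) : plucker (X * rho k n) I = plucker X (I.image (· + 1)) := by
  rw [plucker, plucker, maxMinor_mul_rho hk, residues_image_add_one]

theorem plucker_mul_rho_pow {k n : ℕ} (hk : 0 < k) [NeZero n] (X : Matrix (Fin k) (Fin n) ℂ)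
    (m : ℕ) (I : Finset ℤ) :
    plucker (X * rho k n ^ m) I = plucker X (I.image (· + (m : ℤ))) := by
  induction m generalizing I with
  | zero => simp
  | succ m ih =>
    rw [pow_succ, ← Matrix.mul_assoc, plucker_mul_rho hk, ih, image_image]
    congr 2; ext x; simp; ring

theorem plucker_eq_det {k n : ℕ} [NeZero n] (X : Matrix (Fin k) (Fin n) ℂ) {I : Finset ℤ}
    {f : Fin k → ℕ} (hf : StrictMono f) (hn : ∀ t, f t < n)
    (hI : ∀ x : ℤ, x ∈ I ↔ ∃ t, (f t : ℤ) + 1 = x) :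
    plucker X I = (Matrix.of fun i t => extCol X (f t) i).det := by
  have h := maxMinor_eq_det X (I := residues n I) (f := fun t => ⟨f t, hn t⟩)
    (fun s t hst => hf hst) ?_
  · rw [plucker, h]
    congr 1
    ext i t
    exact (extCol_of_lt X ⟨f t, hn t⟩ i).symm
  · intro c
    simp only [residues, mem_filter, mem_univ, true_and]
    constructor
    · rintro ⟨i, hi, h⟩
      obtain ⟨t, rfl⟩ := (hI i).1 hi
      refine ⟨t, Fin.ext ?_⟩
      have h2 : ((c : ℕ) : ℤ) ≡ (f t : ℕ) [ZMOD n] := Int.ModEq.add_right_cancel' 1 h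
      have h3 := (Int.natCast_modEq_iff.1 h2)
      rw [Nat.ModEq, Nat.mod_eq_of_lt c.2, Nat.mod_eq_of_lt (hn t)] at h3
      exact h3.symm
    · rintro ⟨t, rfl⟩
      exact ⟨_, (hI _).2 ⟨t, rfl⟩, rfl⟩

/-- The twist by ρ^(-k) undoes the translation by k that τ introduces. -/
theorem phi'_apply {k n : ℕ} [NeZero n] (hk : 0 < k) (X : Matrix (Fin k) (Fin n) ℂ) (i j : ℤ) :
    phi' X i j = plucker X ((Icc (j - k) j).erase i) := by
  set Y := X * (rho k n)⁻¹ ^ k with hY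
  have hX : X = Y * rho k n ^ k := (mul_inv_rho_mul_rho hk X k).symm
  rw [phi', tau, phi, ← hY, hX, plucker_mul_rho_pow hk]
  congr 1
  ext x
  simp only [mem_erase, mem_Icc, mem_image]
  constructor
  · rintro ⟨h1, h2, h3⟩
    exact ⟨x - k, ⟨by omega, by omega, by omega⟩, by omega⟩
  · rintro ⟨y, ⟨h1, h2, h3⟩, rfl⟩
    exact ⟨by omega, by omega, by omega⟩

/-- Since k < n, the k+1 consecutive integers have distinct residues, so `maxMinor` takes its
default value 0. This makes `phi' X` vanish off the band: there the omitted index is absent and the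
interval keeps all k+1 elements. -/
theorem plucker_eq_zero_of_Icc {k n : ℕ} (hn : k < n) (X : Matrix (Fin k) (Fin n) ℂ)
    (j : ℤ) : plucker X (Icc (j - k) j) = 0 := by
  rw [plucker, maxMinor, dif_neg]
  intro hc
  have hn0 : (0 : ℤ) < n := by omega
  let g : ℤ → Fin n := fun a => ⟨((a - 1) % n).toNat, by
    have h1 := Int.emod_lt_of_pos (a - 1) hn0
    have h2 := Int.emod_nonneg (a - 1) hn0.ne'
    omega⟩
  have hg : ∀ a, ((g a : ℕ) : ℤ) + 1 ≡ a [ZMOD n] := by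
    intro a
    have h2 := Int.emod_nonneg (a - 1) hn0.ne'
    have : ((g a : ℕ) : ℤ) = (a - 1) % n := by simp [g, h2]
    rw [this]
    simpa using (Int.mod_modEq (a - 1) n).add_right 1
  have : (Icc (j - k) j).card ≤ (residues n (Icc (j - k) j)).card := by
    refine card_le_card_of_injOn g ?_ ?_
    · intro a ha
      simp only [residues, coe_filter, mem_univ, true_and, Set.mem_ofPred_eq]
      exact ⟨a, ha, hg a⟩
    · intro a ha b hb hab
      have h : a ≡ b [ZMOD n] := (hg a).symm.trans (hab ▸ hg b)
      simp only [coe_Icc, Set.mem_Icc] at ha hb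
      have h3 := h.dvd
      by_contra hne
      have := Int.eq_zero_of_abs_lt_dvd h3 (by rw [abs_lt]; omega)
      omega
  rw [hc, Int.card_Icc] at this
  omega

/-! ### The action of `ρ ^ ℓ` on a fixed subspace. -/

section Intertwiner

variable {k n ℓ : ℕ}

theorem vecMul_injective_of_rank {X : Matrix (Fin k) (Fin n) ℂ} (h : X.rank = k) :
    Function.Injective X.vecMul := by
  rw [Matrix.vecMul_injective_iff, linearIndependent_iff_card_eq_finrank_span, Fintype.card_fin]
  rw [Matrix.rank_eq_finrank_span_row] at h
  exact h.symm

theorem mul_right_cancel_of_rank {X : Matrix (Fin k) (Fin n) ℂ} (h : X.rank = k)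
    {A B : Matrix (Fin k) (Fin k) ℂ} (hAB : A * X = B * X) : A = B := by
  ext i j
  exact congrFun (vecMul_injective_of_rank h (congrFun hAB i)) j

/-- A point of the fixed locus is an invariant subspace, on which `ρ ^ ℓ` acts by a `k × k` matrix. -/
theorem exists_intertwiner {X : Matrix (Fin k) (Fin n) ℂ} (hX : X ∈ fixedLocus k n ℓ) :
    ∃ T : Matrix (Fin k) (Fin k) ℂ, X * rho k n ^ ℓ = T * X := by
  have h : ∀ i, ∃ u : Fin k → ℂ, Matrix.vecMul u X = (X * rho k n ^ ℓ) i := by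
    intro i
    have : (X * rho k n ^ ℓ) i ∈ rowSpan X := by
      rw [← hX.2]
      exact Submodule.subset_span ⟨i, rfl⟩
    rw [rowSpan, ← range_vecMulLinear] at this
    exact this
  choose T hT using h
  exact ⟨T, by ext i j; rw [← hT]; rfl⟩

theorem mul_rho_pow_mul_eq {X : Matrix (Fin k) (Fin n) ℂ} {T : Matrix (Fin k) (Fin k) ℂ}
    (hT : X * rho k n ^ ℓ = T * X) (m : ℕ) : X * rho k n ^ (m * ℓ) = T ^ m * X := by
  induction m with
  | zero => simp
  | succ m ih =>
    rw [add_mul, one_mul, pow_add, ← Matrix.mul_assoc, ih, Matrix.mul_assoc, hT, ← Matrix.mul_assoc,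
      pow_succ]

/-- The p-th power of `ρ ^ ℓ` acts as the scalar of ρ^n, and full rank allows `X` to be cancelled.
-/
theorem intertwiner_pow {p : ℕ} [NeZero n] (hn : n = p * ℓ) {X : Matrix (Fin k) (Fin n) ℂ}
    (hX : X.rank = k) {T : Matrix (Fin k) (Fin k) ℂ} (hT : X * rho k n ^ ℓ = T * X) :
    T ^ p = ((-1 : ℂ) ^ (k - 1)) • 1 := by
  apply mul_right_cancel_of_rank hX
  rw [← mul_rho_pow_mul_eq hT, ← hn, mul_rho_pow_self, Matrix.smul_mul, Matrix.one_mul]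

theorem extCol_add [NeZero n] {X : Matrix (Fin k) (Fin n) ℂ} {T : Matrix (Fin k) (Fin k) ℂ}
    (hT : X * rho k n ^ ℓ = T * X) (a : ℕ) : extCol X (a + ℓ) = T.mulVec (extCol X a) := by
  ext i
  rw [← extCol_mul_rho_pow, hT]
  simp only [extCol, Matrix.mul_apply, Matrix.mulVec, dotProduct, mul_sum]
  exact sum_congr rfl fun j _ => by ring

theorem plucker_add [NeZero n] (hk : 0 < k) {X : Matrix (Fin k) (Fin n) ℂ}
    {T : Matrix (Fin k) (Fin k) ℂ} (hT : X * rho k n ^ ℓ = T * X) (I : Finset ℤ) :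
    plucker X (I.image (· + (ℓ : ℤ))) = T.det * plucker X I := by
  rw [← plucker_mul_rho_pow hk, hT, plucker, maxMinor_mul_left, plucker]

end Intertwiner

/-! ### The Cauchy–Binet formula, summed over all families of columns -/

section CauchyBinet

variable {R : Type*} [CommRing R] {k n : ℕ}

theorem det_mul_eq_sum (A : Matrix (Fin k) (Fin n) R) (B : Matrix (Fin n) (Fin k) R) :
    (A * B).det = ∑ f : Fin k → Fin n, (A.submatrix id f).det * ∏ i, B (f i) i := by
  simp only [Matrix.det_apply', Matrix.mul_apply, prod_univ_sum, mul_sum, Fintype.piFinset_univ]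
  rw [Finset.sum_comm]
  simp only [prod_mul_distrib, sum_mul, mul_assoc, Matrix.submatrix_apply, id]

/-- Averaging the multilinear expansion over all reorderings of f turns the product of entries of
`B` into a determinant. Summing over all families instead of k-subsets is what produces the factor
k!. -/
theorem factorial_mul_det_mul (A : Matrix (Fin k) (Fin n) R) (B : Matrix (Fin n) (Fin k) R) :
    (k.factorial : R) * (A * B).det =
      ∑ f : Fin k → Fin n, (A.submatrix id f).det * (B.submatrix f id).det := by
  have h : ∀ σ : Equiv.Perm (Fin k), (A * B).det =
      ∑ f : Fin k → Fin n, (A.submatrix id f).det *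
        ((Equiv.Perm.sign σ : ℤ) * ∏ i, B (f (σ i)) i) := by
    intro σ
    rw [det_mul_eq_sum, ← (Equiv.arrowCongr σ (Equiv.refl (Fin n))).symm.sum_comp]
    refine sum_congr rfl fun f _ => ?_
    have : (A.submatrix id ((Equiv.arrowCongr σ (Equiv.refl (Fin n))).symm f)) =
        (A.submatrix id f).submatrix id σ := by ext; rfl
    rw [this, Matrix.det_permute', mul_comm (_ : R) (A.submatrix id f).det, mul_assoc]
    rfl
  calc (k.factorial : R) * (A * B).det = ∑ _σ : Equiv.Perm (Fin k), (A * B).det := by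
        simp [Fintype.card_perm]
    _ = ∑ σ : Equiv.Perm (Fin k), ∑ f : Fin k → Fin n, (A.submatrix id f).det *
        ((Equiv.Perm.sign σ : ℤ) * ∏ i, B (f (σ i)) i) := sum_congr rfl fun σ _ => h σ
    _ = _ := by
        rw [sum_comm]
        simp only [← mul_sum, Matrix.det_apply', Matrix.submatrix_apply, id]

theorem exists_strictMono_comp_perm {f : Fin k → Fin n} (hf : Function.Injective f) :
    ∃ σ : Equiv.Perm (Fin k), StrictMono (f ∘ σ) :=
  ⟨Tuple.sort f, (Tuple.monotone_sort f).strictMono_of_injective (hf.comp (Tuple.sort f).injective)⟩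

theorem det_mul_det_comp_perm (A : Matrix (Fin k) (Fin n) R) (B : Matrix (Fin n) (Fin k) R)
    (f : Fin k → Fin n) (σ : Equiv.Perm (Fin k)) :
    (A.submatrix id f).det * (B.submatrix f id).det =
      (A.submatrix id (f ∘ σ)).det * (B.submatrix (f ∘ σ) id).det := by
  have h1 : A.submatrix id (f ∘ σ) = (A.submatrix id f).submatrix id σ := by ext; rfl
  have h2 : B.submatrix (f ∘ σ) id = (B.submatrix f id).submatrix σ id := by ext; rfl
  rw [h1, h2, Matrix.det_permute', Matrix.det_permute]
  have h3 : ((Equiv.Perm.sign σ : ℤ) : R) * (Equiv.Perm.sign σ : ℤ) = 1 := by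
    rw [← Int.cast_mul, ← Units.val_mul, Int.units_mul_self]; simp
  linear_combination (-(A.submatrix id f).det * (B.submatrix f id).det) * h3

theorem det_submatrix_of_not_injective (A : Matrix (Fin k) (Fin n) R) {f : Fin k → Fin n}
    (hf : ¬ Function.Injective f) : (A.submatrix id f).det = 0 := by
  rw [Function.Injective] at hf
  push Not at hf
  obtain ⟨i, j, h, hne⟩ := hf
  exact Matrix.det_zero_of_column_eq hne fun t => by simp [h]

end CauchyBinet

-- The Gram matrix X X* has the same rank as X, hence full rank k. It serves both to find a nonzero
-- maximal minor and as a denominator in `locusChar`.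
open scoped ComplexOrder in
theorem det_mul_conjTranspose_ne_zero {k n : ℕ} {X : Matrix (Fin k) (Fin n) ℂ} (hX : X.rank = k) :
    (X * X.conjTranspose).det ≠ 0 := by
  intro h0
  obtain ⟨u, hu, hu'⟩ := Matrix.exists_vecMul_eq_zero_iff.2 h0
  have hinj := vecMul_injective_of_rank (X := X * X.conjTranspose)
    (by rw [Matrix.rank_self_mul_conjTranspose, hX])
  exact hu (hinj (hu'.trans (Matrix.zero_vecMul _).symm))

theorem exists_det_ne_zero_of_rank {k n : ℕ} {X : Matrix (Fin k) (Fin n) ℂ} (h : X.rank = k) :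
    ∃ g : Fin k → Fin n, StrictMono g ∧ (X.submatrix id g).det ≠ 0 := by
  by_contra! hc
  have hdet := det_mul_conjTranspose_ne_zero h
  have h0 : ((k.factorial : ℕ) : ℂ) * (X * X.conjTranspose).det = 0 := by
    rw [factorial_mul_det_mul]
    refine sum_eq_zero fun f _ => ?_
    by_cases hf : Function.Injective f
    · obtain ⟨σ, hσ⟩ := exists_strictMono_comp_perm hf
      rw [det_mul_det_comp_perm _ _ _ σ, hc _ hσ, zero_mul]
    · rw [det_submatrix_of_not_injective _ hf, zero_mul]
  rcases mul_eq_zero.1 h0 with h1 | h1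
  · exact Nat.factorial_ne_zero k (by exact_mod_cast h1)
  · exact hdet h1

/-- Pairing a totally nonnegative point with a matrix of positive maximal minors. -/
theorem IsTNN.det_mul_ne_zero {k n : ℕ} {X : Matrix (Fin k) (Fin n) ℂ} (hX : X.rank = k)
    (hT : IsTNN X) {W : Matrix (Fin n) (Fin k) ℂ} {c : ℂ} (hc : c ≠ 0)
    (hW : ∀ g : Fin k → Fin n, StrictMono g → ∃ r : ℝ, 0 < r ∧ (W.submatrix g id).det = c * r) :
    (X * W).det ≠ 0 := by
  obtain ⟨b, hb, hT⟩ := hT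
  have hT' : ∀ g : Fin k → Fin n, StrictMono g →
      ∃ r : ℝ, 0 ≤ r ∧ (X.submatrix id g).det = b * r := by
    intro g hg
    obtain ⟨r, hr, h⟩ := hT (univ.image g) (by rw [card_image_of_injective _ hg.injective]; simp)
    exact ⟨r, hr, by rw [← h, maxMinor_eq_det X hg (by simp)]⟩
  -- Each term of the Cauchy–Binet sum is a nonnegative multiple of the one constant b * c, so no
  -- cancellation is possible. A nonzero minor of `X` makes at least one multiple positive.
  have key : ∀ f : Fin k → Fin n, ∃ r : ℝ, 0 ≤ r ∧
      (X.submatrix id f).det * (W.submatrix f id).det = b * c * r := by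
    intro f
    by_cases hf : Function.Injective f
    · obtain ⟨σ, hσ⟩ := exists_strictMono_comp_perm hf
      obtain ⟨r, hr, h1⟩ := hT' _ hσ
      obtain ⟨s, hs, h2⟩ := hW _ hσ
      exact ⟨r * s, by positivity, by rw [det_mul_det_comp_perm _ _ _ σ, h1, h2]; push_cast; ring⟩
    · exact ⟨0, le_rfl, by rw [det_submatrix_of_not_injective _ hf]; simp⟩
  choose r hr hrX using key
  obtain ⟨g, hg, hgX⟩ := exists_det_ne_zero_of_rank hX
  have hpos : 0 < r g := by
    refine lt_of_le_of_ne (hr g) fun h => ?_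
    obtain ⟨s, hs, h2⟩ := hW _ hg
    have h3 := hrX g
    rw [← h, h2] at h3
    have hs' : (s : ℂ) ≠ 0 := by exact_mod_cast hs.ne'
    simp [hgX, hc, hs'] at h3
  intro h0
  have h1 := factorial_mul_det_mul X W
  rw [h0, mul_zero, sum_congr rfl fun f _ => hrX f, ← mul_sum, ← Complex.ofReal_sum] at h1
  have h2 : (∑ f, r f) ≠ 0 :=
    (sum_pos' (fun f _ => hr f) ⟨g, mem_univ _, hpos⟩).ne'
  have h3 : ((∑ f, r f : ℝ) : ℂ) ≠ 0 := by exact_mod_cast h2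
  exact mul_ne_zero (mul_ne_zero hb hc) h3 h1.symm

/-! ### Eigenvectors of the cyclic shift -/

/-- The matrix whose columns are eigenvectors of `ρ` with the eigenvalues
`exp (π i (k - 1 - 2 j) / n)`. -/
def shiftEigenvectors (k n : ℕ) : Matrix (Fin n) (Fin k) ℂ :=
  Matrix.rectVandermonde (fun c : Fin n => Complex.exp ((c : ℕ) * (Real.pi * Complex.I / n)))
    (fun c : Fin n => Complex.exp (-((c : ℕ) * (Real.pi * Complex.I / n)))) k

theorem shiftEigenvectors_apply {k n : ℕ} (c : Fin n) (j : Fin k) :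
    shiftEigenvectors k n c j =
      Complex.exp (-((c : ℕ) * (((k : ℂ) - 1 - 2 * (j : ℕ)) * (Real.pi * Complex.I / n)))) := by
  rw [shiftEigenvectors, Matrix.rectVandermonde_apply, ← Complex.exp_nat_mul, ← Complex.exp_nat_mul,
    ← Complex.exp_add, Fin.val_rev, Nat.cast_sub (by have := j.2; omega)]
  congr 1
  push_cast
  ring

theorem exp_pow_eq_neg_one_pow {k n : ℕ} (hk : 0 < k) (hn : n ≠ 0) (j : ℕ) :
    Complex.exp (((k : ℂ) - 1 - 2 * j) * (Real.pi * Complex.I / n)) ^ n = (-1) ^ (k - 1) := by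
  have hn' : (n : ℂ) ≠ 0 := by exact_mod_cast hn
  rw [← Complex.exp_nat_mul, ← Complex.exp_pi_mul_I, ← Complex.exp_nat_mul,
    Complex.exp_eq_exp_iff_exists_int]
  refine ⟨-j, ?_⟩
  push_cast [Nat.cast_sub hk]
  field_simp
  ring

/-- The columns are geometric progressions, and the cyclic closure in row 0 works because the n-th
power of each eigenvalue is the corner entry (-1)^(k-1). -/
theorem rho_mul_shiftEigenvectors {k n : ℕ} (hk : 0 < k) (hn : 0 < n) :
    rho k n * shiftEigenvectors k n = shiftEigenvectors k n * Matrix.diagonal fun j : Fin k =>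
      Complex.exp (((k : ℂ) - 1 - 2 * (j : ℕ)) * (Real.pi * Complex.I / n)) := by
  ext c j
  rw [Matrix.mul_diagonal, Matrix.mul_apply]
  by_cases hc : (c : ℕ) = 0
  · rw [sum_eq_single (⟨n - 1, by omega⟩ : Fin n)]
    · rw [shiftEigenvectors_apply, shiftEigenvectors_apply, hc]
      have h1 : rho k n c ⟨n - 1, by omega⟩ = (-1) ^ (k - 1) := by
        simp [rho, hc, Nat.sub_add_cancel hn, hn.ne]
      rw [h1, ← exp_pow_eq_neg_one_pow hk hn.ne' j, ← Complex.exp_nat_mul, ← Complex.exp_add,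
        ← Complex.exp_add]
      congr 1
      push_cast [Nat.cast_sub hn]
      ring
    · intro b _ hb
      have h1 : ¬ ((b : ℕ) + 1 = n) := fun h => hb (Fin.ext (by simp; omega))
      simp [rho, hc, h1]
    · simp
  · rw [sum_eq_single (⟨c - 1, by omega⟩ : Fin n)]
    · rw [shiftEigenvectors_apply, shiftEigenvectors_apply]
      have h1 : rho k n c ⟨c - 1, by omega⟩ = 1 := by
        simp only [rho, Matrix.of_apply]
        rw [if_pos (by omega)]
      rw [h1, one_mul, ← Complex.exp_add]
      congr 1
      push_cast [Nat.cast_sub (Nat.pos_of_ne_zero hc)]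
      ring
    · intro b _ hb
      have h1 : ¬ ((c : ℕ) = b + 1) := fun h => hb (Fin.ext (by simp; omega))
      simp [rho, hc, h1]
    · simp

/-- In the projective Vandermonde product each pair contributes 2i sin((g j - g i)π/n), with angle
strictly between 0 and π. -/
theorem det_shiftEigenvectors {k n : ℕ} (g : Fin k → Fin n) (hg : StrictMono g) :
    ∃ r : ℝ, 0 < r ∧ ((shiftEigenvectors k n).submatrix g id).det =
      (∏ i : Fin k, ∏ _j ∈ Ioi i, (2 * Complex.I)) * r := by
  have h1 : (shiftEigenvectors k n).submatrix g id = Matrix.projVandermonde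
      (fun t => Complex.exp ((g t : ℕ) * (Real.pi * Complex.I / n)))
      (fun t => Complex.exp (-((g t : ℕ) * (Real.pi * Complex.I / n)))) := rfl
  refine ⟨∏ i : Fin k, ∏ j ∈ Ioi i,
    Real.sin (((g j : ℝ) - (g i : ℝ)) * Real.pi / n), ?_, ?_⟩
  · refine prod_pos fun i _ => prod_pos fun j hj => ?_
    have hij : g i < g j := hg (mem_Ioi.1 hj)
    have hij' : ((g i : ℕ) : ℝ) < (g j : ℕ) := by exact_mod_cast hij
    have hjn : ((g j : ℕ) : ℝ) < n := by exact_mod_cast (g j).2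
    have hi0 : (0 : ℝ) ≤ (g i : ℕ) := by positivity
    have hn0 : (0 : ℝ) < n := by linarith
    have h0 : 0 < (g j : ℝ) - (g i : ℝ) := by linarith
    apply Real.sin_pos_of_pos_of_lt_pi
    · have := Real.pi_pos
      positivity
    · rw [div_lt_iff₀ hn0, mul_comm]
      exact mul_lt_mul_of_pos_left (by linarith) Real.pi_pos
  · rw [h1, Matrix.det_projVandermonde]
    push_cast
    simp only [← prod_mul_distrib]
    refine prod_congr rfl fun i _ => prod_congr rfl fun j _ => ?_
    rw [← Complex.exp_add, ← Complex.exp_add, Complex.sin]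
    have hI : Complex.I * Complex.I = -1 := Complex.I_mul_I
    have e1 : ((g j : ℕ) : ℂ) * (Real.pi * Complex.I / n) + -((g i : ℕ) * (Real.pi * Complex.I / n)) =
      (((g j : ℕ) : ℂ) - (g i : ℕ)) * Real.pi / n * Complex.I := by ring
    have e2 : ((g i : ℕ) : ℂ) * (Real.pi * Complex.I / n) + -((g j : ℕ) * (Real.pi * Complex.I / n)) =
      -((((g j : ℕ) : ℂ) - (g i : ℕ)) * Real.pi / n) * Complex.I := by ring
    rw [e1, e2]
    linear_combination (-(Complex.exp (-((((g j : ℕ) : ℂ) - (g i : ℕ)) * Real.pi / n) * Complex.I) -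
      Complex.exp ((((g j : ℕ) : ℂ) - (g i : ℕ)) * Real.pi / n * Complex.I))) * hI

/-- The eigenvalues of `ρ ^ ℓ` on the points of the distinguished component. -/
def distEigenvalue (k p j : ℕ) : ℂ :=
  Complex.exp (((k : ℂ) - 1 - 2 * j) * (Real.pi * Complex.I / p))

/-- From T X = X ρ^ℓ and ρ^ℓ W = W Λ^ℓ one gets T (X W) = (X W) Λ^ℓ. Total nonnegativity enters only
to make X W invertible. -/
theorem det_sub_of_isTNN {k n ℓ p : ℕ} (hk : 0 < k) (hn : n = p * ℓ) (hn0 : 0 < n)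
    {X : Matrix (Fin k) (Fin n) ℂ} (hX : X.rank = k) (hTNN : IsTNN X)
    {T : Matrix (Fin k) (Fin k) ℂ} (hT : X * rho k n ^ ℓ = T * X) (z : ℂ) :
    (z • 1 - T).det = ∏ j : Fin k, (z - distEigenvalue k p j) := by
  set W := shiftEigenvectors k n
  set Λ : Matrix (Fin k) (Fin k) ℂ := Matrix.diagonal fun j : Fin k =>
      Complex.exp (((k : ℂ) - 1 - 2 * (j : ℕ)) * (Real.pi * Complex.I / n)) with hΛ
  have hdet : (X * W).det ≠ 0 := by
    refine hTNN.det_mul_ne_zero hX (c := ∏ i : Fin k, ∏ _j ∈ Ioi i, (2 * Complex.I)) ?_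
      det_shiftEigenvectors
    exact prod_ne_zero_iff.2 fun i _ => prod_ne_zero_iff.2 fun j _ => by simp
  have hpow : ∀ m, rho k n ^ m * W = W * Λ ^ m := by
    intro m
    induction m with
    | zero => simp
    | succ m ih =>
      rw [pow_succ, Matrix.mul_assoc, rho_mul_shiftEigenvectors hk hn0, ← Matrix.mul_assoc, ih,
        Matrix.mul_assoc, pow_succ]
  have hΛℓ : Λ ^ ℓ = Matrix.diagonal fun j : Fin k => distEigenvalue k p j := by
    rw [hΛ, Matrix.diagonal_pow]
    congr 1
    ext j
    rw [Pi.pow_apply, ← Complex.exp_nat_mul, distEigenvalue]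
    have hp : (p : ℂ) ≠ 0 := by rintro h; simp_all
    have hℓ : (ℓ : ℂ) ≠ 0 := by rintro h; simp_all
    congr 1
    rw [hn]; push_cast
    field_simp
  have h1 : (z • 1 - T) * (X * W) = (X * W) * (z • 1 - Λ ^ ℓ) := by
    rw [sub_mul, mul_sub, ← Matrix.mul_assoc T, ← hT, Matrix.mul_assoc X, Matrix.mul_assoc X, hpow]
    simp [Matrix.mul_assoc]
  have h2 := congrArg Matrix.det h1
  rw [Matrix.det_mul, Matrix.det_mul, mul_comm] at h2
  rw [mul_left_cancel₀ hdet h2, hΛℓ, Matrix.smul_one_eq_diagonal, Matrix.diagonal_sub,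
    Matrix.det_diagonal]

/-! ### The characteristic polynomial is constant on connected components -/

/-- The value at `z` of the characteristic polynomial of `ρ ^ ℓ` on the subspace represented by
`X`. -/
def locusChar (k n ℓ : ℕ) (z : ℂ) (X : Matrix (Fin k) (Fin n) ℂ) : ℂ :=
  (z • (X * X.conjTranspose) - X * rho k n ^ ℓ * X.conjTranspose).det /
    (X * X.conjTranspose).det

/-- `T` depends on a choice made separately at each point, whereas `locusChar` is visibly continuous
in `X`; multiplying by the Gram matrix X X* identifies the two. -/
theorem locusChar_eq {k n ℓ : ℕ} (z : ℂ) {X : Matrix (Fin k) (Fin n) ℂ} (hX : X.rank = k)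
    {T : Matrix (Fin k) (Fin k) ℂ} (hT : X * rho k n ^ ℓ = T * X) :
    locusChar k n ℓ z X = (z • 1 - T).det := by
  rw [locusChar, hT, div_eq_iff (det_mul_conjTranspose_ne_zero hX), ← Matrix.det_mul, sub_mul,
    Matrix.smul_mul, Matrix.one_mul, Matrix.mul_assoc]

theorem continuousOn_locusChar {k n ℓ : ℕ} (z : ℂ) :
    ContinuousOn (locusChar k n ℓ z) (fixedLocus k n ℓ) := by
  refine ContinuousOn.div ?_ ?_ fun X hX => det_mul_conjTranspose_ne_zero hX.1
  · exact Continuous.continuousOn (by fun_prop)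
  · exact Continuous.continuousOn (by fun_prop)

/-- The eigenvalues are p-th roots of ε, so at each z the characteristic polynomial takes one of
finitely many values, indexed by multisets of k such roots and independent of `T`. -/
theorem det_sub_mem_of_pow_eq {k p : ℕ} (hp : 0 < p) (ε : ℂ) (z : ℂ)
    {T : Matrix (Fin k) (Fin k) ℂ} (hT : T ^ p = ε • 1) :
    (z • 1 - T).det ∈ ((nthRoots p ε).toFinset.sym k).image
      fun m : Sym ℂ k => ((m : Multiset ℂ).map fun r => z - r).prod := by
  have hs : T.charpoly.Splits := IsAlgClosed.splits _
  have hcard : Multiset.card T.charpoly.roots = k := by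
    rw [← hs.natDegree_eq_card_roots, Matrix.charpoly_natDegree_eq_dim, Fintype.card_fin]
  refine mem_image.2 ⟨(Sym.mk T.charpoly.roots hcard : Sym ℂ k), ?_, ?_⟩
  · rw [mem_sym_iff]
    intro r hr
    have hr' : r ∈ T.charpoly.roots := hr
    rw [mem_roots', IsRoot.def, Matrix.eval_charpoly] at hr'
    obtain ⟨u, hu, hu'⟩ := Matrix.exists_vecMul_eq_zero_iff.2 hr'.2
    rw [Matrix.vecMul_sub, sub_eq_zero, Matrix.scalar_apply, ← Matrix.smul_one_eq_diagonal,
      Matrix.vecMul_smul, Matrix.vecMul_one] at hu'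
    have hpow : ∀ m : ℕ, Matrix.vecMul u (T ^ m) = r ^ m • u := by
      intro m
      induction m with
      | zero => simp
      | succ m ih =>
        rw [pow_succ, ← Matrix.vecMul_vecMul, ih, Matrix.smul_vecMul, ← hu', smul_smul, pow_succ]
    have h1 := hpow p
    rw [hT, Matrix.vecMul_smul, Matrix.vecMul_one] at h1
    rw [Multiset.mem_toFinset, mem_nthRoots hp]
    obtain ⟨i, hi⟩ := Function.ne_iff.1 hu
    exact (mul_right_cancel₀ hi (congrFun h1 i)).symm
  · have h1 : (z • 1 - T).det = T.charpoly.eval z := by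
      rw [Matrix.eval_charpoly, Matrix.scalar_apply, Matrix.smul_one_eq_diagonal]
    rw [h1, hs.eval_eq_prod_roots, T.charpoly_monic.leadingCoeff, one_mul]
    rfl

/-- On the distinguished component, `ρ ^ ℓ` has the eigenvalues `distEigenvalue k p j`, `0 ≤ j < k`. -/
theorem det_sub_of_mem_distinguished {k n ℓ p : ℕ} (hk : 0 < k) (hn : n = p * ℓ) (hn0 : 0 < n)
    {X : Matrix (Fin k) (Fin n) ℂ} (hX : X ∈ distinguished k n ℓ)
    {T : Matrix (Fin k) (Fin k) ℂ} (hT : X * rho k n ^ ℓ = T * X) (z : ℂ) :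
    (z • 1 - T).det = ∏ j : Fin k, (z - distEigenvalue k p j) := by
  have : NeZero n := ⟨hn0.ne'⟩
  obtain ⟨X₀, hX₀, hTNN, hXc⟩ := hX
  have hsub := connectedComponentIn_subset (fixedLocus k n ℓ) X₀
  obtain ⟨T₀, hT₀⟩ := exists_intertwiner hX₀
  rw [← locusChar_eq z (hsub hXc).1 hT, ← det_sub_of_isTNN hk hn hn0 hX₀.1 hTNN hT₀ z,
    ← locusChar_eq z hX₀.1 hT₀]
  have hpre := (isPreconnected_connectedComponentIn (x := X₀) (F := fixedLocus k n ℓ)).image _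
    ((continuousOn_locusChar z).mono hsub)
  -- A connected subset of ℂ with two points is infinite, while the values at z lie in a finite set.
  by_contra hne
  have hinf := hpre.infinite_of_nontrivial
    ⟨_, ⟨X, hXc, rfl⟩, _, ⟨X₀, mem_connectedComponentIn hX₀, rfl⟩, hne⟩
  refine hinf (Set.Finite.subset (finite_toSet
    (((nthRoots p ((-1 : ℂ) ^ (k - 1))).toFinset.sym k).image
      fun m : Sym ℂ k => ((m : Multiset ℂ).map fun r => z - r).prod)) ?_)
  rintro _ ⟨Y, hY, rfl⟩
  obtain ⟨S, hS⟩ := exists_intertwiner (hsub hY)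
  rw [locusChar_eq z (hsub hY).1 hS]
  exact det_sub_mem_of_pow_eq (Nat.pos_of_ne_zero fun h => by simp [h] at hn; omega) _ z
    (intertwiner_pow hn (hsub hY).1 hS)

/-! ### Complementary minors of vectors and of their relations. -/

section DualMinors

variable {R : Type*} [CommRing R] {k m : ℕ}

/-- The minor of a sequence of vectors formed by `v_c, …, v_{c+k-1}`. -/
def intervalDet (v : ℕ → Fin k → R) (c : ℕ) : R :=
  (Matrix.of fun i t : Fin k => v (c + t) i).det

/-- The minor of a sequence of vectors formed by `v_c, …, v_{c+k}` without `v_a`. -/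
def bandEntry (v : ℕ → Fin k → R) (a c : ℕ) : R :=
  if c ≤ a ∧ a ≤ c + k then
    (Matrix.of fun i t : Fin k => v (c + if (t : ℕ) < a - c then (t : ℕ) else t + 1) i).det
  else 0

theorem bandEntry_add_left (v : ℕ → Fin k → R) (c : ℕ) :
    bandEntry v (k + c) c = intervalDet v c := by
  rw [bandEntry, if_pos (by omega), intervalDet]
  congr 1
  ext i t
  simp

theorem bandEntry_map {S : Type*} [CommRing S] (φ : R →+* S) (v : ℕ → Fin k → R) (a c : ℕ) :
    bandEntry (fun b i => φ (v b i)) a c = φ (bandEntry v a c) := by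
  unfold bandEntry
  split_ifs
  · rw [RingHom.map_det]; rfl
  · simp

/-- `k + 1` vectors in a space of dimension `k` are linearly dependent. -/
theorem sum_bandEntry_mul (v : ℕ → Fin k → R) (c w : ℕ) (hw : c + k < w) (i : Fin k) :
    ∑ a ∈ range w, (-1) ^ a * bandEntry v a c * v a i = 0 := by
  have h1 : ∑ s : Fin (k + 1), (-1) ^ (s : ℕ) * v (c + s) i * bandEntry v (c + s) c = 0 := by
    -- The k+1 vectors with their i-th coordinate row repeated on top: expanding this vanishing
    -- determinant along the top row is Cramer's relation.
    let A : Matrix (Fin (k + 1)) (Fin (k + 1)) R :=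
      Matrix.of fun j s => (Fin.cons i id : Fin (k + 1) → Fin k) j |> v (c + s)
    have hA : A.det = 0 := Matrix.det_zero_of_row_eq (Fin.succ_ne_zero i).symm (by ext; simp [A])
    rw [Matrix.det_succ_row_zero] at hA
    rw [← hA]
    refine sum_congr rfl fun s _ => ?_
    congr 1
    rw [bandEntry, if_pos (by have := s.2; omega)]
    congr 1
    ext j t
    simp only [Matrix.of_apply, Matrix.submatrix_apply, A, Fin.cons_succ, id]
    congr 2
    simp only [Nat.add_sub_cancel_left, Fin.succAbove, Fin.lt_def, Fin.val_castSucc]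
    split_ifs <;> simp
  have h2 : ∑ a ∈ Ico c (c + k + 1), (-1) ^ a * bandEntry v a c * v a i = 0 := by
    rw [sum_Ico_eq_sum_range, show c + k + 1 - c = k + 1 by omega,
      ← Fin.sum_univ_eq_sum_range (fun s => (-1) ^ (c + s) * bandEntry v (c + s) c * v (c + s) i)]
    have h3 : ∀ s : Fin (k + 1), (-1) ^ (c + (s : ℕ)) * bandEntry v (c + s) c * v (c + s) i =
        (-1) ^ c * ((-1) ^ (s : ℕ) * v (c + s) i * bandEntry v (c + s) c) := fun s => by
      rw [pow_add]; ring
    rw [sum_congr rfl fun s _ => h3 s, ← mul_sum, h1, mul_zero]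
  rw [← h2]
  symm
  apply sum_subset
  · intro a; simp only [mem_Ico, mem_range]; omega
  · intro a _ ha
    rw [mem_Ico] at ha
    rw [bandEntry, if_neg (by omega)]
    simp

/-- The matrix with the rows of `V` followed by the standard basis vectors numbered by `r`. -/
def stackRows (V : Matrix (Fin k) (Fin (k + m)) R) (r : Fin m → Fin (k + m)) :
    Matrix (Fin (k + m)) (Fin (k + m)) R :=
  Matrix.of (Fin.append (fun i j => V i j) fun a j => if j = r a then 1 else 0)

theorem stackRows_castAdd (V : Matrix (Fin k) (Fin (k + m)) R) (r : Fin m → Fin (k + m))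
    (i : Fin k) (j : Fin (k + m)) : stackRows V r (Fin.castAdd m i) j = V i j := by
  simp [stackRows]

theorem stackRows_natAdd (V : Matrix (Fin k) (Fin (k + m)) R) (r : Fin m → Fin (k + m))
    (a : Fin m) (j : Fin (k + m)) :
    stackRows V r (Fin.natAdd k a) j = if j = r a then 1 else 0 := by
  simp [stackRows]

/-- Laplace expansion of a determinant whose last rows are standard basis vectors. -/
theorem det_stackRows (V : Matrix (Fin k) (Fin (k + m)) R) (r : Fin m → Fin (k + m))
    (s : Fin k → Fin (k + m)) (hr : StrictMono r) (hs : StrictMono s) (hrs : ∀ a t, s t ≠ r a) :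
    (stackRows V r).det =
      (-1) ^ (∑ a, (r a : ℕ) + ∑ a : Fin m, (k + a)) * (V.submatrix id s).det := by
  induction m with
  | zero =>
    have hs' : s = id := by
      refine hs.range_inj strictMono_id |>.1 ?_
      rw [Set.range_id, Set.range_eq_univ]
      exact Finite.surjective_of_injective (α := Fin k) hs.injective
    subst hs'
    simp only [univ_eq_empty, sum_empty, add_zero, pow_zero, one_mul]
    congr 1
    ext i j
    exact stackRows_castAdd V r i j
  | succ m ih =>
    set q := r (Fin.last m) with hq
    have hlt : ∀ a : Fin m, r a.castSucc < q := fun a => hr (Fin.castSucc_lt_last a)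
    have h1 : ∀ a : Fin m, ∃ b : Fin (k + m), q.succAbove b = r a.castSucc := fun a =>
      Fin.exists_succAbove_eq (hlt a).ne
    have h2 : ∀ t : Fin k, ∃ b : Fin (k + m), q.succAbove b = s t := fun t =>
      Fin.exists_succAbove_eq (hrs _ t)
    choose r' hr' using h1
    choose s' hs' using h2
    -- The column q deleted with the last basis row is the largest of the r a, so the others keep
    -- their numbers and the exponent of the sign stays controlled.
    have hval : ∀ a, (r' a : ℕ) = r a.castSucc := by
      intro a
      have h3 := hlt a
      rw [← hr', Fin.succAbove_lt_iff_castSucc_lt] at h3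
      rw [← hr', Fin.succAbove_of_castSucc_lt _ _ h3, Fin.val_castSucc]
    have hinj := q.succAbove_right_injective
    have hmono := Fin.strictMono_succAbove q
    have ih' := ih (V.submatrix id q.succAbove) r' s'
      (fun a b hab => hmono.lt_iff_lt.1 (by rw [hr', hr']; exact hr (by simpa using hab)))
      (fun a b hab => hmono.lt_iff_lt.1 (by rw [hs', hs']; exact hs hab))
      (fun a t h => hrs a.castSucc t (by rw [← hs', ← hr', h]))
    have hlast : ∀ j : Fin (k + m + 1), stackRows V r (Fin.last (k + m)) j =
        if j = q then 1 else 0 := fun j => stackRows_natAdd V r (Fin.last m) j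
    have key := Matrix.det_succ_row
      (stackRows (m := m + 1) V r : Matrix (Fin (k + m + 1)) (Fin (k + m + 1)) R) (Fin.last (k + m))
    refine (key.trans (sum_eq_single (q : Fin (k + m + 1)) (fun j _ hj => ?_) (by simp))).trans ?_
    · exact mul_eq_zero_of_left (mul_eq_zero_of_right _ ((hlast j).trans (if_neg hj))) _
    · have hsub : (stackRows (m := m + 1) V r : Matrix (Fin (k + m + 1)) (Fin (k + m + 1)) R).submatrix
            (Fin.last (k + m)).succAbove q.succAbove =
          stackRows (V.submatrix id q.succAbove) r' := by
        ext a b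
        rw [Matrix.submatrix_apply, Fin.succAbove_last]
        refine Fin.addCases (fun i => ?_) (fun i => ?_) a
        · rw [stackRows_castAdd]
          exact stackRows_castAdd V r i (q.succAbove b)
        · rw [stackRows_natAdd]
          refine (stackRows_natAdd V r i.castSucc (q.succAbove b)).trans ?_
          simp only [← hr', hinj.eq_iff]
      rw [hsub, ih']
      have hVs : (V.submatrix id q.succAbove).submatrix id s' = V.submatrix id s := by
        ext i t
        simp [hs']
      rw [hVs, (hlast q).trans (if_pos rfl), mul_one, ← mul_assoc, ← pow_add,
        Fin.sum_univ_castSucc (fun a => (r a : ℕ)), Fin.sum_univ_castSucc (fun a => k + (a : ℕ))]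
      simp only [hval, Fin.val_castSucc, Fin.val_last, ← hq]
      congr 2
      ring

/-- The maximal minors of the matrix of linear relations between consecutive vectors are
proportional to the complementary minors of the vectors. -/
theorem intervalDet_mul_det_bandEntry (v : ℕ → Fin k → R) (r : Fin m → Fin (k + m))
    (s : Fin k → Fin (k + m)) (hr : StrictMono r) (hs : StrictMono s) (hrs : ∀ a t, s t ≠ r a) :
    intervalDet v 0 * (Matrix.of fun a c : Fin m => bandEntry v (r a) c).det =
      (Matrix.of fun i t : Fin k => v (s t) i).det * ∏ c : Fin m, intervalDet v c := by
  -- P stacks the vectors on basis rows; Q consists of the first k basis columns followed by the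
  -- signed relations. The relations annihilate the vectors, so P Q is block lower triangular, while
  -- Q is block upper triangular with consecutive minors on the diagonal of its last block.
  -- Comparing det(P Q) with det P · det Q gives the identity up to signs.
  let V : Matrix (Fin k) (Fin (k + m)) R := Matrix.of fun i a => v a i
  let P : Matrix (Fin (k + m)) (Fin (k + m)) R := stackRows V r
  let Q : Matrix (Fin (k + m)) (Fin (k + m)) R := Matrix.of fun a =>
    Fin.append (fun t : Fin k => if (a : ℕ) = t then 1 else 0)
      fun c : Fin m => (-1) ^ (a : ℕ) * ((-1) ^ (c : ℕ) * bandEntry v a c)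
  let V₀ : Matrix (Fin k) (Fin k) R := Matrix.of fun i t : Fin k => v (0 + t) i
  let Mr : Matrix (Fin m) (Fin m) R := Matrix.of fun a c : Fin m =>
    (-1) ^ (r a : ℕ) * ((-1) ^ (c : ℕ) * bandEntry v (r a) c)
  have hP : P.det = (-1) ^ (∑ a, (r a : ℕ) + ∑ a : Fin m, (k + a)) *
      (Matrix.of fun i t : Fin k => v (s t) i).det := det_stackRows V r s hr hs hrs
  have hQ : Q.det = ∏ c : Fin m, ((-1) ^ (k : ℕ) * intervalDet v c) := by
    rw [← Matrix.det_submatrix_equiv_self finSumFinEquiv Q]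
    have : Q.submatrix finSumFinEquiv finSumFinEquiv = Matrix.fromBlocks 1
        (Matrix.of fun (t : Fin k) (c : Fin m) =>
          (-1) ^ (t : ℕ) * ((-1) ^ (c : ℕ) * bandEntry v t c)) 0
        (Matrix.of fun a c : Fin m =>
          (-1) ^ (k + a : ℕ) * ((-1) ^ (c : ℕ) * bandEntry v (k + a) c)) := by
      ext a b
      rcases a with a | a <;> rcases b with b | b
      · simp [Q, Matrix.one_apply, Fin.ext_iff]
      · simp [Q]
      · have : ¬ (k + (a : ℕ) = b) := by have := b.2; omega
        simp [Q, this]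
      · simp [Q]
    rw [this, Matrix.det_fromBlocks_zero₂₁, Matrix.det_one, one_mul,
      Matrix.det_of_isUpperTriangular]
    · refine prod_congr rfl fun c _ => ?_
      rw [Matrix.of_apply, bandEntry_add_left, ← mul_assoc, ← pow_add, add_assoc, pow_add,
        Even.neg_one_pow ⟨(c : ℕ), rfl⟩, mul_one]
    · intro a c hac
      have hac' : (c : ℕ) < a := hac
      rw [Matrix.of_apply, bandEntry, if_neg (by omega)]
      simp
  have hPQ : (P * Q).det = V₀.det * Mr.det := by
    rw [← Matrix.det_submatrix_equiv_self finSumFinEquiv (P * Q)]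
    have : (P * Q).submatrix finSumFinEquiv finSumFinEquiv = Matrix.fromBlocks V₀ 0
        (Matrix.of fun (a : Fin m) (t : Fin k) => if (r a : ℕ) = t then 1 else 0) Mr := by
      ext a b
      rw [Matrix.submatrix_apply, Matrix.mul_apply]
      rcases a with a | a
      · simp only [P, finSumFinEquiv_apply_left, stackRows_castAdd, V, Matrix.of_apply]
        rcases b with b | b
        · rw [sum_eq_single (Fin.castAdd m b)]
          · simp [Q, V₀]
          · intro c _ hc
            have : ¬ ((c : ℕ) = b) := fun h => hc (Fin.ext h)
            simp [Q, this]
          · simp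
        · have h1 := sum_bandEntry_mul v b (k + m) (by have := b.2; omega) a
          rw [← Fin.sum_univ_eq_sum_range (fun c => (-1) ^ c * bandEntry v c b * v c a)] at h1
          rw [Matrix.fromBlocks_apply₁₂, Matrix.zero_apply, ← mul_zero ((-1 : R) ^ (b : ℕ)), ← h1,
            mul_sum]
          refine sum_congr rfl fun c _ => ?_
          simp only [Q, Matrix.of_apply, finSumFinEquiv_apply_right, Fin.append_right]
          ring
      · simp only [P, finSumFinEquiv_apply_right, stackRows_natAdd]
        rw [sum_eq_single (r a)]
        · rcases b with b | b
          · simp [Q]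
          · simp [Q, Mr]
        · intro c _ hc
          rw [if_neg hc, zero_mul]
        · simp
    rw [this, Matrix.det_fromBlocks_zero₁₂]
  have hMr : Mr.det = (∏ a, (-1) ^ (r a : ℕ)) * ((∏ c : Fin m, (-1) ^ (c : ℕ)) *
      (Matrix.of fun a c : Fin m => bandEntry v (r a) c).det) := by
    rw [← Matrix.det_mul_row, ← Matrix.det_mul_column]
    rfl
  have hfin : V₀.det * Mr.det = P.det * Q.det := by rw [← hPQ, Matrix.det_mul]
  rw [hMr, hP, hQ, prod_mul_distrib, prod_pow_eq_pow_sum, prod_pow_eq_pow_sum, sum_add_distrib,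
    prod_const, card_univ, Fintype.card_fin, sum_const, card_univ, Fintype.card_fin, smul_eq_mul,
    ← pow_mul] at hfin
  have e : ∀ x : ℕ, ((-1 : R) ^ x) * (-1) ^ x = 1 := fun x => by
    rw [← pow_add, Even.neg_one_pow ⟨x, rfl⟩]
  set x := ∑ a, (r a : ℕ)
  set y := ∑ c : Fin m, (c : ℕ)
  change V₀.det * _ = _
  set D := (Matrix.of fun a c : Fin m => bandEntry v (r a) c).det
  set E := (Matrix.of fun i t : Fin k => v (s t) i).det * ∏ c : Fin m, intervalDet v c with hE
  -- The two sides agree with the common sign (-1)^(x+y), after the sign (-1)^(mk) cancels against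
  -- itself.
  have h3 : (-1) ^ x * ((-1) ^ y * (V₀.det * D)) = (-1) ^ x * ((-1) ^ y * E) := by
    have := e (m * k)
    rw [mul_comm k m, pow_add, pow_add] at hfin
    rw [hE]
    linear_combination hfin + (-1) ^ x * (-1) ^ y * E * this
  have hu : ∀ x : ℕ, IsUnit ((-1 : R) ^ x) := fun x => IsUnit.of_mul_eq_one _ (e x)
  exact (hu y).mul_left_cancel ((hu x).mul_left_cancel h3)

/-- The preceding identity contains the first consecutive minor on both sides, but this minor may
vanish for given vectors. It is cancelled for generic vectors over ℤ, where it is a nonzero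
polynomial, and the result is specialized. -/
theorem det_bandEntry (v : ℕ → Fin k → R) (r : Fin (m + 1) → Fin (k + (m + 1)))
    (s : Fin k → Fin (k + (m + 1))) (hr : StrictMono r) (hs : StrictMono s)
    (hrs : ∀ a t, s t ≠ r a) :
    (Matrix.of fun a c : Fin (m + 1) => bandEntry v (r a) c).det =
      (Matrix.of fun i t : Fin k => v (s t) i).det * ∏ c : Fin m, intervalDet v (c + 1) := by
  let u : ℕ → Fin k → MvPolynomial (ℕ × Fin k) ℤ := fun a i => MvPolynomial.X (a, i)
  have hu : (Matrix.of fun a c : Fin (m + 1) => bandEntry u (r a) c).det =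
      (Matrix.of fun i t : Fin k => u (s t) i).det * ∏ c : Fin m, intervalDet u (c + 1) := by
    have h0 : intervalDet u 0 ≠ 0 := by
      intro h
      have := congrArg (MvPolynomial.eval fun x : ℕ × Fin k => if x.1 = x.2 then (1 : ℤ) else 0) h
      rw [intervalDet, RingHom.map_det, map_zero] at this
      have h1 : (MvPolynomial.eval fun x : ℕ × Fin k => if x.1 = x.2 then (1 : ℤ) else 0).mapMatrix
          (Matrix.of fun i t : Fin k => u (0 + t) i) = 1 := by
        ext i t
        simp [u, Matrix.one_apply, Fin.ext_iff, eq_comm]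
      rw [h1, Matrix.det_one] at this
      exact one_ne_zero this
    apply mul_left_cancel₀ h0
    rw [intervalDet_mul_det_bandEntry u r s hr hs hrs, Fin.prod_univ_succ]
    simp only [Fin.val_zero, Fin.val_succ]
    ring
  let φ : MvPolynomial (ℕ × Fin k) ℤ →+* R :=
    MvPolynomial.eval₂Hom (Int.castRingHom R) fun x => v x.1 x.2
  have hφ : ∀ a i, φ (u a i) = v a i := fun a i => by simp [φ, u]
  have hv : v = fun a i => φ (u a i) := by ext a i; rw [hφ]
  have h := congrArg φ hu
  rw [map_mul, map_prod, RingHom.map_det, RingHom.map_det] at h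
  have hI : ∀ c, intervalDet v c = φ (intervalDet u c) := fun c => by
    rw [← bandEntry_add_left, ← bandEntry_add_left, ← bandEntry_map, ← hv]
  simp only [hI]
  refine Eq.trans ?_ (h.trans ?_)
  · congr 1
    ext a c
    simp only [RingHom.mapMatrix_apply, Matrix.map_apply, Matrix.of_apply, ← bandEntry_map, ← hv]
  · congr 2
    ext i t
    simp only [RingHom.mapMatrix_apply, Matrix.map_apply, Matrix.of_apply, hφ]

end DualMinors

/-! ### Entries and initial minors of the band matrix. -/

section BandImage

variable {k n ℓ : ℕ}

theorem bandEntry_comp_add {R : Type*} [CommRing R] (v : ℕ → Fin k → R) (d a c : ℕ) :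
    bandEntry (fun b => v (d + b)) a c = bandEntry v (d + a) (d + c) := by
  unfold bandEntry
  by_cases h : c ≤ a ∧ a ≤ c + k
  · rw [if_pos h, if_pos (by omega)]
    simp only [Nat.add_sub_add_left, add_assoc]
  · rw [if_neg h, if_neg (by omega)]

/-- Vectors are numbered from 0 and columns from 1, whence the shifts by one. The bound on c keeps
the window c+1,…,c+k+1 inside {1,…,n}, where no sign of the extension rule enters. -/
theorem phi'_eq_bandEntry [NeZero n] (hk : 0 < k) (X : Matrix (Fin k) (Fin n) ℂ) (a c : ℕ)
    (hc : c + k < n) : phi' X ((a : ℤ) + 1) ((c : ℤ) + k + 1) = bandEntry (extCol X) a c := by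
  rw [phi'_apply hk, bandEntry]
  split_ifs with h
  · refine plucker_eq_det X (f := fun t : Fin k => c + if (t : ℕ) < a - c then (t : ℕ) else t + 1)
      ?_ ?_ ?_
    · intro s t hst
      have hst' : (s : ℕ) < t := hst
      dsimp only
      split_ifs <;> omega
    · intro t
      have := t.2
      split_ifs <;> omega
    · intro x
      rw [mem_erase, mem_Icc]
      constructor
      · rintro ⟨h1, h2, h3⟩
        by_cases hx : x < (a : ℤ) + 1
        · refine ⟨⟨(x - c - 1).toNat, by omega⟩, ?_⟩
          rw [if_pos (by simp; omega)]
          push_cast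
          omega
        · refine ⟨⟨(x - c - 2).toNat, by omega⟩, ?_⟩
          rw [if_neg (by simp; omega)]
          push_cast
          omega
      · rintro ⟨t, rfl⟩
        have := t.2
        split_ifs <;> push_cast <;> omega
  · rw [erase_eq_of_notMem]
    · exact plucker_eq_zero_of_Icc (by omega) X _
    · rw [mem_Icc]; omega

theorem plucker_Icc_eq_intervalDet [NeZero n] (X : Matrix (Fin k) (Fin n) ℂ) (c : ℕ)
    (hc : c + k ≤ n) :
    plucker X (Icc ((c : ℤ) + 1) ((c : ℤ) + k)) = intervalDet (extCol X) c := by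
  refine plucker_eq_det X (f := fun t : Fin k => c + t) (fun s t hst => ?_) (fun t => ?_) ?_
  · have hst' : (s : ℕ) < t := hst
    dsimp only; omega
  · have := t.2
    omega
  · intro x
    rw [mem_Icc]
    constructor
    · rintro ⟨h1, h2⟩
      exact ⟨⟨(x - c - 1).toNat, by omega⟩, by push_cast; omega⟩
    · rintro ⟨t, rfl⟩
      have := t.2
      push_cast
      omega

/-- Plücker coordinates are invariant under shifts by multiples of `ℓ`. -/
theorem plucker_image_add_mul {X : Matrix (Fin k) (Fin n) ℂ}
    (hper : ∀ I, plucker X (I.image (· + (ℓ : ℤ))) = plucker X I) (z : ℤ) (I : Finset ℤ) :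
    plucker X (I.image (· + z * ℓ)) = plucker X I := by
  induction z using Int.induction_on generalizing I with
  | zero => simp
  | succ z ih =>
    have h : I.image (· + ((z : ℤ) + 1) * ℓ) = (I.image (· + (z : ℤ) * ℓ)).image (· + (ℓ : ℤ)) := by
      rw [image_image]
      congr 1; ext x; simp; ring
    rw [h, hper, ih]
  | pred z ih =>
    have h : (I.image (· + (-(z : ℤ) - 1) * ℓ)).image (· + (ℓ : ℤ)) = I.image (· + -(z : ℤ) * ℓ) := by
      rw [image_image]
      congr 1; ext x; simp; ring
    rw [← hper (I.image (· + (-(z : ℤ) - 1) * ℓ)), h, ih]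

theorem plucker_Icc_congr {X : Matrix (Fin k) (Fin n) ℂ}
    (hper : ∀ I, plucker X (I.image (· + (ℓ : ℤ))) = plucker X I) (z a b : ℤ) :
    plucker X (Icc (a + z * ℓ) (b + z * ℓ)) = plucker X (Icc a b) := by
  rw [← plucker_image_add_mul hper z (Icc a b), image_add_right_Icc]

theorem initSet_numMutable_add (j : ℕ) (hj : 1 ≤ j) :
    initSet k ℓ (numMutable k ℓ + j) = Icc ((j : ℤ) - k + 1) j := by
  rw [initSet, if_neg (by omega)]
  congr 1 <;> push_cast <;> ring

/-- Replacing a by its residue translates the interval by a multiple of ℓ, which does not affect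
periodic Plücker coordinates. -/
theorem plucker_frozen {X : Matrix (Fin k) (Fin n) ℂ} (hℓ : 0 < ℓ)
    (hper : ∀ I, plucker X (I.image (· + (ℓ : ℤ))) = plucker X I) (a : ℤ) :
    plucker X (initSet k ℓ (numMutable k ℓ + resIcc ℓ a)) = plucker X (Icc (a - k + 1) a) := by
  rw [initSet_numMutable_add _ (by simp [resIcc])]
  have h1 : 0 ≤ (a - 1) % ℓ := Int.emod_nonneg _ (by omega)
  have h2 : (resIcc ℓ a : ℤ) = a + -((a - 1) / ℓ) * ℓ := by
    rw [resIcc]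
    push_cast
    rw [Int.toNat_of_nonneg h1]
    have := Int.emod_add_mul_ediv (a - 1) ℓ
    linarith
  rw [h2, ← plucker_Icc_congr hper (-((a - 1) / ℓ)) (a - k + 1) a]
  congr 2
  ring

theorem phi'_mem_band [NeZero n] (hk : 0 < k) (hkn : k < n) {X : Matrix (Fin k) (Fin n) ℂ}
    (hper : ∀ I, plucker X (I.image (· + (ℓ : ℤ))) = plucker X I) : phi' X ∈ band k ℓ := by
  constructor
  · intro i j hij
    rw [phi'_apply hk, erase_eq_of_notMem]
    · exact plucker_eq_zero_of_Icc hkn X _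
    · rw [mem_Icc]; omega
  · intro i j
    rw [phi'_apply hk, phi'_apply hk, ← hper ((Icc (j - k) j).erase i)]
    congr 1
    rw [image_erase (add_left_injective _), image_add_right_Icc]
    congr 2
    ring

theorem phi'_diag [NeZero n] (hk : 0 < k) (X : Matrix (Fin k) (Fin n) ℂ) (i : ℤ) :
    phi' X i i = plucker X (Icc (i - k) (i - 1)) := by
  rw [phi'_apply hk]
  congr 1
  ext x
  simp only [mem_erase, mem_Icc]
  omega

theorem phi'_outer [NeZero n] (hk : 0 < k) (X : Matrix (Fin k) (Fin n) ℂ) (i : ℤ) :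
    phi' X (i - k - 1) (i - 1) = plucker X (Icc (i - k) (i - 1)) := by
  rw [phi'_apply hk]
  congr 1
  ext x
  simp only [mem_erase, mem_Icc]
  omega

theorem largest_eq {m : ℕ} {S U : Finset ℤ} (hUS : U ⊆ S) (hU : ∀ a ∈ U, ∀ b ∈ S, a < b → b ∈ U)
    (hm : U.card = m) : largest m S = U := by
  ext a
  rw [largest, mem_filter]
  constructor
  · rintro ⟨ha, hc⟩
    by_contra haU
    refine absurd (card_le_card (s := U) (t := S.filter fun b => a < b) fun b hb => ?_) (not_le.2 (hm ▸ hc))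
    refine mem_filter.2 ⟨hUS hb, lt_of_not_ge fun hba => ?_⟩
    rcases hba.lt_or_eq with h | h
    · exact haU (hU b hb a ha h)
    · exact haU (h ▸ hb)
  · intro ha
    refine ⟨hUS ha, ?_⟩
    rw [← hm]
    refine card_lt_card ⟨fun b hb => ?_, fun h => ?_⟩
    · rw [mem_filter] at hb
      exact hU a ha b hb.1 hb.2
    · exact lt_irrefl _ (mem_filter.1 (h ha)).2

theorem minor_eq_det (M : Matrix ℤ ℤ ℂ) {m : ℕ} {R C : Finset ℤ} {r c : Fin m → ℤ}
    (hr : StrictMono r) (hc : StrictMono c) (hR : ∀ x, x ∈ R ↔ ∃ a, r a = x)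
    (hC : ∀ x, x ∈ C ↔ ∃ a, c a = x) :
    minor M R C = (Matrix.of fun a b => M (r a) (c b)).det := by
  have hR' : R.card = m := by
    rw [show R = univ.image r by ext; simp [hR], card_image_of_injective _ hr.injective]; simp
  have hC' : C.card = m := by
    rw [show C = univ.image c by ext; simp [hC], card_image_of_injective _ hc.injective]; simp
  subst hR'
  rw [minor, dif_pos hC', ← orderEmbOfFin_unique hC' (fun a => (hC _).2 ⟨a, rfl⟩) hc,
    ← orderEmbOfFin_unique rfl (fun a => (hR _).2 ⟨a, rfl⟩) hr]
  rfl

/-- Position of the elements of `I_i` relative to `i`. -/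
def initPos (ℓ i t : ℕ) : ℕ := if t ≤ (i - 1) / (ℓ - 1) then t else 1 + t * ℓ - i

/-- Past the consecutive block, the element 1 + tℓ of I_i lies at distance at least t from i. This
makes the truncated subtraction in `initPos` harmless and gives the increasing order of I_i. -/
theorem le_one_add_mul {ℓ i t : ℕ} (hℓ : 2 ≤ ℓ) (hi : 1 ≤ i) (ht : (i - 1) / (ℓ - 1) < t) :
    i + t ≤ 1 + t * ℓ := by
  have h1 : i - 1 < (ℓ - 1) * t := by
    rw [mul_comm]; exact (Nat.div_lt_iff_lt_mul (by omega)).1 ht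
  have h2 : (ℓ - 1) * t + t = t * ℓ := by
    obtain ⟨e, rfl⟩ : ∃ e, ℓ = e + 1 := ⟨ℓ - 1, by omega⟩
    simp; ring
  omega

theorem div_lt_of_le_numMutable {i : ℕ} (hℓ : 2 ≤ ℓ) (hi : 1 ≤ i)
    (hiN : i ≤ numMutable k ℓ) : (i - 1) / (ℓ - 1) < k - 1 := by
  rw [Nat.div_lt_iff_lt_mul (by omega)]
  rw [numMutable] at hiN
  omega

theorem strictMono_initPos {i : ℕ} (hℓ : 2 ≤ ℓ) (hi : 1 ≤ i) :
    StrictMono (initPos ℓ i) := by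
  refine strictMono_nat_of_lt_succ fun t => ?_
  unfold initPos
  split_ifs with h1 h2 h2
  · omega
  · have := le_one_add_mul hℓ hi (not_le.1 h2); omega
  · omega
  · have := le_one_add_mul hℓ hi (not_le.1 h1)
    have := le_one_add_mul hℓ hi (not_le.1 h2)
    have : (t + 1) * ℓ = t * ℓ + ℓ := by ring
    omega

theorem mem_initSet_iff {i : ℕ} (hk : 2 ≤ k) (hℓ : 2 ≤ ℓ) (hi : 1 ≤ i)
    (hiN : i ≤ numMutable k ℓ) (x : ℤ) :
    x ∈ initSet k ℓ i ↔ ∃ t : Fin k, (i : ℤ) + initPos ℓ i t = x := by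
  have hq := div_lt_of_le_numMutable hℓ hi hiN
  rw [initSet, if_pos hiN]
  simp only [mem_union, mem_Icc, mem_image, mem_Ico]
  constructor
  · rintro (⟨h1, h2⟩ | ⟨t, ⟨h1, h2⟩, rfl⟩)
    · refine ⟨⟨(x - i).toNat, by omega⟩, ?_⟩
      rw [initPos, if_pos (by simp only; omega)]
      simp only
      omega
    · refine ⟨⟨t, h2⟩, ?_⟩
      have := le_one_add_mul hℓ hi (show (i - 1) / (ℓ - 1) < t by omega)
      rw [initPos, if_neg (by simp only; omega)]
      push_cast [Nat.cast_sub (show i ≤ 1 + t * ℓ by omega)]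
      ring
  · rintro ⟨t, rfl⟩
    unfold initPos
    split_ifs with h
    · left; omega
    · right
      have := le_one_add_mul hℓ hi (not_le.1 h)
      refine ⟨t, ⟨by omega, t.2⟩, ?_⟩
      push_cast [Nat.cast_sub (show i ≤ 1 + (t : ℕ) * ℓ by omega)]
      ring

theorem numMutable_add (hk : 1 ≤ k) (hℓ : 1 ≤ ℓ) : numMutable k ℓ + k = (k - 1) * ℓ + 1 := by
  obtain ⟨e, rfl⟩ : ∃ e, ℓ = e + 1 := ⟨ℓ - 1, by omega⟩
  obtain ⟨d, rfl⟩ : ∃ d, k = d + 1 := ⟨k - 1, by omega⟩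
  simp [numMutable]; ring

theorem initPos_lt {i : ℕ} (hk : 2 ≤ k) (hℓ : 2 ≤ ℓ) (hi : 1 ≤ i) (hiN : i ≤ numMutable k ℓ)
    (t : Fin k) : i + initPos ℓ i t ≤ (k - 1) * ℓ + 1 := by
  have hq := div_lt_of_le_numMutable hℓ hi hiN
  have h1 : initPos ℓ i t ≤ initPos ℓ i (k - 1) :=
    (strictMono_initPos hℓ hi).monotone (by have := t.2; omega)
  have h2 : initPos ℓ i (k - 1) = 1 + (k - 1) * ℓ - i := by
    rw [initPos, if_neg (by omega)]
  have := le_one_add_mul hℓ hi hq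
  omega

/-- With q = ⌊(i-1)/(ℓ-1)⌋, everything from i to i+q belongs to I_i, and beyond i+q the set I_i
consists of the numbers congruent to 1 modulo ℓ. What remains of the window {i,…,(k-1)ℓ+1} is thus
an upper segment of the candidate rows. Its size is N-i+1, because the window has N+k-i+1 elements.
-/
theorem initRows_eq {i : ℕ} (hk : 2 ≤ k) (hℓ : 2 ≤ ℓ) (hi : 1 ≤ i) (hiN : i ≤ numMutable k ℓ) :
    initRows k ℓ i = Icc (i : ℤ) ((((k - 1 : ℕ) : ℤ) * ℓ + 1)) \ initSet k ℓ i := by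
  have hq := div_lt_of_le_numMutable hℓ hi hiN
  have hN := numMutable_add (k := k) (ℓ := ℓ) (by omega) (by omega)
  set q := (i - 1) / (ℓ - 1) with hqd
  have hq0 : (0 : ℤ) ≤ q := Int.natCast_nonneg q
  have hchar : ∀ x : ℤ, x ∈ Icc (i : ℤ) ((((k - 1 : ℕ) : ℤ) * ℓ + 1)) \ initSet k ℓ i ↔
      (x ∈ (Icc (1 : ℤ) (((k - 1 : ℕ) : ℤ) * ℓ)).filter fun j => ¬ j ≡ 1 [ZMOD ℓ]) ∧
        (i : ℤ) + q < x := by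
    -- Together with `hlt`: 1 + qℓ ≤ i + q < 1 + (q+1)ℓ, so the first number beyond i+q congruent to
    -- 1 modulo ℓ is the one at which the second piece of I_i starts.
    have hiq : (q : ℤ) * ℓ + 1 ≤ i + q := by
      have h1 : q * (ℓ - 1) ≤ i - 1 := Nat.div_mul_le_self _ _
      have h2 : q * (ℓ - 1) + q = q * ℓ := by
        obtain ⟨e, rfl⟩ : ∃ e, ℓ = e + 1 := ⟨ℓ - 1, by omega⟩
        simp; ring
      have h3 : q * ℓ + 1 ≤ i + q := by omega
      exact_mod_cast h3
    have hlt : (i : ℤ) + q < 1 + (q + 1) * ℓ := by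
      have h1 := le_one_add_mul hℓ hi (Nat.lt_succ_self q)
      have h2 : ((i + (q + 1) : ℕ) : ℤ) ≤ ((1 + (q + 1) * ℓ : ℕ) : ℤ) := by exact_mod_cast h1
      push_cast at h2
      linarith
    have hkl : ∀ t : ℤ, (q : ℤ) + 1 ≤ t → t ≤ ((k - 1 : ℕ) : ℤ) →
        1 + t * ℓ ∈ initSet k ℓ i := by
      intro t h1 h2
      rw [initSet, if_pos hiN]
      refine mem_union_right _ (mem_image.2 ⟨t.toNat, mem_Ico.2 ⟨by omega, by omega⟩, ?_⟩)
      rw [Int.toNat_of_nonneg (by omega)]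
    intro x
    simp only [mem_sdiff, mem_Icc, mem_filter]
    constructor
    · rintro ⟨⟨h1, h2⟩, h3⟩
      have h4 : (i : ℤ) + q < x := by
        by_contra h
        refine h3 ?_
        rw [initSet, if_pos hiN]
        exact mem_union_left _ (mem_Icc.2 ⟨h1, by push_cast; omega⟩)
      refine ⟨⟨⟨by omega, ?_⟩, fun h => h3 ?_⟩, h4⟩
      · by_contra h
        have hx : x = 1 + (((k - 1 : ℕ) : ℤ)) * ℓ := by omega
        exact h3 (hx ▸ hkl _ (by omega) le_rfl)
      · obtain ⟨t, ht⟩ := h.symm.dvd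
        have hx : x = 1 + t * ℓ := by linarith
        rw [hx]
        have hℓ0 : (0 : ℤ) < ℓ := by omega
        apply hkl
        · have : (q : ℤ) * ℓ < t * ℓ := by linarith
          exact Int.add_one_le_iff.2 (lt_of_mul_lt_mul_right this hℓ0.le)
        · have : t * ℓ ≤ ((k - 1 : ℕ) : ℤ) * ℓ := by linarith
          exact le_of_mul_le_mul_right this hℓ0
    · rintro ⟨⟨⟨h1, h2⟩, h3⟩, h4⟩
      refine ⟨⟨by omega, by omega⟩, fun h => ?_⟩
      rw [initSet, if_pos hiN] at h
      rcases mem_union.1 h with h | h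
      · rw [mem_Icc] at h
        push_cast at h
        omega
      · obtain ⟨t, _, rfl⟩ := mem_image.1 h
        refine h3 ?_
        simp
  rw [initRows]
  refine largest_eq (fun x hx => ((hchar x).1 hx).1) ?_ ?_
  · intro a ha b hb hab
    exact (hchar b).2 ⟨hb, ((hchar a).1 ha).2.trans hab⟩
  · have hs : initSet k ℓ i = univ.image fun t : Fin k => (i : ℤ) + initPos ℓ i t := by
      ext x
      rw [mem_initSet_iff hk hℓ hi hiN]
      simp
    have hcard : (initSet k ℓ i).card = k := by
      rw [hs, card_image_of_injective]
      · simp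
      · intro s t hst
        have : initPos ℓ i s = initPos ℓ i t := by
          have := add_left_cancel hst
          exact_mod_cast this
        exact Fin.ext ((strictMono_initPos hℓ hi).injective this)
    rw [card_sdiff_of_subset, hcard, Int.card_Icc]
    · have : (((k - 1 : ℕ) : ℤ)) * ℓ + 1 = ((numMutable k ℓ + k : ℕ) : ℤ) := by
        rw [hN]; push_cast; ring
      rw [this]
      omega
    · intro x hx
      obtain ⟨t, rfl⟩ := (mem_initSet_iff hk hℓ hi hiN x).1 hx
      have := initPos_lt hk hℓ hi hiN t
      rw [mem_Icc]
      refine ⟨by omega, ?_⟩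
      exact_mod_cast this

/-- This is `det_bandEntry` for the vectors numbered i,…,(k-1)ℓ+1, with s listing I_i and r its
complement. The assumption kℓ ≤ n keeps the whole window inside {1,…,n}. -/
theorem initMinor_phi' [NeZero n] (hk : 2 ≤ k) (hℓ : 2 ≤ ℓ) (hkn : k * ℓ ≤ n)
    {X : Matrix (Fin k) (Fin n) ℂ}
    (hper : ∀ I, plucker X (I.image (· + (ℓ : ℤ))) = plucker X I) {i : ℕ} (hi : 1 ≤ i)
    (hiN : i ≤ numMutable k ℓ) :
    initMinor k ℓ i (phi' X) = plucker X (initSet k ℓ i) * ∏ b ∈ Ico i (numMutable k ℓ),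
      plucker X (initSet k ℓ (numMutable k ℓ + resIcc ℓ (b + k))) := by
  obtain ⟨m, hm⟩ : ∃ m, numMutable k ℓ = i + m := ⟨numMutable k ℓ - i, by omega⟩
  have hN := numMutable_add (k := k) (ℓ := ℓ) (by omega) (by omega)
  have hLn : (k - 1) * ℓ + 1 < n := by
    have : (k - 1) * ℓ + ℓ = k * ℓ := by
      obtain ⟨d, rfl⟩ : ∃ d, k = d + 1 := ⟨k - 1, by omega⟩
      simp; ring
    omega
  have hL : (((k - 1 : ℕ) : ℤ)) * ℓ + 1 = i + m + k := by
    have : (((k - 1) * ℓ + 1 : ℕ) : ℤ) = ((i + m + k : ℕ) : ℤ) := by rw [← hN, hm]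
    push_cast at this
    exact this
  let s : Fin k → Fin (k + (m + 1)) := fun t => ⟨initPos ℓ i t, by
    have := initPos_lt hk hℓ hi hiN t; omega⟩
  have hs : StrictMono s := fun a b hab => strictMono_initPos hℓ hi hab
  have hcard : ((univ.image s)ᶜ).card = m + 1 := by
    rw [card_compl, card_image_of_injective _ hs.injective, card_univ, Fintype.card_fin,
      Fintype.card_fin]
    omega
  let r : Fin (m + 1) → Fin (k + (m + 1)) := (univ.image s)ᶜ.orderEmbOfFin hcard
  have hr : StrictMono r := ((univ.image s)ᶜ.orderEmbOfFin hcard).strictMono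
  have hmem : ∀ x, (∃ a, r a = x) ↔ ∀ t, s t ≠ x := by
    intro x
    have h1 : x ∈ Set.range r ↔ x ∈ (univ.image s)ᶜ := by
      rw [show Set.range r = _ from range_orderEmbOfFin _ hcard, mem_coe]
    rw [← Set.mem_range, h1]
    simp
  rw [initMinor, minor_eq_det (phi' X) (r := fun a : Fin (m + 1) => (i : ℤ) + r a)
    (c := fun c : Fin (m + 1) => (k : ℤ) + i + c)]
  · have h1 := det_bandEntry (fun b => extCol X (i - 1 + b)) r s hr hs
      (fun a => (hmem _).1 ⟨a, rfl⟩)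
    have h2 : (Matrix.of fun a b : Fin (m + 1) => phi' X ((i : ℤ) + r a) ((k : ℤ) + i + b)) =
        Matrix.of fun a c : Fin (m + 1) => bandEntry (fun b => extCol X (i - 1 + b)) (r a) c := by
      ext a c
      simp only [Matrix.of_apply]
      rw [bandEntry_comp_add, ← phi'_eq_bandEntry (by omega) X _ _ (by have := c.2; omega)]
      congr 1 <;> push_cast [Nat.cast_sub hi] <;> ring
    rw [h2, h1]
    congr 1
    · symm
      refine plucker_eq_det X (f := fun t : Fin k => i - 1 + initPos ℓ i t) (fun a b hab => ?_)
        (fun t => ?_) fun x => ?_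
      · exact Nat.add_lt_add_left (strictMono_initPos hℓ hi hab) _
      · have := initPos_lt hk hℓ hi hiN t
        omega
      · rw [mem_initSet_iff hk hℓ hi hiN]
        push_cast [Nat.cast_sub hi]
        refine exists_congr fun t => ?_
        constructor <;> intro h <;> omega
    · rw [hm, prod_Ico_eq_prod_range, Nat.add_sub_cancel_left, ← Fin.prod_univ_eq_prod_range
        (fun c => plucker X (initSet k ℓ (i + m + resIcc ℓ ((i + c : ℕ) + k)))) m]
      refine prod_congr rfl fun c _ => ?_
      rw [← hm, plucker_frozen (by omega) hper]
      have h3 := plucker_Icc_eq_intervalDet X (i + c) (by have := c.2; omega)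
      have h4 : intervalDet (fun b => extCol X (i - 1 + b)) ((c : ℕ) + 1) =
          intervalDet (extCol X) (i + c) := by
        unfold intervalDet
        congr 1
        ext j t
        simp only [Matrix.of_apply]
        congr 1
        omega
      rw [h4, ← h3]
      congr 2
      ring
  · intro a b hab
    have : (r a : ℕ) < r b := hr hab
    dsimp only; omega
  · intro a b hab
    have : (a : ℕ) < b := hab
    dsimp only; omega
  · intro x
    rw [initRows_eq hk hℓ hi hiN, mem_sdiff, mem_initSet_iff hk hℓ hi hiN, mem_Icc, hL]
    constructor
    · rintro ⟨⟨h1, h2⟩, h3⟩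
      have h4 : (x - i).toNat < k + (m + 1) := by omega
      obtain ⟨a, ha⟩ := (hmem ⟨_, h4⟩).2 fun t ht => h3 ⟨t, by
        have := congrArg Fin.val ht
        simp only [s] at this
        omega⟩
      refine ⟨a, ?_⟩
      rw [ha]
      simp only
      omega
    · rintro ⟨a, rfl⟩
      have := (r a).2
      refine ⟨by omega, ?_⟩
      rintro ⟨t, ht⟩
      refine (hmem (r a)).1 ⟨a, rfl⟩ t (Fin.ext ?_)
      simp only [s]
      omega
  · intro x
    rw [initCols, mem_Icc, hL]
    constructor
    · rintro ⟨h1, h2⟩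
      exact ⟨⟨(x - k - i).toNat, by omega⟩, by simp only; omega⟩
    · rintro ⟨a, rfl⟩
      have := a.2
      omega

end BandImage

theorem prod_Icc_natCast_zmod {M : Type*} [CommMonoid M] {ℓ : ℕ} [NeZero ℓ] (G : ZMod ℓ → M) :
    ∏ i ∈ Icc 1 ℓ, G (i : ZMod ℓ) = ∏ j, G j := by
  obtain ⟨e, rfl⟩ : ∃ e, ℓ = e + 1 := ⟨ℓ - 1, by have := NeZero.ne ℓ; omega⟩
  have h1 : Icc 1 (e + 1) = Ico 1 (e + 1 + 1) := by ext; simp only [mem_Icc, mem_Ico]; omega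
  rw [h1, prod_Ico_eq_prod_range, show e + 1 + 1 - 1 = e + 1 by omega,
    ← Fin.prod_univ_eq_prod_range (fun i => G ((1 + i : ℕ) : ZMod (e + 1)))]
  rw [← Equiv.prod_comp (Equiv.addLeft (1 : ZMod (e + 1))) G]
  refine prod_congr rfl fun i _ => ?_
  congr 1
  rw [Nat.cast_add, Nat.cast_one, Equiv.coe_addLeft]
  congr 1
  exact Fin.cast_val_eq_self i

theorem resIcc_val {ℓ : ℕ} [NeZero ℓ] (a : ℤ) :
    resIcc ℓ ((a : ZMod ℓ).val : ℤ) = resIcc ℓ a := by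
  rw [resIcc, resIcc, ZMod.val_intCast, Int.emod_sub_emod]

theorem resIcc_of_mem {ℓ i : ℕ} (hi : i ∈ Icc 1 ℓ) : resIcc ℓ i = i := by
  rw [mem_Icc] at hi
  rw [resIcc, Int.emod_eq_of_lt (by omega) (by omega)]
  omega

/-! ### The polynomial det(tB + A) and its roots. -/

section CoefficientString

variable {k n ℓ : ℕ}

/-- The frozen Plücker coordinates, indexed by residue classes. -/
def frozenPlucker {k n : ℕ} (ℓ : ℕ) (X : Matrix (Fin k) (Fin n) ℂ) (j : ZMod ℓ) : ℂ :=
  plucker X (initSet k ℓ (numMutable k ℓ + resIcc ℓ j.val))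

theorem plucker_eq_frozenPlucker [NeZero ℓ] (X : Matrix (Fin k) (Fin n) ℂ) (a : ℤ) :
    plucker X (initSet k ℓ (numMutable k ℓ + resIcc ℓ a)) = frozenPlucker ℓ X a := by
  rw [frozenPlucker, resIcc_val]

theorem prod_frozenPlucker [NeZero ℓ] (X : Matrix (Fin k) (Fin n) ℂ) :
    ∏ i ∈ Icc 1 ℓ, plucker X (initSet k ℓ (numMutable k ℓ + i)) = ∏ j, frozenPlucker ℓ X j := by
  rw [← prod_Icc_natCast_zmod]
  refine prod_congr rfl fun i hi => ?_
  have := plucker_eq_frozenPlucker (ℓ := ℓ) X (i : ℤ)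
  rw [resIcc_of_mem hi] at this
  simpa using this

/-- B is lower triangular, and its diagonal consists of outer entries of the band, that is, frozen
coordinates shifted by k; the shift only permutes the residues modulo ℓ. -/
theorem det_matB [NeZero n] (hk : 0 < k) (hℓ : 0 < ℓ) {X : Matrix (Fin k) (Fin n) ℂ}
    (hband : phi' X ∈ band k ℓ)
    (hper : ∀ I, plucker X (I.image (· + (ℓ : ℤ))) = plucker X I) :
    (matB k ℓ (phi' X)).det = ∏ i ∈ Icc 1 ℓ, plucker X (initSet k ℓ (numMutable k ℓ + i)) := by
  have : NeZero ℓ := ⟨hℓ.ne'⟩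
  rw [prod_frozenPlucker, Matrix.det_of_isLowerTriangular]
  · rw [← Equiv.prod_comp (Equiv.addRight (k : ZMod ℓ)) (frozenPlucker ℓ X), ← prod_Icc_natCast_zmod]
    have h1 : Icc 1 ℓ = Ico 1 (ℓ + 1) := by ext; simp only [mem_Icc, mem_Ico]; omega
    rw [h1, prod_Ico_eq_prod_range, show ℓ + 1 - 1 = ℓ by omega,
      ← Fin.prod_univ_eq_prod_range
        (fun i => frozenPlucker ℓ X (Equiv.addRight (k : ZMod ℓ) ((1 + i : ℕ) : ZMod ℓ)))]
    refine prod_congr rfl fun b _ => ?_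
    have h2 := plucker_eq_frozenPlucker (ℓ := ℓ) X ((1 + b : ℕ) + k : ℤ)
    rw [plucker_frozen hℓ hper] at h2
    have h3 := phi'_outer hk X ((b : ℕ) + k + 2)
    have h4 : ((((1 + b : ℕ) + k : ℤ)) : ZMod ℓ) =
        Equiv.addRight (k : ZMod ℓ) ((1 + b : ℕ) : ZMod ℓ) := by
      simp
    rw [← h4, ← h2, matB, Matrix.of_apply]
    convert h3 using 2
    · ring
    · ring
    · congr 1 <;> push_cast <;> ring
  · intro a b hab
    have hab' : (a : ℕ) < b := hab
    rw [matB, Matrix.of_apply]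
    exact hband.1 _ _ (by omega)

/-- The polynomial `det (t B + A)` is divisible by `t ^ (ℓ - k)`. -/
theorem exists_det_eq_mul_X_pow (hkℓ : k ≤ ℓ) (M : Matrix ℤ ℤ ℂ) :
    ∃ g : ℂ[X], ((X : ℂ[X]) • (matB k ℓ M).map C + (matA k ℓ M).map C).det = g * X ^ (ℓ - k) := by
  -- The first ℓ-k columns of `A` are zero, so t can be pulled out of each of them.
  let d : Fin ℓ → ℂ[X] := fun b => if (b : ℕ) < ℓ - k then X else 1
  let E : Matrix (Fin ℓ) (Fin ℓ) ℂ[X] := Matrix.of fun a b =>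
    if (b : ℕ) < ℓ - k then C (matB k ℓ M a b) else X * C (matB k ℓ M a b) + C (matA k ℓ M a b)
  have h : (X : ℂ[X]) • (matB k ℓ M).map C + (matA k ℓ M).map C = E * Matrix.diagonal d := by
    ext1 a b
    rw [Matrix.mul_diagonal]
    simp only [E, d, Matrix.of_apply, Matrix.add_apply, Matrix.smul_apply, Matrix.map_apply,
      smul_eq_mul]
    split_ifs with hb
    · have : matA k ℓ M a b = 0 := by
        simp only [matA, Matrix.of_apply]
        rw [if_neg (by omega)]
      rw [this, map_zero, add_zero, mul_comm]
    · rw [mul_one]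
  refine ⟨E.det, ?_⟩
  rw [h, Matrix.det_mul, Matrix.det_diagonal]
  congr 1
  simp only [d]
  rw [prod_ite, prod_const, prod_const_one, mul_one]
  congr 1
  rw [Fin.card_filter_val_lt]
  omega

/-- After division by t^(ℓ-k) the degree is at most k with coefficient det B in degree k.
Subtracting the claimed product leaves degree below k and k distinct zeros; nothing requires det B
to be nonzero. -/
theorem det_eq_prod_of_roots (hkℓ : k ≤ ℓ) (M : Matrix ℤ ℤ ℂ) (a : Fin k → ℂ)
    (ha : Function.Injective a) (ha0 : ∀ j, a j ≠ 0)
    (hroot : ∀ j, (a j • matB k ℓ M + matA k ℓ M).det = 0) :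
    ((X : ℂ[X]) • (matB k ℓ M).map C + (matA k ℓ M).map C).det =
      C (matB k ℓ M).det * (∏ j, (X - C (a j))) * X ^ (ℓ - k) := by
  obtain ⟨g, hg⟩ := exists_det_eq_mul_X_pow hkℓ M
  set D := ((X : ℂ[X]) • (matB k ℓ M).map C + (matA k ℓ M).map C).det with hD
  have hdeg : D.natDegree ≤ ℓ := by
    simpa using natDegree_det_X_add_C_le (matB k ℓ M) (matA k ℓ M)
  have hlead : D.coeff ℓ = (matB k ℓ M).det := by
    simpa using coeff_det_X_add_C_card (matB k ℓ M) (matA k ℓ M)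
  have hcoeff : ∀ m, g.coeff m = D.coeff (m + (ℓ - k)) := fun m => by
    rw [hg, coeff_mul_X_pow]
  have heval : ∀ j, g.eval (a j) = 0 := by
    intro j
    have h1 : D.eval (a j) = 0 := by
      rw [← hroot j, hD, ← coe_evalRingHom, RingHom.map_det]
      congr 1
      ext b c
      simpa using mul_comm _ _
    rw [hg, eval_mul, eval_pow, eval_X] at h1
    exact (mul_eq_zero.1 h1).resolve_right (pow_ne_zero _ (ha0 j))
  rw [hg]
  congr 1
  have hmonic : (∏ j, (X - C (a j))).Monic := monic_prod_X_sub_C a univ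
  have hnat : (∏ j, (X - C (a j))).natDegree = k := by
    rw [natDegree_finsetProd_X_sub_C_eq_card]; simp
  refine eq_of_degree_sub_lt_of_eval_finset_eq (univ.image a) ?_ ?_
  · rw [card_image_of_injective _ ha, card_univ, Fintype.card_fin, degree_lt_iff_coeff_zero]
    intro m hm
    rw [coeff_sub, coeff_C_mul, hcoeff]
    rcases hm.eq_or_lt with rfl | hm
    · have h1 : (∏ j, (X - C (a j))).coeff k = 1 := by
        have := hmonic.coeff_natDegree
        rwa [hnat] at this
      rw [h1, show k + (ℓ - k) = ℓ by omega, hlead, mul_one, sub_self]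
    · rw [coeff_eq_zero_of_natDegree_lt (hdeg.trans_lt (by omega)),
        coeff_eq_zero_of_natDegree_lt (hnat.trans_lt hm), mul_zero, sub_zero]
  · intro x hx
    obtain ⟨j, _, rfl⟩ := mem_image.1 hx
    rw [heval, eval_mul, eval_prod, prod_eq_zero (mem_univ j) (by simp), mul_zero]

/-- For a left eigenvector u of T, the numbers f a = u · v_a satisfy f (a+ℓ) = λ f a, and (-1)^a f a
is orthogonal to every relation column. Folding two consecutive periods into one gives a left kernel
vector of B + (-1)^ℓ λ A, which is proportional to tB + A. -/
theorem det_smul_matB_add_matA [NeZero n] (hk : 0 < k) (hkℓ : k < ℓ) (hℓn : 2 * ℓ ≤ n)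
    {X : Matrix (Fin k) (Fin n) ℂ} (hX : X.rank = k) (hband : phi' X ∈ band k ℓ)
    {T : Matrix (Fin k) (Fin k) ℂ} (hT : X * rho k n ^ ℓ = T * X) {lam t : ℂ}
    (hlam : (lam • 1 - T).det = 0) (ht : t * lam = (-1) ^ ℓ) :
    (t • matB k ℓ (phi' X) + matA k ℓ (phi' X)).det = 0 := by
  obtain ⟨u, hu, hu'⟩ := Matrix.exists_vecMul_eq_zero_iff.2 hlam
  rw [Matrix.vecMul_sub, sub_eq_zero, Matrix.vecMul_smul, Matrix.vecMul_one] at hu'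
  set f : ℕ → ℂ := fun a => ∑ i, u i * extCol X a i with hf
  have hfℓ : ∀ a, f (a + ℓ) = lam * f a := by
    intro a
    change u ⬝ᵥ extCol X (a + ℓ) = lam * (u ⬝ᵥ extCol X a)
    rw [extCol_add hT, Matrix.dotProduct_mulVec, ← hu', smul_dotProduct, smul_eq_mul]
  have hA : ∀ a b : Fin ℓ, matA k ℓ (phi' X) a b = bandEntry (extCol X) (a + ℓ) b := by
    intro a b
    have h1 := phi'_eq_bandEntry hk X (a + ℓ) b (by have := b.2; omega)
    have h2 := hband.2 ((a : ℕ) + 1) ((b : ℕ) + 1 - ℓ + k)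
    rw [← h1]
    have h3 : phi' X (((a + ℓ : ℕ) : ℤ) + 1) ((b : ℕ) + k + 1) =
        phi' X ((a : ℕ) + 1) ((b : ℕ) + 1 - ℓ + k) := by
      rw [← h2]; congr 1 <;> push_cast <;> ring
    rw [h3]
    simp only [matA, Matrix.of_apply]
    split_ifs with h
    · rfl
    · exact (hband.1 _ _ (by omega)).symm
  have hB : ∀ a b : Fin ℓ, matB k ℓ (phi' X) a b = bandEntry (extCol X) a b := by
    intro a b
    rw [← phi'_eq_bandEntry hk X a b (by have := b.2; omega)]
    simp only [matB, Matrix.of_apply]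
    congr 1; ring
  refine Matrix.exists_vecMul_eq_zero_iff.1 ⟨fun a : Fin ℓ => (-1) ^ (a : ℕ) * f a, ?_, ?_⟩
  -- If one period of f vanished, all of f would, so u X = 0, contrary to full rank.
  · intro h0
    have hf0 : ∀ a, f a = 0 := by
      have h1 : ∀ q r : ℕ, r < ℓ → f (r + q * ℓ) = 0 := by
        intro q r hr
        induction q with
        | zero => simpa using congrFun h0 ⟨r, hr⟩
        | succ q ih => rw [add_mul, one_mul, ← add_assoc, hfℓ, ih, mul_zero]
      intro a
      rw [← Nat.mod_add_div' a ℓ]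
      exact h1 _ _ (Nat.mod_lt _ (by omega))
    refine hu (vecMul_injective_of_rank hX ?_)
    ext c
    have h2 := hf0 c
    simp only [hf, extCol_of_lt] at h2
    simpa [Matrix.vecMul, dotProduct] using h2
  · ext b
    -- A column b < ℓ is supported on rows b,…,b+k, which lie below 2ℓ because k < ℓ. The first
    -- period of rows is the block B, the second the block A.
    have h1 : ∑ a ∈ range (2 * ℓ), (-1) ^ a * f a * bandEntry (extCol X) a b = 0 := by
      simp only [hf, mul_sum, sum_mul]
      rw [sum_comm]
      refine sum_eq_zero fun i _ => ?_
      have h2 := sum_bandEntry_mul (extCol X) b (2 * ℓ) (by have := b.2; omega) i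
      rw [← mul_zero (u i), ← h2, mul_sum]
      exact sum_congr rfl fun a _ => by ring
    rw [two_mul, sum_range_add, ← sum_add_distrib, ← Fin.sum_univ_eq_sum_range
      (fun a => (-1) ^ a * f a * bandEntry (extCol X) a b +
        (-1) ^ (ℓ + a) * f (ℓ + a) * bandEntry (extCol X) (ℓ + a) b)] at h1
    rw [Pi.zero_apply, ← mul_zero t, ← h1, mul_sum, Matrix.vecMul, dotProduct]
    refine sum_congr rfl fun a _ => ?_
    rw [Matrix.add_apply, Matrix.smul_apply, smul_eq_mul, hA, hB, add_comm ℓ, hfℓ, pow_add]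
    have h3 : ((-1 : ℂ) ^ ℓ) * (-1) ^ ℓ = 1 := by rw [← mul_pow]; simp
    linear_combination ((-1) ^ (a : ℕ) * f a * bandEntry (extCol X) (a + ℓ) b) *
      (-h3 - (-1) ^ ℓ * ht)

end CoefficientString

/-! ### Inversion symmetry and distinctness of the eigenvalues. -/

section Eigenvalues

variable {k p : ℕ}

theorem distEigenvalue_ne_zero (j : ℕ) : distEigenvalue k p j ≠ 0 := Complex.exp_ne_zero _

theorem distEigenvalue_mul_rev (j : Fin k) :
    distEigenvalue k p j * distEigenvalue k p j.rev = 1 := by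
  rw [distEigenvalue, distEigenvalue, ← Complex.exp_add, Fin.val_rev,
    Nat.cast_sub (by have := j.2; omega)]
  convert Complex.exp_zero using 2
  push_cast
  ring

/-- Equal exponentials force p to divide b - a, and |b - a| < k ≤ p. -/
theorem distEigenvalue_injective (hp : k ≤ p) :
    Function.Injective fun j : Fin k => distEigenvalue k p j := by
  intro a b hab
  obtain ⟨N, hN⟩ := Complex.exp_eq_exp_iff_exists_int.1 hab
  have hp0 : (p : ℂ) ≠ 0 := by
    have := a.2
    exact_mod_cast (by omega : p ≠ 0)
  have hπ : (Real.pi : ℂ) * Complex.I ≠ 0 := by simp [Real.pi_ne_zero]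
  have h1 : ((b : ℕ) : ℂ) - (a : ℕ) = N * p := by
    apply mul_left_cancel₀ (mul_ne_zero two_ne_zero hπ)
    have h2 := congrArg (fun z => z * (p : ℂ)) hN
    simp only [add_mul] at h2
    field_simp at h2
    linear_combination (Real.pi * Complex.I) * h2
  have h2 : ((b : ℕ) : ℤ) - (a : ℕ) = N * p := by exact_mod_cast h1
  have h3 : (p : ℤ) ∣ ((b : ℕ) : ℤ) - (a : ℕ) := ⟨N, by rw [h2]; ring⟩
  have := a.2
  have := b.2
  have h4 := Int.eq_zero_of_abs_lt_dvd h3 (by rw [abs_lt]; omega)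
  exact Fin.ext (by omega)

end Eigenvalues

/-! ### Periodicity and coefficient strings on the distinguished component. -/

section DistinguishedComponent

variable {k n ℓ p : ℕ}

/-- On the distinguished component, Plücker coordinates are `ℓ`-periodic. -/
theorem plucker_image_add_of_mem_distinguished (hk : 0 < k) (hn : n = p * ℓ) (hn0 : 0 < n)
    {X : Matrix (Fin k) (Fin n) ℂ} (hX : X ∈ distinguished k n ℓ) (I : Finset ℤ) :
    plucker X (I.image (· + (ℓ : ℤ))) = plucker X I := by
  have : NeZero n := ⟨hn0.ne'⟩
  obtain ⟨X₀, hX₀, hTNN, hXc⟩ := id hX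
  obtain ⟨T, hT⟩ := exists_intertwiner (connectedComponentIn_subset _ _ hXc)
  have h1 := det_sub_of_mem_distinguished hk hn hn0 hX hT 0
  have h2 : T.det = ∏ j : Fin k, distEigenvalue k p j := by
    simp only [zero_smul, zero_sub, Matrix.det_neg, prod_neg, Fintype.card_fin, card_univ] at h1
    exact mul_left_cancel₀ (pow_ne_zero k (neg_ne_zero.2 one_ne_zero)) h1
  have h4 : T.det = 1 := by
    rw [h2]
    simp only [distEigenvalue]
    rw [← Complex.exp_sum, ← sum_mul]
    -- The exponents k-1-2j are antisymmetric under j ↦ k-1-j, so the eigenvalues multiply to 1.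
    have h5 : ∑ j : Fin k, ((k : ℂ) - 1 - 2 * (j : ℕ)) = 0 := by
      have h6 : ∑ j : Fin k, ((k : ℂ) - 1 - 2 * (j : ℕ)) =
          -∑ j : Fin k, ((k : ℂ) - 1 - 2 * (j : ℕ)) := by
        conv_lhs => rw [← Equiv.sum_comp Fin.revPerm]
        rw [← sum_neg_distrib]
        refine sum_congr rfl fun j _ => ?_
        rw [Fin.revPerm_apply, Fin.val_rev, Nat.cast_sub (by have := j.2; omega)]
        push_cast
        ring
      exact self_eq_neg.1 h6
    rw [h5, zero_mul, Complex.exp_zero]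
  rw [plucker_add hk hT, h4, one_mul]

/-- An eigenvalue λ of T yields the root (-1)^ℓ λ⁻¹. The set of eigenvalues is closed under
inversion, so the roots are again the numbers (-1)^ℓ λ; k ≤ p makes them distinct. This step works
for every k. -/
theorem det_smul_matB_add_matA_eq (hk : 0 < k) (hkℓ : k < ℓ) (hp2 : 2 ≤ p) (hp : k ≤ p)
    (hn : n = p * ℓ) {X : Matrix (Fin k) (Fin n) ℂ} (hX : X ∈ distinguished k n ℓ) :
    ((Polynomial.X : ℂ[X]) • (matB k ℓ (phi' X)).map C + (matA k ℓ (phi' X)).map C).det =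
      C (∏ i ∈ Icc 1 ℓ, plucker X (initSet k ℓ (numMutable k ℓ + i))) *
        (∏ j : Fin k, (Polynomial.X - C ((-1) ^ ℓ * distEigenvalue k p j))) *
          Polynomial.X ^ (ℓ - k) := by
  have hℓn : 2 * ℓ ≤ n := by rw [hn]; exact Nat.mul_le_mul_right _ hp2
  have hn0 : 0 < n := by omega
  have : NeZero n := ⟨hn0.ne'⟩
  have hper := plucker_image_add_of_mem_distinguished hk hn hn0 hX
  have hband : phi' X ∈ band k ℓ := phi'_mem_band hk (by omega) hper
  obtain ⟨X₀, hX₀, hTNN, hXc⟩ := id hX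
  have hXf := connectedComponentIn_subset _ _ hXc
  obtain ⟨T, hT⟩ := exists_intertwiner hXf
  rw [← det_matB hk (by omega) hband hper]
  have h1 : ((-1 : ℂ) ^ ℓ) ≠ 0 := pow_ne_zero _ (by simp)
  refine det_eq_prod_of_roots hkℓ.le _ _ ?_ ?_ ?_
  · intro a b hab
    exact distEigenvalue_injective hp (mul_left_cancel₀ h1 hab)
  · intro j
    exact mul_ne_zero h1 (distEigenvalue_ne_zero _)
  · intro j
    refine det_smul_matB_add_matA hk hkℓ hℓn hXf.1 hband hT
      (lam := distEigenvalue k p j.rev) ?_ ?_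
    · rw [det_sub_of_mem_distinguished hk hn hn0 hX hT]
      exact prod_eq_zero (mem_univ j.rev) (sub_self _)
    · rw [mul_assoc, distEigenvalue_mul_rev, mul_one]

theorem exp_pi_div_sub_inv_ne_zero (hp : 2 ≤ p) :
    Complex.exp (Real.pi * Complex.I / p) - (Complex.exp (Real.pi * Complex.I / p))⁻¹ ≠ 0 := by
  have h := distEigenvalue_injective (k := 2) (p := p) hp
  have h1 : distEigenvalue 2 p (0 : Fin 2) ≠ distEigenvalue 2 p (1 : Fin 2) :=
    h.ne (by decide)
  rw [← Complex.exp_neg, sub_ne_zero]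
  simpa [distEigenvalue, show (2 : ℂ) - 1 = 1 by norm_num, show (1 : ℂ) - 2 = -1 by norm_num]
    using h1

theorem qInt_one (hp : 2 ≤ p) : qInt p 1 = 1 := by
  rw [qInt]
  simp only [pow_one]
  exact div_self (exp_pi_div_sub_inv_ne_zero hp)

theorem qInt_two (hp : 2 ≤ p) : qInt p 2 =
    Complex.exp (Real.pi * Complex.I / p) + (Complex.exp (Real.pi * Complex.I / p))⁻¹ := by
  rw [qInt, div_eq_iff (exp_pi_div_sub_inv_ne_zero hp)]
  have := Complex.exp_ne_zero (Real.pi * Complex.I / p)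
  field_simp
  ring

theorem qInt_three (hp : 2 ≤ p) : qInt p 3 =
    Complex.exp (Real.pi * Complex.I / p) ^ 2 + 1 +
      (Complex.exp (Real.pi * Complex.I / p) ^ 2)⁻¹ := by
  rw [qInt, div_eq_iff (exp_pi_div_sub_inv_ne_zero hp)]
  have := Complex.exp_ne_zero (Real.pi * Complex.I / p)
  field_simp
  ring

theorem distEigenvalue_three_zero :
    distEigenvalue 3 p 0 = Complex.exp (Real.pi * Complex.I / p) ^ 2 := by
  rw [← Complex.exp_nat_mul, distEigenvalue]; congr 1; push_cast; ring

theorem distEigenvalue_three_one : distEigenvalue 3 p 1 = 1 := by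
  rw [distEigenvalue]; convert Complex.exp_zero using 2; push_cast; ring

theorem distEigenvalue_three_two :
    distEigenvalue 3 p 2 = (Complex.exp (Real.pi * Complex.I / p) ^ 2)⁻¹ := by
  rw [← Complex.exp_nat_mul, ← Complex.exp_neg, distEigenvalue]; congr 1; push_cast; ring

/-- With h = exp(πi/p), vanishing of h + h⁻¹ would give h² = h⁻², two coinciding eigenvalues for k =
3. -/
theorem qInt_two_ne_zero (hp : 3 ≤ p) : qInt p 2 ≠ 0 := by
  rw [qInt_two (by omega)]
  intro h0
  have h1 : distEigenvalue 3 p 0 = distEigenvalue 3 p 2 := by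
    rw [distEigenvalue_three_zero, distEigenvalue_three_two, ← inv_pow]
    have h2 := eq_neg_of_add_eq_zero_left h0
    calc _ = (-(Complex.exp (Real.pi * Complex.I / p))⁻¹) ^ 2 := by rw [← h2]
      _ = _ := by ring
  exact absurd (@distEigenvalue_injective 3 p hp 0 2 h1) (by decide)

theorem eta_two (hp : 2 ≤ p) : eta 2 p 1 = distEigenvalue 2 p 0 + distEigenvalue 2 p 1 := by
  have h1 : distEigenvalue 2 p 0 = Complex.exp (Real.pi * Complex.I / p) := by
    rw [distEigenvalue]; congr 1; push_cast; ring
  have h2 : distEigenvalue 2 p 1 = (Complex.exp (Real.pi * Complex.I / p))⁻¹ := by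
    rw [distEigenvalue, ← Complex.exp_neg]; congr 1; push_cast; ring
  rw [h1, h2, ← qInt_two hp, eta, qFactorial, qFactorial]
  simp [show Icc 1 2 = {1, 2} by rfl, qInt_one hp]

theorem eta_three (hp : 3 ≤ p) {s : ℕ} (hs : s = 1 ∨ s = 2) :
    eta 3 p s = distEigenvalue 3 p 0 + distEigenvalue 3 p 1 + distEigenvalue 3 p 2 := by
  have h4 := qInt_two_ne_zero hp
  rw [distEigenvalue_three_zero, distEigenvalue_three_one, distEigenvalue_three_two,
    ← qInt_three (by omega)]
  rcases hs with rfl | rfl <;>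
    simp [eta, qFactorial, show Icc 1 2 = {1, 2} by rfl, show Icc 1 3 = {1, 2, 3} by rfl,
      qInt_one (show 2 ≤ p by omega)] <;> field_simp

/-- Vieta gives the elementary symmetric function e_s of the eigenvalues with sign (-1)^(s+sℓ),
which the normalizing sign (-1)^(s(ℓ-s)) removes because s² and s have the same parity. For k = 3,
e_1 = e_2: the eigenvalues are 1 and an inverse pair. -/
theorem coeffString_phi' (hkℓ : k < ℓ) (hp : k ≤ p) (hn : n = p * ℓ) (hk : k = 2 ∨ k = 3)
    {X : Matrix (Fin k) (Fin n) ℂ} (hX : X ∈ distinguished k n ℓ) {s : ℕ}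
    (hs : s ∈ Icc 1 (k - 1)) :
    coeffString k ℓ s (phi' X) =
      eta k p s * ∏ i ∈ Icc 1 ℓ, plucker X (initSet k ℓ (numMutable k ℓ + i)) := by
  rw [mem_Icc] at hs
  have hdet := det_smul_matB_add_matA_eq (by omega) hkℓ (by omega) hp hn hX
  rw [coeffString, charCoeff, hdet]
  rw [show ℓ - s = (k - s) + (ℓ - k) by omega, coeff_mul_X_pow, coeff_C_mul]
  set F := ∏ i ∈ Icc 1 ℓ, plucker X (initSet k ℓ (numMutable k ℓ + i))
  have hsq : ∀ m : ℕ, ((-1 : ℂ) ^ m) * (-1) ^ m = 1 := fun m => by rw [← mul_pow]; simp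
  rcases hk with rfl | rfl
  · obtain rfl : s = 1 := by omega
    obtain ⟨e, rfl⟩ : ∃ e, ℓ = e + 2 := ⟨ℓ - 2, by omega⟩
    have h1 : ∀ a b : ℂ, ((Polynomial.X - C a) * (Polynomial.X - C b)).coeff 1 = -(a + b) := by
      intro a b
      have : (Polynomial.X - C a) * (Polynomial.X - C b) =
          Polynomial.X ^ 2 - C (a + b) * Polynomial.X + C (a * b) := by
        simp only [map_add, map_mul]; ring
      rw [this]
      simp [coeff_X_pow, coeff_C]
    rw [Fin.prod_univ_two, show 2 - 1 = 1 from rfl, h1, eta_two hp]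
    simp only [Fin.val_zero, Fin.val_one]
    rw [show 1 * (1 + (e + 2 - 2)) = e + 1 by omega, show e + 2 = e + 1 + 1 by omega,
      pow_succ _ (e + 1)]
    linear_combination (F * (distEigenvalue 2 p 0 + distEigenvalue 2 p 1)) * hsq (e + 1)
  · obtain ⟨e, rfl⟩ : ∃ e, ℓ = e + 3 := ⟨ℓ - 3, by omega⟩
    have h1 : ∀ a b c : ℂ, (Polynomial.X - C a) * (Polynomial.X - C b) * (Polynomial.X - C c) =
        Polynomial.X ^ 3 - C (a + b + c) * Polynomial.X ^ 2 +
          C (a * b + b * c + a * c) * Polynomial.X - C (a * b * c) := by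
      intro a b c
      simp only [map_add, map_mul]; ring
    have hrev : distEigenvalue 3 p 0 * distEigenvalue 3 p 2 = 1 :=
      distEigenvalue_mul_rev (k := 3) (p := p) 0
    rw [Fin.prod_univ_three, h1, eta_three hp (by omega)]
    simp only [Fin.val_zero, Fin.val_one, Fin.val_two]
    rcases (show s = 1 ∨ s = 2 by omega) with rfl | rfl
    · simp only [show 3 - 1 = 2 from rfl, coeff_add, coeff_sub, coeff_C_mul, coeff_X_pow, coeff_X,
        coeff_C]
      norm_num
      rw [show 2 + e = e + 2 by omega, show e + 3 = e + 2 + 1 by omega, pow_succ _ (e + 2)]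
      linear_combination (F * (distEigenvalue 3 p 0 + distEigenvalue 3 p 1 +
        distEigenvalue 3 p 2)) * hsq (e + 2)
    · simp only [show 3 - 2 = 1 from rfl, coeff_add, coeff_sub, coeff_C_mul, coeff_X_pow, coeff_X,
        coeff_C]
      norm_num
      rw [distEigenvalue_three_one]
      linear_combination (F * (distEigenvalue 3 p 0 + 1 +
        distEigenvalue 3 p 2)) * hsq (e + 3) + F * ((-1) ^ (e + 3)) * ((-1) ^ (e + 3)) * hrev

end DistinguishedComponent

/-! ### Extension of a ring homomorphism to fractions -/

set_option linter.unusedSectionVars false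

section FractionMap

variable {A B : Type} [CommRing A] [IsDomain A] [CommRing B] [IsDomain B]

open Classical in
/-- The partially defined map of fraction fields induced by a ring homomorphism: it sends `g / h` to
`Θ g / Θ h` when `Θ h ≠ 0`. -/
def fractionMap (Θ : A →+* B) (f : FractionRing A) : FractionRing B :=
  if H : ∃ g h : A, Θ h ≠ 0 ∧ f * algebraMap A (FractionRing A) h = algebraMap A (FractionRing A) g
  then algebraMap B (FractionRing B) (Θ H.choose) /
    algebraMap B (FractionRing B) (Θ H.choose_spec.choose)
  else 0

theorem algebraMap_fractionRing_ne_zero {b : B} (hb : b ≠ 0) :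
    algebraMap B (FractionRing B) b ≠ 0 := by
  rwa [Ne, FaithfulSMul.algebraMap_eq_zero_iff]

/-- Two representations with denominators outside the kernel have the same image: cross-multiply in
A, where the fractions are equal, and then apply Θ. -/
theorem fractionMap_eq (Θ : A →+* B) {f : FractionRing A} {g h : A} (hh : Θ h ≠ 0)
    (hf : f * algebraMap A (FractionRing A) h = algebraMap A (FractionRing A) g) :
    fractionMap Θ f =
      algebraMap B (FractionRing B) (Θ g) / algebraMap B (FractionRing B) (Θ h) := by
  have H : ∃ g h : A, Θ h ≠ 0 ∧
      f * algebraMap A (FractionRing A) h = algebraMap A (FractionRing A) g := ⟨g, h, hh, hf⟩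
  rw [fractionMap, dif_pos H]
  set g' := H.choose
  set h' := H.choose_spec.choose
  obtain ⟨hh', hf'⟩ : Θ h' ≠ 0 ∧
      f * algebraMap A (FractionRing A) h' = algebraMap A (FractionRing A) g' :=
    H.choose_spec.choose_spec
  rw [div_eq_div_iff (algebraMap_fractionRing_ne_zero hh') (algebraMap_fractionRing_ne_zero hh),
    ← map_mul, ← map_mul, ← map_mul, ← map_mul]
  congr 2
  apply FaithfulSMul.algebraMap_injective A (FractionRing A)
  rw [map_mul, map_mul, ← hf, ← hf']
  ring

theorem fractionMap_algebraMap (Θ : A →+* B) (a : A) :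
    fractionMap Θ (algebraMap A (FractionRing A) a) = algebraMap B (FractionRing B) (Θ a) := by
  rw [fractionMap_eq Θ (g := a) (h := 1) (by simp) (by simp)]
  simp

/-- `f` is a quotient of two elements which are positive at a point (given by `ε`). -/
def IsPositiveAt (ε : A →+* ℂ) (f : FractionRing A) : Prop :=
  ∃ (g h : A) (r s : ℝ), 0 < r ∧ 0 < s ∧ ε g = r ∧ ε h = s ∧
    f * algebraMap A (FractionRing A) h = algebraMap A (FractionRing A) g

variable {ε : A →+* ℂ} {f f' : FractionRing A}

theorem isPositiveAt_of_eq_one {a : A} (ha : ε a = 1) :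
    IsPositiveAt ε (algebraMap A (FractionRing A) a) :=
  ⟨a, 1, 1, 1, one_pos, one_pos, by simpa using ha, by simp, by simp⟩

theorem IsPositiveAt.add (hf : IsPositiveAt ε f) (hf' : IsPositiveAt ε f') :
    IsPositiveAt ε (f + f') := by
  obtain ⟨g, h, r, s, hr, hs, hg, hh, e⟩ := hf
  obtain ⟨g', h', r', s', hr', hs', hg', hh', e'⟩ := hf'
  refine ⟨g * h' + g' * h, h * h', r * s' + r' * s, s * s', by positivity, by positivity, ?_, ?_, ?_⟩
  · simp [hg, hh, hg', hh']
  · simp [hh, hh']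
  · simp only [map_add, map_mul, ← e, ← e']; ring

theorem IsPositiveAt.mul (hf : IsPositiveAt ε f) (hf' : IsPositiveAt ε f') :
    IsPositiveAt ε (f * f') := by
  obtain ⟨g, h, r, s, hr, hs, hg, hh, e⟩ := hf
  obtain ⟨g', h', r', s', hr', hs', hg', hh', e'⟩ := hf'
  refine ⟨g * g', h * h', r * r', s * s', by positivity, by positivity, ?_, ?_, ?_⟩
  · simp [hg, hg']
  · simp [hh, hh']
  · simp only [map_mul, ← e, ← e']; ring

theorem IsPositiveAt.ne_zero (hf : IsPositiveAt ε f) : f ≠ 0 := by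
  obtain ⟨g, h, r, s, hr, hs, hg, hh, e⟩ := hf
  rintro rfl
  rw [zero_mul, eq_comm, FaithfulSMul.algebraMap_eq_zero_iff] at e
  rw [e, map_zero, eq_comm] at hg
  exact hr.ne' (by exact_mod_cast hg)

theorem IsPositiveAt.inv (hf : IsPositiveAt ε f) : IsPositiveAt ε f⁻¹ := by
  have h0 := hf.ne_zero
  obtain ⟨g, h, r, s, hr, hs, hg, hh, e⟩ := hf
  refine ⟨h, g, s, r, hs, hr, hh, hg, ?_⟩
  rw [← e, inv_mul_cancel_left₀ h0]

theorem IsPositiveAt.div (hf : IsPositiveAt ε f) (hf' : IsPositiveAt ε f') :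
    IsPositiveAt ε (f / f') := by
  rw [div_eq_mul_inv]; exact hf.mul hf'.inv

variable {δ : B →+* ℂ} {Θ : A →+* B}

/-- The test evaluation factors through Θ, so an element that is positive there cannot lie in the
kernel of Θ. This protects denominators although Θ is not injective. -/
theorem map_ne_zero_of_pos (hε : ε = δ.comp Θ) {h : A} {s : ℝ} (hs : 0 < s) (hh : ε h = s) :
    Θ h ≠ 0 := by
  intro h0
  rw [hε, RingHom.comp_apply, h0, map_zero, eq_comm] at hh
  exact hs.ne' (by exact_mod_cast hh)

theorem fractionMap_add (hε : ε = δ.comp Θ) (hf : IsPositiveAt ε f) (hf' : IsPositiveAt ε f') :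
    fractionMap Θ (f + f') = fractionMap Θ f + fractionMap Θ f' := by
  obtain ⟨g, h, r, s, hr, hs, hg, hh, e⟩ := hf
  obtain ⟨g', h', r', s', hr', hs', hg', hh', e'⟩ := hf'
  have h1 := map_ne_zero_of_pos hε hs hh
  have h2 := map_ne_zero_of_pos hε hs' hh'
  rw [fractionMap_eq Θ h1 e, fractionMap_eq Θ h2 e',
    fractionMap_eq Θ (g := g * h' + h * g') (h := h * h')
      (by rw [map_mul]; exact mul_ne_zero h1 h2)
      (by simp only [map_add, map_mul, ← e, ← e']; ring)]
  rw [div_add_div _ _ (algebraMap_fractionRing_ne_zero h1) (algebraMap_fractionRing_ne_zero h2)]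
  simp only [map_add, map_mul]

theorem fractionMap_mul (hε : ε = δ.comp Θ) (hf : IsPositiveAt ε f) (hf' : IsPositiveAt ε f') :
    fractionMap Θ (f * f') = fractionMap Θ f * fractionMap Θ f' := by
  obtain ⟨g, h, r, s, hr, hs, hg, hh, e⟩ := hf
  obtain ⟨g', h', r', s', hr', hs', hg', hh', e'⟩ := hf'
  have h1 := map_ne_zero_of_pos hε hs hh
  have h2 := map_ne_zero_of_pos hε hs' hh'
  rw [fractionMap_eq Θ h1 e, fractionMap_eq Θ h2 e',
    fractionMap_eq Θ (g := g * g') (h := h * h')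
      (by rw [map_mul]; exact mul_ne_zero h1 h2)
      (by simp only [map_mul, ← e, ← e']; ring)]
  rw [div_mul_div_comm]
  simp only [map_mul]

theorem fractionMap_inv (hε : ε = δ.comp Θ) (hf : IsPositiveAt ε f) :
    fractionMap Θ f⁻¹ = (fractionMap Θ f)⁻¹ := by
  have h0 := hf.ne_zero
  obtain ⟨g, h, r, s, hr, hs, hg, hh, e⟩ := hf
  have h1 := map_ne_zero_of_pos hε hs hh
  have h2 := map_ne_zero_of_pos hε hr hg
  rw [fractionMap_eq Θ h1 e, fractionMap_eq Θ (g := h) (h := g) h2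
    (by rw [← e, inv_mul_cancel_left₀ h0]), inv_div]

theorem fractionMap_div (hε : ε = δ.comp Θ) (hf : IsPositiveAt ε f) (hf' : IsPositiveAt ε f') :
    fractionMap Θ (f / f') = fractionMap Θ f / fractionMap Θ f' := by
  rw [div_eq_mul_inv, fractionMap_mul hε hf hf'.inv, fractionMap_inv hε hf', div_eq_mul_inv]

end FractionMap

/-! ### Laurent monomials -/

section LaurentMonomials

variable {K : Type} [Field K] {G : Set K}

theorem mem_laurentMonomials {f : K} (hf : f ∈ G) (h0 : f ≠ 0) : f ∈ laurentMonomials G :=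
  ⟨Units.mk0 f h0, Subgroup.subset_closure hf, rfl⟩

theorem one_mem_laurentMonomials : (1 : K) ∈ laurentMonomials G := ⟨1, one_mem _, rfl⟩

theorem mul_mem_laurentMonomials {f g : K} (hf : f ∈ laurentMonomials G)
    (hg : g ∈ laurentMonomials G) : f * g ∈ laurentMonomials G := by
  obtain ⟨u, hu, rfl⟩ := hf
  obtain ⟨v, hv, rfl⟩ := hg
  exact ⟨u * v, mul_mem hu hv, rfl⟩

theorem inv_mem_laurentMonomials {f : K} (hf : f ∈ laurentMonomials G) :
    f⁻¹ ∈ laurentMonomials G := by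
  obtain ⟨u, hu, rfl⟩ := hf
  exact ⟨u⁻¹, inv_mem hu, by simp⟩

theorem pow_mem_laurentMonomials {f : K} (hf : f ∈ laurentMonomials G) (m : ℕ) :
    f ^ m ∈ laurentMonomials G := by
  obtain ⟨u, hu, rfl⟩ := hf
  exact ⟨u ^ m, pow_mem hu m, by simp⟩

theorem prod_mem_laurentMonomials {ι : Type*} {S : Finset ι} {f : ι → K}
    (hf : ∀ i ∈ S, f i ∈ laurentMonomials G) : ∏ i ∈ S, f i ∈ laurentMonomials G :=
  prod_induction f (· ∈ laurentMonomials G) (fun _ _ => mul_mem_laurentMonomials)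
    one_mem_laurentMonomials hf

end LaurentMonomials

theorem laurentMonomials_fractionMap {A B : Type} [CommRing A] [IsDomain A] [CommRing B]
    [IsDomain B] {ε : A →+* ℂ} {δ : B →+* ℂ} {Θ : A →+* B} (hε : ε = δ.comp Θ)
    {G : Set (FractionRing A)} {P : Set (FractionRing B)}
    (hG : ∀ f ∈ G, IsPositiveAt ε f ∧ fractionMap Θ f ∈ laurentMonomials P)
    {f : FractionRing A} (hf : f ∈ laurentMonomials G) :
    IsPositiveAt ε f ∧ fractionMap Θ f ∈ laurentMonomials P := by
  obtain ⟨u, hu, rfl⟩ := hf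
  induction hu using Subgroup.closure_induction with
  | mem u hu => exact hG _ hu
  | one =>
    have h1 : ((1 : (FractionRing A)ˣ) : FractionRing A) = algebraMap A (FractionRing A) 1 := by simp
    rw [h1]
    exact ⟨isPositiveAt_of_eq_one (map_one ε), by
      rw [fractionMap_algebraMap]; simpa using one_mem_laurentMonomials⟩
  | mul u v _ _ hu hv =>
    rw [Units.val_mul]
    refine ⟨hu.1.mul hv.1, ?_⟩
    rw [fractionMap_mul hε hu.1 hv.1]
    exact mul_mem_laurentMonomials hu.2 hv.2
  | inv u _ hu =>
    rw [Units.val_inv_eq_inv_val]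
    refine ⟨hu.1.inv, ?_⟩
    rw [fractionMap_inv hε hu.1]
    exact inv_mem_laurentMonomials hu.2

/-- Additivity and multiplicativity of `fractionMap` are available only for fractions positive at
the test point, so positivity is carried through the induction. -/
theorem subtractionFree_fractionMap {A B : Type} [CommRing A] [IsDomain A] [CommRing B]
    [IsDomain B] {ε : A →+* ℂ} {δ : B →+* ℂ} {Θ : A →+* B} (hε : ε = δ.comp Θ)
    {G : Set (FractionRing A)} {P : Set (FractionRing B)}
    (hG : ∀ f ∈ G, IsPositiveAt ε f ∧ SubtractionFree P (fractionMap Θ f))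
    {f : FractionRing A} (hf : SubtractionFree G f) :
    IsPositiveAt ε f ∧ SubtractionFree P (fractionMap Θ f) := by
  induction hf with
  | of h => exact hG _ h
  | add _ _ h1 h2 =>
    exact ⟨h1.1.add h2.1, by rw [fractionMap_add hε h1.1 h2.1]; exact h1.2.add h2.2⟩
  | mul _ _ h1 h2 =>
    exact ⟨h1.1.mul h2.1, by rw [fractionMap_mul hε h1.1 h2.1]; exact h1.2.mul h2.2⟩
  | div _ _ h1 h2 =>
    exact ⟨h1.1.div h2.1, by rw [fractionMap_div hε h1.1 h2.1]; exact h1.2.div h2.2⟩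

/-! ### The exchange matrix -/

/-- Each family of arrows contributes at most one arrow between i and j in either direction. The
conditions 2 ≤ i and ℓ < i say that the index of the arrow triangle, i-1 or i-ℓ, is at least 1;
multiplicities may still add up when two families coincide. -/
theorem exchange_eq {k ℓ i j : ℕ} (hi : i ∈ Icc 1 (numMutable k ℓ)) (hj : 1 ≤ j) :
    exchange k ℓ j i =
      (if j = i + 1 then 1 else 0) + (if j + ℓ = i then 1 else 0) +
      (if 2 ≤ i ∧ j + 1 = i + ℓ then 1 else 0) - (if j + 1 = i then 1 else 0) -
      (if j = i + ℓ then 1 else 0) - (if ℓ < i ∧ j + ℓ = i + 1 then 1 else 0) := by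
  rw [mem_Icc] at hi
  have key : ∀ (c : ℕ → Prop) [DecidablePred c] (P : Prop) [Decidable P] (t : ℕ),
      (∀ x ∈ Icc 1 (numMutable k ℓ), c x ↔ x = t ∧ P) → (P → t ∈ Icc 1 (numMutable k ℓ)) →
      ∑ x ∈ Icc 1 (numMutable k ℓ), (if c x then (1 : ℤ) else 0) = if P then 1 else 0 := by
    intro c _ P _ t h1 h2
    split_ifs with hP
    · rw [sum_eq_single t]
      · rw [if_pos ((h1 t (h2 hP)).2 ⟨rfl, hP⟩)]
      · intro b hb hne
        rw [if_neg fun h => hne ((h1 b hb).1 h).1]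
      · intro h; exact absurd (h2 hP) h
    · exact sum_eq_zero fun b hb => if_neg fun h => hP ((h1 b hb).1 h).2
  simp only [exchange, arrows, sum_add_distrib]
  rw [key (fun x => j = x + 1 ∧ i = x) (j = i + 1) i, key (fun x => j = x ∧ i = x + ℓ) (j + ℓ = i) j,
    key (fun x => j = x + ℓ ∧ i = x + 1) (2 ≤ i ∧ j + 1 = i + ℓ) (i - 1),
    key (fun x => i = x + 1 ∧ j = x) (j + 1 = i) j, key (fun x => i = x ∧ j = x + ℓ) (j = i + ℓ) i,
    key (fun x => i = x + ℓ ∧ j = x + 1) (ℓ < i ∧ j + ℓ = i + 1) (i - ℓ)]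
  · ring
  all_goals
    first
    | (intro x hx; rw [mem_Icc] at hx; omega)
    | (rw [mem_Icc]; omega)

section ExchangeProducts

variable {K : Type} [Field K] {k ℓ : ℕ}

theorem prod_zpow_ite (S : Finset ℕ) (H : ℕ → K) (c : Prop) [Decidable c] (m : ℕ) (P : ℕ → Prop)
    [DecidablePred P] (hP : ∀ j ∈ S, P j ↔ j = m ∧ c) :
    ∏ j ∈ S, H j ^ (if P j then (1 : ℤ) else 0) = if m ∈ S ∧ c then H m else 1 := by
  split_ifs with h
  · rw [prod_eq_single_of_mem m h.1, if_pos ((hP m h.1).2 ⟨rfl, h.2⟩), zpow_one]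
    intro b hb hne
    rw [if_neg fun h' => hne ((hP b hb).1 h').1, zpow_zero]
  · refine prod_eq_one fun b hb => ?_
    rw [if_neg, zpow_zero]
    intro h'
    obtain ⟨rfl, hc⟩ := (hP b hb).1 h'
    exact h ⟨hb, hc⟩

theorem prod_zpow_exchange {i : ℕ} (hi : i ∈ Icc 1 (numMutable k ℓ)) (S : Finset ℕ)
    (hS : ∀ j ∈ S, 1 ≤ j) (H : ℕ → K) (hH : ∀ j, H j ≠ 0) :
    ∏ j ∈ S, H j ^ exchange k ℓ j i =
      (if i + 1 ∈ S ∧ True then H (i + 1) else 1) * (if i - ℓ ∈ S ∧ ℓ < i then H (i - ℓ) else 1) *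
      (if i + ℓ - 1 ∈ S ∧ 2 ≤ i then H (i + ℓ - 1) else 1) /
      (if i - 1 ∈ S ∧ 2 ≤ i then H (i - 1) else 1) / (if i + ℓ ∈ S ∧ True then H (i + ℓ) else 1) /
      (if i + 1 - ℓ ∈ S ∧ ℓ < i then H (i + 1 - ℓ) else 1) := by
  have h1 : ∀ j ∈ S, H j ^ exchange k ℓ j i =
      H j ^ (if j = i + 1 then (1 : ℤ) else 0) * H j ^ (if j + ℓ = i then (1 : ℤ) else 0) *
      H j ^ (if 2 ≤ i ∧ j + 1 = i + ℓ then (1 : ℤ) else 0) /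
      H j ^ (if j + 1 = i then (1 : ℤ) else 0) / H j ^ (if j = i + ℓ then (1 : ℤ) else 0) /
      H j ^ (if ℓ < i ∧ j + ℓ = i + 1 then (1 : ℤ) else 0) := by
    intro j hj
    rw [exchange_eq hi (hS j hj), zpow_sub₀ (hH j), zpow_sub₀ (hH j), zpow_sub₀ (hH j),
      zpow_add₀ (hH j), zpow_add₀ (hH j)]
  rw [mem_Icc] at hi
  rw [prod_congr rfl h1, prod_div_distrib, prod_div_distrib, prod_div_distrib, prod_mul_distrib,
    prod_mul_distrib,
    prod_zpow_ite S H True (i + 1) (fun j => j = i + 1) (by intros; simp),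
    prod_zpow_ite S H (ℓ < i) (i - ℓ) (fun j => j + ℓ = i)
      (by intro j hj; have := hS j hj; omega),
    prod_zpow_ite S H (2 ≤ i) (i + ℓ - 1) (fun j => 2 ≤ i ∧ j + 1 = i + ℓ)
      (by intro j hj; omega),
    prod_zpow_ite S H (2 ≤ i) (i - 1) (fun j => j + 1 = i)
      (by intro j hj; have := hS j hj; omega),
    prod_zpow_ite S H True (i + ℓ) (fun j => j = i + ℓ) (by intros; simp),
    prod_zpow_ite S H (ℓ < i) (i + 1 - ℓ) (fun j => ℓ < i ∧ j + ℓ = i + 1)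
      (by intro j hj; omega)]

theorem prod_toNat_div_prod_toNat (S : Finset ℕ) (H : ℕ → K) (hH : ∀ j, H j ≠ 0) (b : ℕ → ℤ) :
    (∏ j ∈ S, H j ^ (b j).toNat) / ∏ j ∈ S, H j ^ (-b j).toNat = ∏ j ∈ S, H j ^ b j := by
  rw [← prod_div_distrib]
  refine prod_congr rfl fun j _ => ?_
  rw [← zpow_natCast, ← zpow_natCast, ← zpow_sub₀ (hH j)]
  congr 1
  omega

end ExchangeProducts

/-! ### The monomial substitution inducing ψ*. -/

section Psi

variable {k ℓ : ℕ}

/-- The coefficient string variable `z_s` as a polynomial. -/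
def zPoly (k ℓ s : ℕ) : MvPolynomial (CycVar k ℓ) ℂ :=
  if h : 1 ≤ min s (k - s) ∧ min s (k - s) ≤ k / 2 then
    MvPolynomial.X (.z ⟨min s (k - s), h⟩) else 1

/-- The images of the initial variables under `ψ^*`. -/
def psiVar (k ℓ : ℕ) : GSVVar k ℓ → MvPolynomial (CycVar k ℓ) ℂ
  | .x i => MvPolynomial.X (.x i) * ∏ b ∈ Ico (i : ℕ) (numMutable k ℓ),
      MvPolynomial.X (.frozen ((b : ZMod ℓ) + k))
  | .diag j => MvPolynomial.X (.frozen (j - 1))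
  | .outer j => MvPolynomial.X (.frozen (j + k))
  | .c s => zPoly k ℓ s * ∏ i ∈ Icc 1 ℓ, MvPolynomial.X (.frozen (i : ZMod ℓ))

/-- The substitution inducing `ψ^*`. -/
def psiPoly (k ℓ : ℕ) : MvPolynomial (GSVVar k ℓ) ℂ →+* MvPolynomial (CycVar k ℓ) ℂ :=
  (MvPolynomial.aeval (psiVar k ℓ) : MvPolynomial (GSVVar k ℓ) ℂ →ₐ[ℂ] _).toRingHom

/-- The map `ψ^*`. -/
def psi (k ℓ : ℕ) : GSVField k ℓ → CycField k ℓ := fractionMap (psiPoly k ℓ)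

/-- The frozen variables of `𝒜_cyc`. -/
def cycFrozen (k ℓ : ℕ) (j : ZMod ℓ) : CycField k ℓ := cycVar (.frozen j)

theorem cycVar_ne_zero (v : CycVar k ℓ) : cycVar v ≠ 0 :=
  algebraMap_fractionRing_ne_zero (MvPolynomial.X_ne_zero v)

theorem cycFrozen_ne_zero (j : ZMod ℓ) : cycFrozen k ℓ j ≠ 0 := cycVar_ne_zero _

theorem cycX_numMutable_add {j : ℕ} (hj : 1 ≤ j) :
    cycX k ℓ (numMutable k ℓ + j) = cycFrozen k ℓ j := by
  rw [cycX, dif_neg (by omega), Nat.add_sub_cancel_left, cycFrozen]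

theorem cycX_resIcc (hℓ : 0 < ℓ) (a : ℤ) :
    cycX k ℓ (numMutable k ℓ + resIcc ℓ a) = cycFrozen k ℓ a := by
  have : NeZero ℓ := ⟨hℓ.ne'⟩
  rw [cycX_numMutable_add (by simp [resIcc])]
  congr 1
  have h1 : 0 ≤ (a - 1) % ℓ := Int.emod_nonneg _ (by omega)
  have h2 : ((resIcc ℓ a : ℤ) : ZMod ℓ) = (a : ZMod ℓ) := by
    have h3 : (resIcc ℓ a : ℤ) = (a - 1) % ℓ + 1 := by
      rw [resIcc]; push_cast; rw [Int.toNat_of_nonneg h1]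
    rw [h3, Int.cast_add, ZMod.intCast_mod]
    push_cast
    ring
  simpa using h2

theorem cycX_ne_zero (i : ℕ) : cycX k ℓ i ≠ 0 := by
  rw [cycX]
  split_ifs <;> exact cycVar_ne_zero _

theorem algebraMap_zPoly (s : ℕ) : algebraMap _ (CycField k ℓ) (zPoly k ℓ s) = cycZ k ℓ s := by
  rw [zPoly, cycZ]
  split_ifs
  · rfl
  · simp

theorem psi_gsvVar (v : GSVVar k ℓ) :
    psi k ℓ (gsvVar v) = algebraMap _ (CycField k ℓ) (psiVar k ℓ v) := by
  rw [psi, gsvVar, fractionMap_algebraMap]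
  congr 1
  simp [psiPoly]

/-- The monomial in frozen variables by which `ψ^*(x_i)` differs from `x̄_i`. -/
def frozenFactor (k ℓ i : ℕ) : CycField k ℓ :=
  ∏ b ∈ Ico i (numMutable k ℓ), cycFrozen k ℓ ((b : ZMod ℓ) + k)

theorem frozenFactor_ne_zero (i : ℕ) : frozenFactor k ℓ i ≠ 0 :=
  prod_ne_zero_iff.2 fun _ _ => cycFrozen_ne_zero _

theorem frozenFactor_of_le {i : ℕ} (hi : numMutable k ℓ ≤ i) : frozenFactor k ℓ i = 1 := by
  rw [frozenFactor, Ico_eq_empty (by omega), prod_empty]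

/-- Neighbouring factors differ by a single frozen variable, so quotients along the arrows of the
quiver telescope. -/
theorem frozenFactor_of_lt {i : ℕ} (hi : i < numMutable k ℓ) :
    frozenFactor k ℓ i = cycFrozen k ℓ ((i : ZMod ℓ) + k) * frozenFactor k ℓ (i + 1) := by
  rw [frozenFactor, frozenFactor, prod_eq_prod_Ico_succ_bot hi]

theorem psi_gsvX {i : ℕ} (hi : i ∈ Icc 1 (numMutable k ℓ)) :
    psi k ℓ (gsvX k ℓ i) = cycX k ℓ i * frozenFactor k ℓ i := by
  rw [mem_Icc] at hi
  rw [gsvX, dif_pos hi, psi_gsvVar, psiVar, map_mul, map_prod, cycX, dif_pos hi]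
  rfl

theorem psi_gsvDiag (i : ℤ) : psi k ℓ (gsvDiag k ℓ i) = cycFrozen k ℓ ((i : ZMod ℓ) - 1) := by
  rw [gsvDiag, psi_gsvVar]; rfl

theorem psi_gsvOuter (i : ℤ) : psi k ℓ (gsvOuter k ℓ i) = cycFrozen k ℓ ((i : ZMod ℓ) + k) := by
  rw [gsvOuter, psi_gsvVar]; rfl

theorem psi_gsvC {s : ℕ} (hs : 1 ≤ s ∧ s ≤ k - 1) : psi k ℓ (gsvC k ℓ s) =
    cycZ k ℓ s * ∏ i ∈ Icc 1 ℓ, cycFrozen k ℓ (i : ZMod ℓ) := by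
  rw [gsvC, dif_pos hs, psi_gsvVar, psiVar, map_mul, map_prod, algebraMap_zPoly]
  rfl

theorem psiOnVariables (hℓ : 0 < ℓ) : PsiOnVariables k ℓ (psi k ℓ) := by
  refine ⟨fun i hi => ?_, fun i => ⟨?_, ?_⟩⟩
  · rw [psi_gsvX hi, frozenFactor]
    congr 1
    refine prod_congr rfl fun b _ => ?_
    rw [cycX_resIcc hℓ]
    congr 1
    push_cast
    ring
  · rw [psi_gsvDiag, cycX_resIcc hℓ]
    congr 1
    push_cast
    ring
  · rw [psi_gsvOuter, cycX_resIcc hℓ]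
    congr 1
    push_cast
    ring

theorem psiOnCoefficients : PsiOnCoefficients k ℓ (psi k ℓ) := by
  intro s hs
  rw [psi_gsvC (mem_Icc.1 hs)]
  congr 1
  refine prod_congr rfl fun i hi => ?_
  rw [cycX_numMutable_add (mem_Icc.1 hi).1]

/-! ### Positivity -/

/-- Every variable is sent to a monomial with coefficient 1. The point with all coordinates 1 is
therefore the test point of `map_ne_zero_of_pos`. -/
theorem eval_one_psiPoly (k ℓ : ℕ) : (MvPolynomial.eval fun _ : GSVVar k ℓ => (1 : ℂ)) =
    (MvPolynomial.eval fun _ : CycVar k ℓ => (1 : ℂ)).comp (psiPoly k ℓ) := by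
  refine MvPolynomial.ringHom_ext (fun r => by simp [psiPoly]) fun v => ?_
  simp only [MvPolynomial.eval_X, RingHom.comp_apply, psiPoly, AlgHom.toRingHom_eq_coe,
    RingHom.coe_coe, MvPolynomial.aeval_X]
  cases v with
  | x i => simp [psiVar]
  | diag j => simp [psiVar]
  | outer j => simp [psiVar]
  | c s =>
    simp only [psiVar, zPoly]
    split_ifs <;> simp

theorem isPositiveAt_gsvVar (v : GSVVar k ℓ) :
    IsPositiveAt (MvPolynomial.eval fun _ : GSVVar k ℓ => (1 : ℂ)) (gsvVar v) :=
  isPositiveAt_of_eq_one (by simp)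

theorem cycFrozen_mem (j : ZMod ℓ) : cycFrozen k ℓ j ∈ cycCoeff k ℓ :=
  mem_laurentMonomials (Or.inl ⟨j, rfl⟩) (cycFrozen_ne_zero j)

theorem cycZ_mem (s : ℕ) : cycZ k ℓ s ∈ cycCoeff k ℓ := by
  rw [cycZ]
  split_ifs with h
  · exact mem_laurentMonomials (Or.inr ⟨_, rfl⟩) (cycVar_ne_zero _)
  · exact one_mem_laurentMonomials

theorem frozenFactor_mem (i : ℕ) : frozenFactor k ℓ i ∈ cycCoeff k ℓ :=
  prod_mem_laurentMonomials fun _ _ => cycFrozen_mem _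

theorem psi_coeff {f : GSVField k ℓ} (hf : f ∈ gsvCoeff k ℓ) :
    IsPositiveAt (MvPolynomial.eval fun _ : GSVVar k ℓ => (1 : ℂ)) f ∧ psi k ℓ f ∈ cycCoeff k ℓ := by
  refine laurentMonomials_fractionMap (eval_one_psiPoly k ℓ) ?_ hf
  rintro f ((⟨j, rfl⟩ | ⟨j, rfl⟩) | ⟨s, rfl⟩)
  · refine ⟨isPositiveAt_gsvVar _, ?_⟩
    change psi k ℓ _ ∈ cycCoeff k ℓ
    rw [psi_gsvVar]
    exact cycFrozen_mem _
  · refine ⟨isPositiveAt_gsvVar _, ?_⟩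
    change psi k ℓ _ ∈ cycCoeff k ℓ
    rw [psi_gsvVar]
    exact cycFrozen_mem _
  · refine ⟨isPositiveAt_gsvVar _, ?_⟩
    change psi k ℓ _ ∈ cycCoeff k ℓ
    rw [psi_gsvVar, psiVar, map_mul, map_prod, algebraMap_zPoly]
    exact mul_mem_laurentMonomials (cycZ_mem _)
      (prod_mem_laurentMonomials fun _ _ => cycFrozen_mem _)

theorem psi_ambient {f : GSVField k ℓ}
    (hf : f ∈ ambient (numMutable k ℓ) (gsvCoeff k ℓ) (gsvSeed k ℓ)) :
    IsPositiveAt (MvPolynomial.eval fun _ : GSVVar k ℓ => (1 : ℂ)) f ∧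
      psi k ℓ f ∈ ambient (numMutable k ℓ) (cycCoeff k ℓ) (cycSeed k ℓ) := by
  refine subtractionFree_fractionMap (eval_one_psiPoly k ℓ) ?_ hf
  rintro f (⟨i, hi, rfl⟩ | hf)
  · constructor
    · have hi' := mem_Icc.1 hi
      change IsPositiveAt _ (gsvX k ℓ i)
      rw [gsvX, dif_pos hi']
      exact isPositiveAt_gsvVar _
    · change SubtractionFree _ (psi k ℓ (gsvX k ℓ i))
      rw [psi_gsvX hi]
      exact SubtractionFree.mul (SubtractionFree.of (Or.inl ⟨i, hi, rfl⟩))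
        (SubtractionFree.of (Or.inr (frozenFactor_mem i)))
  · exact ⟨(psi_coeff hf).1, SubtractionFree.of (Or.inr (psi_coeff hf).2)⟩

/-! ### Specialization -/

/-- Evaluation at b after the substitution is evaluation at a, so a denominator not vanishing at a
has nonzero image and the image fraction is defined at b with the same value. -/
theorem hasValueAt_psi {a : GSVVar k ℓ → ℂ} {b : CycVar k ℓ → ℂ}
    (hab : ∀ v, MvPolynomial.eval b (psiVar k ℓ v) = a v) {f : GSVField k ℓ} {c : ℂ}
    (hf : HasValueAt a f c) : HasValueAt b (psi k ℓ f) c := by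
  have hcomp : (MvPolynomial.eval b).comp (psiPoly k ℓ) = MvPolynomial.eval a := by
    refine MvPolynomial.ringHom_ext (fun r => by simp [psiPoly]) fun v => ?_
    simp [psiPoly, hab]
  have hev : ∀ g, MvPolynomial.eval b (psiPoly k ℓ g) = MvPolynomial.eval a g := fun g => by
    rw [← hcomp]; rfl
  obtain ⟨g, h, hh, e, rfl⟩ := hf
  have h0 : psiPoly k ℓ h ≠ 0 := by
    intro h0
    rw [← hev, h0, map_zero] at hh
    exact hh rfl
  refine ⟨psiPoly k ℓ g, psiPoly k ℓ h, by rwa [hev], ?_, by rw [hev, hev]⟩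
  rw [psi, fractionMap_eq _ h0 e, div_mul_cancel₀ _ (algebraMap_fractionRing_ne_zero h0)]

/-! ### Coefficients -/

theorem cycZ_symm {s : ℕ} (hs : s ≤ k) : cycZ k ℓ (k - s) = cycZ k ℓ s := by
  have : min (k - s) (k - (k - s)) = min s (k - s) := by omega
  simp only [cycZ, this]

theorem cycZ_self : cycZ k ℓ k = 1 := by
  rw [cycZ, dif_neg (by simp)]

theorem gsvOuter_mem (i : ℤ) : gsvOuter k ℓ i ∈ gsvCoeff k ℓ :=
  mem_laurentMonomials (Or.inl (Or.inr ⟨_, rfl⟩))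
    (algebraMap_fractionRing_ne_zero (MvPolynomial.X_ne_zero _))

theorem gsvDiag_mem (i : ℤ) : gsvDiag k ℓ i ∈ gsvCoeff k ℓ :=
  mem_laurentMonomials (Or.inl (Or.inl ⟨_, rfl⟩))
    (algebraMap_fractionRing_ne_zero (MvPolynomial.X_ne_zero _))

theorem gsvC_mem (s : ℕ) : gsvC k ℓ s ∈ gsvCoeff k ℓ := by
  rw [gsvC]
  split_ifs
  · exact mem_laurentMonomials (Or.inr ⟨_, rfl⟩)
      (algebraMap_fractionRing_ne_zero (MvPolynomial.X_ne_zero _))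
  · exact one_mem_laurentMonomials

theorem gsvP_mem (i s : ℕ) : gsvP k ℓ i s ∈ gsvCoeff k ℓ := by
  have hm : ∀ {f g : GSVField k ℓ}, f ∈ gsvCoeff k ℓ → g ∈ gsvCoeff k ℓ → f * g ∈ gsvCoeff k ℓ :=
    mul_mem_laurentMonomials
  have hd : ∀ S : Finset ℕ, ∏ a ∈ S, gsvDiag k ℓ a ∈ gsvCoeff k ℓ := fun S =>
    prod_mem_laurentMonomials fun a _ => gsvDiag_mem a
  have ho : ∀ (S : Finset ℕ) (m : ℕ), ∏ a ∈ S, gsvOuter k ℓ a ^ m ∈ gsvCoeff k ℓ := fun S m =>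
    prod_mem_laurentMonomials fun a _ => pow_mem_laurentMonomials (gsvOuter_mem a) m
  have ho1 : ∀ S : Finset ℕ, ∏ a ∈ S, gsvOuter k ℓ a ∈ gsvCoeff k ℓ := fun S =>
    prod_mem_laurentMonomials fun a _ => gsvOuter_mem a
  have h1 : (1 : GSVField k ℓ) ∈ gsvCoeff k ℓ := one_mem_laurentMonomials
  unfold gsvP
  split_ifs <;> first
    | exact hm (hd _) (ho1 _)
    | exact hm (hd _) (ho _ _)
    | exact hm (gsvC_mem _) (ho _ _)
    | exact gsvC_mem _
    | exact hm (gsvOuter_mem _) (gsvDiag_mem _)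
    | exact gsvOuter_mem _
    | exact hm (gsvOuter_mem _) h1
    | exact hm h1 (gsvDiag_mem _)
    | exact hm h1 h1
    | exact h1

theorem isSeedOver_gsvSeed (hk : 1 ≤ k) :
    (gsvSeed k ℓ).IsSeedOver (numMutable k ℓ) (gsvCoeff k ℓ) := by
  refine ⟨fun i _ => ⟨?_, fun s _ => gsvP_mem i s⟩, fun _ => 1, fun _ => one_pos, fun i _ j _ => ?_⟩
  · change 1 ≤ degree k i
    rw [degree]; split_ifs <;> omega
  · simp [gsvSeed, exchange]

theorem isSeedOver_cycSeed (hk : 1 ≤ k) :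
    (cycSeed k ℓ).IsSeedOver (numMutable k ℓ) (cycCoeff k ℓ) := by
  refine ⟨fun i _ => ⟨?_, fun s _ => ?_⟩, fun _ => 1, fun _ => one_pos, fun i _ j _ => ?_⟩
  · change 1 ≤ degree k i
    rw [degree]; split_ifs <;> omega
  · refine mul_mem_laurentMonomials ?_ (prod_mem_laurentMonomials fun j hj => ?_)
    · split_ifs
      · exact cycZ_mem s
      · exact one_mem_laurentMonomials
    · refine pow_mem_laurentMonomials ?_ _
      rw [mem_Icc] at hj
      have : j = numMutable k ℓ + (j - numMutable k ℓ) := by omega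
      rw [this, cycX_numMutable_add (by omega)]
      exact cycFrozen_mem _
  · simp [cycSeed, exchange]

end Psi

/-! ### Comparison of the ŷ in the two initial seeds. -/

section Equivalence

variable {k ℓ : ℕ}

theorem psi_one : psi k ℓ 1 = 1 := by
  have := fractionMap_algebraMap (psiPoly k ℓ) 1
  rw [map_one, map_one, map_one] at this
  exact this

theorem psi_mul {f g : GSVField k ℓ} (hf : f ∈ gsvCoeff k ℓ) (hg : g ∈ gsvCoeff k ℓ) :
    psi k ℓ (f * g) = psi k ℓ f * psi k ℓ g :=
  fractionMap_mul (eval_one_psiPoly k ℓ) (psi_coeff hf).1 (psi_coeff hg).1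

theorem psi_pow {f : GSVField k ℓ} (hf : f ∈ gsvCoeff k ℓ) (m : ℕ) :
    psi k ℓ (f ^ m) = psi k ℓ f ^ m := by
  induction m with
  | zero => simpa using psi_one
  | succ m ih => rw [pow_succ, psi_mul (pow_mem_laurentMonomials hf m) hf, ih, pow_succ]

theorem psi_prod {ι : Type*} (S : Finset ι) {f : ι → GSVField k ℓ}
    (hf : ∀ a, f a ∈ gsvCoeff k ℓ) : psi k ℓ (∏ a ∈ S, f a) = ∏ a ∈ S, psi k ℓ (f a) := by
  classical
  induction S using Finset.induction_on with
  | empty => simpa using psi_one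
  | insert a S ha ih =>
    rw [prod_insert ha, prod_insert ha, psi_mul (hf a) (prod_mem_laurentMonomials fun b _ => hf b),
      ih]

theorem monPos_div_monNeg {K : Type} [Field K] (N : ℕ) (S : CSSeed K) (i : ℕ) (H : ℕ → K)
    (hH : ∀ j, H j ≠ 0) (hx : ∀ j ∈ Icc 1 N, S.x j = H j) :
    S.monPos N i / S.monNeg N i = ∏ j ∈ Icc 1 N, H j ^ S.B j i := by
  rw [← prod_toNat_div_prod_toNat _ H hH, CSSeed.monPos, CSSeed.monNeg]
  congr 1 <;> exact prod_congr rfl fun j hj => by rw [hx j hj]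

theorem cycZ_zero : cycZ k ℓ 0 = 1 := by
  rw [cycZ, dif_neg (by simp)]

/-- With b⁺ and b⁻ the positive and negative parts of b, the exponent s b⁺ + (d-s) b⁻ minus its
value d b⁻ at s = 0 is s b. -/
theorem cycSeed_p_div {i s : ℕ} (hs : s ≤ degree k i) :
    (cycSeed k ℓ).p i s / (cycSeed k ℓ).p i 0 = (if i = 1 then cycZ k ℓ s else 1) *
      (∏ j ∈ Icc (numMutable k ℓ + 1) (numMutable k ℓ + ℓ),
        cycX k ℓ j ^ exchange k ℓ j i) ^ s := by
  simp only [cycSeed, cycZ_zero, ite_self, one_mul, mul_div_assoc]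
  congr 1
  rw [← prod_div_distrib, ← prod_pow]
  refine prod_congr rfl fun j _ => ?_
  have h0 := cycX_ne_zero (k := k) (ℓ := ℓ) j
  rw [← zpow_natCast, ← zpow_natCast, ← zpow_natCast, ← zpow_sub₀ h0, ← zpow_mul]
  congr 1
  rw [Nat.sub_zero, zero_mul, zero_add]
  push_cast [Nat.cast_sub hs]
  have h1 : exchange k ℓ j i = ((exchange k ℓ j i).toNat : ℤ) - ((-exchange k ℓ j i).toNat : ℤ) := by
    omega
  conv_rhs => rw [h1]
  ring

/-- It suffices to compare the contributions of the frozen variables. -/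
theorem yhat_eq_of_frozen {i s : ℕ} (hs : s ≤ degree k i)
    (h : psi k ℓ (gsvP k ℓ i s) / psi k ℓ (gsvP k ℓ i 0) *
        (∏ j ∈ Icc 1 (numMutable k ℓ), frozenFactor k ℓ j ^ exchange k ℓ j i) ^ s =
      (if i = 1 then cycZ k ℓ s else 1) *
        (∏ j ∈ Icc (numMutable k ℓ + 1) (numMutable k ℓ + ℓ),
          cycX k ℓ j ^ exchange k ℓ j i) ^ s) :
    ((gsvSeed k ℓ).map (psi k ℓ)).yhat (numMutable k ℓ) i s =
      (cycSeed k ℓ).yhat (numMutable k ℓ) i s := by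
  rw [CSSeed.yhat, CSSeed.yhat, cycSeed_p_div hs, ← h,
    monPos_div_monNeg _ (cycSeed k ℓ) i (cycX k ℓ) cycX_ne_zero fun _ _ => rfl,
    monPos_div_monNeg _ ((gsvSeed k ℓ).map (psi k ℓ)) i
      (fun j => cycX k ℓ j * frozenFactor k ℓ j)
      (fun j => mul_ne_zero (cycX_ne_zero j) (frozenFactor_ne_zero j)) fun j hj => psi_gsvX hj]
  simp only [mul_zpow, prod_mul_distrib, mul_pow]
  change psi k ℓ (gsvP k ℓ i s) / psi k ℓ (gsvP k ℓ i 0) * _ = _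
  simp only [CSSeed.map, gsvSeed, cycSeed]
  ring

theorem natCast_numMutable (hk : 1 ≤ k) (hℓ : 1 ≤ ℓ) : (numMutable k ℓ : ZMod ℓ) = 1 - k := by
  have h := congrArg (Nat.cast (R := ZMod ℓ)) (numMutable_add hk hℓ)
  push_cast at h
  rw [ZMod.natCast_self, mul_zero, zero_add] at h
  rw [← h]; ring

/-- The factor is 1 from index N on, so the restriction to mutable indices can be dropped. -/
theorem ite_frozenFactor {i : ℕ} (hi : 1 ≤ i) :
    (if (1 ≤ i ∧ i ≤ numMutable k ℓ) ∧ True then frozenFactor k ℓ i else 1) =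
      frozenFactor k ℓ i := by
  by_cases h : i ≤ numMutable k ℓ
  · rw [if_pos ⟨⟨hi, h⟩, trivial⟩]
  · rw [if_neg fun h' => h h'.1.2, frozenFactor_of_le (by omega)]

theorem yhat_eq_of_two_le (hk : 2 ≤ k) (hℓ : 3 ≤ ℓ) {i : ℕ} (hi : i ∈ Icc 1 (numMutable k ℓ))
    (hi2 : 2 ≤ i) : ((gsvSeed k ℓ).map (psi k ℓ)).yhat (numMutable k ℓ) i 1 =
      (cycSeed k ℓ).yhat (numMutable k ℓ) i 1 := by
  apply yhat_eq_of_frozen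
  · rw [degree, if_neg (by omega)]
  have hN := natCast_numMutable (k := k) (ℓ := ℓ) (by omega) (by omega)
  have hi' := mem_Icc.1 hi
  rw [pow_one, pow_one, prod_zpow_exchange hi _ (fun j hj => (mem_Icc.1 hj).1) _
      frozenFactor_ne_zero,
    prod_zpow_exchange hi _ (fun j hj => by rw [mem_Icc] at hj; omega) _ cycX_ne_zero]
  simp only [mem_Icc]
  have hi1 : i ≠ 1 := by omega
  have hp0 : gsvP k ℓ i 0 = 1 := by simp [gsvP, hi1]
  have hp1 : psi k ℓ (gsvP k ℓ i 1) = (if i ≤ ℓ then cycFrozen k ℓ ((i : ZMod ℓ) + k) else 1) *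
      (if numMutable k ℓ + 2 ≤ i + ℓ then cycFrozen k ℓ ((i : ZMod ℓ) + k - 2) else 1) := by
    have h1 : gsvP k ℓ i 1 = (if i ≤ ℓ then gsvOuter k ℓ i else 1) *
      (if numMutable k ℓ + 2 ≤ i + ℓ then gsvDiag k ℓ (i + k - 1) else 1) := by
      simp [gsvP, hi1]
    rw [h1, psi_mul]
    · congr 1
      · split_ifs
        · rw [psi_gsvOuter]; congr 1; push_cast; ring
        · exact psi_one
      · split_ifs
        · rw [psi_gsvDiag]; congr 1; push_cast; ring
        · exact psi_one
    · split_ifs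
      · exact gsvOuter_mem _
      · exact one_mem_laurentMonomials
    · split_ifs
      · exact gsvDiag_mem _
      · exact one_mem_laurentMonomials
  have hF := fun j : ZMod ℓ => cycFrozen_ne_zero (k := k) j
  have hG := fun j : ℕ => frozenFactor_ne_zero (k := k) (ℓ := ℓ) j
  rw [hp0, psi_one, div_one, hp1, if_neg hi1, one_mul]
  -- The next three identities telescope the pairs (i-ℓ, i+1-ℓ), (i+ℓ-1, i+ℓ) and (i-1, i+1). Frozen
  -- indices are compared modulo ℓ, and the boundary cases are those where one index of a pair
  -- leaves the mutable range.
  have g2 : (if (1 ≤ i - ℓ ∧ i - ℓ ≤ numMutable k ℓ) ∧ ℓ < i then frozenFactor k ℓ (i - ℓ) else 1) =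
      (if i ≤ ℓ then 1 else cycFrozen k ℓ ((i : ZMod ℓ) + k)) *
      (if (1 ≤ i + 1 - ℓ ∧ i + 1 - ℓ ≤ numMutable k ℓ) ∧ ℓ < i then
        frozenFactor k ℓ (i + 1 - ℓ) else 1) := by
    by_cases h : i ≤ ℓ
    · rw [if_neg (by omega), if_pos h, if_neg (by omega), mul_one]
    · rw [if_pos (by omega), if_neg h, if_pos (by omega), frozenFactor_of_lt (i := i - ℓ) (by omega),
        show i - ℓ + 1 = i + 1 - ℓ by omega, Nat.cast_sub (show ℓ ≤ i by omega), ZMod.natCast_self,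
        sub_zero]
  have g3 : (if (1 ≤ i + ℓ - 1 ∧ i + ℓ - 1 ≤ numMutable k ℓ) ∧ 2 ≤ i then
      frozenFactor k ℓ (i + ℓ - 1) else 1) =
      (if numMutable k ℓ < i + ℓ then 1 else cycFrozen k ℓ ((i : ZMod ℓ) + k - 1)) *
      (if (1 ≤ i + ℓ ∧ i + ℓ ≤ numMutable k ℓ) ∧ True then frozenFactor k ℓ (i + ℓ) else 1) := by
    by_cases h : numMutable k ℓ < i + ℓ
    · rw [if_pos h, one_mul, if_neg (show ¬ ((1 ≤ i + ℓ ∧ i + ℓ ≤ numMutable k ℓ) ∧ True) by omega)]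
      split_ifs
      · exact frozenFactor_of_le (by omega)
      · rfl
    · rw [if_pos (by omega), if_neg h, if_pos ⟨by omega, trivial⟩,
        frozenFactor_of_lt (i := i + ℓ - 1) (by omega), show i + ℓ - 1 + 1 = i + ℓ by omega,
        Nat.cast_sub (show 1 ≤ i + ℓ by omega), Nat.cast_add, ZMod.natCast_self]
      congr 2
      push_cast
      ring
  have g4 : (if (1 ≤ i - 1 ∧ i - 1 ≤ numMutable k ℓ) ∧ 2 ≤ i then frozenFactor k ℓ (i - 1) else 1) =
      cycFrozen k ℓ ((i : ZMod ℓ) + k - 1) *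
      ((if i = numMutable k ℓ then 1 else cycFrozen k ℓ ((i : ZMod ℓ) + k)) *
        frozenFactor k ℓ (i + 1)) := by
    rw [if_pos (by omega), frozenFactor_of_lt (i := i - 1) (by omega),
      show i - 1 + 1 = i by omega, Nat.cast_sub (show 1 ≤ i by omega)]
    congr 1
    · congr 1; push_cast; ring
    · split_ifs with h
      · rw [frozenFactor_of_le (i := i) (by omega), frozenFactor_of_le (i := i + 1) (by omega),
          one_mul]
      · rw [frozenFactor_of_lt (i := i) (by omega)]
  rw [ite_frozenFactor (i := i + 1) (by omega), g2, g3, g4]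
  -- On the other side, only the neighbours i+1, i+ℓ-1 and i+ℓ can be frozen; their residues follow
  -- from N ≡ 1 - k modulo ℓ.
  have f1 : (if (numMutable k ℓ + 1 ≤ i + 1 ∧ i + 1 ≤ numMutable k ℓ + ℓ) ∧ True then
      cycX k ℓ (i + 1) else 1) =
      if i = numMutable k ℓ then cycFrozen k ℓ ((i : ZMod ℓ) + k) else 1 := by
    by_cases h : i = numMutable k ℓ
    · have h' : (i : ZMod ℓ) = 1 - k := by rw [h, hN]
      rw [if_pos ⟨by omega, trivial⟩, if_pos h, h', show i + 1 = numMutable k ℓ + 1 by omega,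
        cycX_numMutable_add le_rfl]
      congr 1; push_cast; ring
    · rw [if_neg (by omega), if_neg h]
  have f3 : (if (numMutable k ℓ + 1 ≤ i + ℓ - 1 ∧ i + ℓ - 1 ≤ numMutable k ℓ + ℓ) ∧ 2 ≤ i then
      cycX k ℓ (i + ℓ - 1) else 1) =
      if numMutable k ℓ + 2 ≤ i + ℓ then cycFrozen k ℓ ((i : ZMod ℓ) + k - 2) else 1 := by
    by_cases h : numMutable k ℓ + 2 ≤ i + ℓ
    · rw [if_pos (by omega), if_pos h,
        show i + ℓ - 1 = numMutable k ℓ + (i + ℓ - 1 - numMutable k ℓ) by omega,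
        cycX_numMutable_add (by omega), Nat.cast_sub (show numMutable k ℓ ≤ i + ℓ - 1 by omega),
        Nat.cast_sub (show 1 ≤ i + ℓ by omega), Nat.cast_add, hN, ZMod.natCast_self]
      congr 1; push_cast; ring
    · rw [if_neg (by omega), if_neg h]
  have f5 : (if (numMutable k ℓ + 1 ≤ i + ℓ ∧ i + ℓ ≤ numMutable k ℓ + ℓ) ∧ True then
      cycX k ℓ (i + ℓ) else 1) =
      if numMutable k ℓ < i + ℓ then cycFrozen k ℓ ((i : ZMod ℓ) + k - 1) else 1 := by
    by_cases h : numMutable k ℓ < i + ℓ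
    · rw [if_pos ⟨by omega, trivial⟩, if_pos h,
        show i + ℓ = numMutable k ℓ + (i + ℓ - numMutable k ℓ) by omega,
        cycX_numMutable_add (by omega), Nat.cast_sub (show numMutable k ℓ ≤ i + ℓ by omega),
        Nat.cast_add, hN, ZMod.natCast_self]
      congr 1; ring
    · rw [if_neg (by omega), if_neg h]
  have f2 : ¬ ((numMutable k ℓ + 1 ≤ i - ℓ ∧ i - ℓ ≤ numMutable k ℓ + ℓ) ∧ ℓ < i) := by omega
  have f4 : ¬ ((numMutable k ℓ + 1 ≤ i - 1 ∧ i - 1 ≤ numMutable k ℓ + ℓ) ∧ 2 ≤ i) := by omega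
  have f6 : ¬ ((numMutable k ℓ + 1 ≤ i + 1 - ℓ ∧ i + 1 - ℓ ≤ numMutable k ℓ + ℓ) ∧ ℓ < i) := by
    omega
  rw [f1, f3, f5, if_neg f2, if_neg f4, if_neg f6]
  have hX : (if (1 ≤ i + 1 - ℓ ∧ i + 1 - ℓ ≤ numMutable k ℓ) ∧ ℓ < i then
        frozenFactor k ℓ (i + 1 - ℓ) else 1) ≠ 0 := by
    split_ifs
    · exact hG _
    · exact one_ne_zero
  have hY : (if (1 ≤ i + ℓ ∧ i + ℓ ≤ numMutable k ℓ) ∧ True then frozenFactor k ℓ (i + ℓ) else 1) ≠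
      0 := by
    split_ifs
    · exact hG _
    · exact one_ne_zero
  have hZ := hG (i + 1)
  generalize (if (1 ≤ i + 1 - ℓ ∧ i + 1 - ℓ ≤ numMutable k ℓ) ∧ ℓ < i then
        frozenFactor k ℓ (i + 1 - ℓ) else 1) = x at *
  generalize (if (1 ≤ i + ℓ ∧ i + ℓ ≤ numMutable k ℓ) ∧ True then
        frozenFactor k ℓ (i + ℓ) else 1) = y at *
  generalize frozenFactor k ℓ (i + 1) = z at *
  have ha := hF ((i : ZMod ℓ) + k)
  have hb := hF ((i : ZMod ℓ) + k - 1)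
  generalize cycFrozen k ℓ ((i : ZMod ℓ) + k) = a at *
  generalize cycFrozen k ℓ ((i : ZMod ℓ) + k - 1) = b at *
  generalize (if numMutable k ℓ + 2 ≤ i + ℓ then cycFrozen k ℓ ((i : ZMod ℓ) + k - 2) else 1) = c
    at *
  split_ifs <;> field_simp

theorem prod_Icc_cycFrozen_add (hℓ : 0 < ℓ) (c : ZMod ℓ) :
    ∏ a ∈ Icc 1 ℓ, cycFrozen k ℓ ((a : ZMod ℓ) + c) = ∏ a ∈ Icc 1 ℓ, cycFrozen k ℓ (a : ZMod ℓ) := by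
  have : NeZero ℓ := ⟨hℓ.ne'⟩
  rw [prod_Icc_natCast_zmod (fun a : ZMod ℓ => cycFrozen k ℓ (a + c)),
    prod_Icc_natCast_zmod (fun a : ZMod ℓ => cycFrozen k ℓ a)]
  exact Equiv.prod_comp (Equiv.addRight c) (cycFrozen k ℓ)

/-- Vertex 1 has only the arrows 2 → 1 → ℓ+1. For k ≥ 3 the vertex ℓ+1 is mutable, while for k = 2
it is the frozen vertex N+2; hence the two forms of the exchange polynomial. -/
theorem yhat_eq_one (hk : 2 ≤ k) (hkℓ : k < ℓ) {s : ℕ} (hs : s ∈ Icc 1 k) :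
    ((gsvSeed k ℓ).map (psi k ℓ)).yhat (numMutable k ℓ) 1 s =
      (cycSeed k ℓ).yhat (numMutable k ℓ) 1 s := by
  have hs' := mem_Icc.1 hs
  apply yhat_eq_of_frozen
  · rw [degree, if_pos rfl]; omega
  have hN := natCast_numMutable (k := k) (ℓ := ℓ) (by omega) (by omega)
  have hN2 : 2 ≤ numMutable k ℓ := by
    rw [numMutable]
    calc 2 = 1 * 2 := rfl
      _ ≤ _ := Nat.mul_le_mul (by omega) (by omega)
  rw [prod_zpow_exchange (mem_Icc.2 ⟨le_rfl, by omega⟩) _ (fun j hj => (mem_Icc.1 hj).1) _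
      frozenFactor_ne_zero,
    prod_zpow_exchange (mem_Icc.2 ⟨le_rfl, by omega⟩) _
      (fun j hj => by rw [mem_Icc] at hj; omega) _ cycX_ne_zero]
  simp only [mem_Icc]
  have hF := fun j : ZMod ℓ => cycFrozen_ne_zero (k := k) j
  have f2 : ¬ ((1 ≤ 1 - ℓ ∧ 1 - ℓ ≤ numMutable k ℓ) ∧ ℓ < 1) := by omega
  have f3 : ¬ ((1 ≤ 1 + ℓ - 1 ∧ 1 + ℓ - 1 ≤ numMutable k ℓ) ∧ 2 ≤ 1) := by omega
  have f4 : ¬ ((1 ≤ 1 - 1 ∧ 1 - 1 ≤ numMutable k ℓ) ∧ 2 ≤ 1) := by omega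
  have f6 : ¬ ((1 ≤ 1 + 1 - ℓ ∧ 1 + 1 - ℓ ≤ numMutable k ℓ) ∧ ℓ < 1) := by omega
  have h1 : ¬ ((numMutable k ℓ + 1 ≤ 1 + 1 ∧ 1 + 1 ≤ numMutable k ℓ + ℓ) ∧ True) := by omega
  have h2 : ¬ ((numMutable k ℓ + 1 ≤ 1 - ℓ ∧ 1 - ℓ ≤ numMutable k ℓ + ℓ) ∧ ℓ < 1) := by omega
  have h3 : ¬ ((numMutable k ℓ + 1 ≤ 1 + ℓ - 1 ∧ 1 + ℓ - 1 ≤ numMutable k ℓ + ℓ) ∧ 2 ≤ 1) := by omega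
  have h4 : ¬ ((numMutable k ℓ + 1 ≤ 1 - 1 ∧ 1 - 1 ≤ numMutable k ℓ + ℓ) ∧ 2 ≤ 1) := by omega
  have h6 : ¬ ((numMutable k ℓ + 1 ≤ 1 + 1 - ℓ ∧ 1 + 1 - ℓ ≤ numMutable k ℓ + ℓ) ∧ ℓ < 1) := by omega
  rw [ite_frozenFactor (i := 1 + ℓ) (by omega), ite_frozenFactor (i := 1 + 1) (by omega), if_neg f2,
    if_neg f3, if_neg f4, if_neg f6, if_neg h1, if_neg h2, if_neg h3, if_neg h4, if_neg h6, if_true]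
  simp only [mul_one, div_one, one_div]
  have hprod0 : ∀ S : Finset ℕ, ∀ c : ZMod ℓ, ∏ a ∈ S, cycFrozen k ℓ ((a : ZMod ℓ) + c) ≠ 0 :=
    fun S c => prod_ne_zero_iff.2 fun _ _ => hF _
  have hIcc : Icc 1 ℓ = insert 1 (Icc 2 ℓ) := by
    ext x; simp only [mem_Icc, mem_insert]; omega
  set Q := ∏ a ∈ Icc 2 ℓ, cycFrozen k ℓ ((a : ZMod ℓ) + k) with hQ
  set Pi := ∏ a ∈ Icc 1 ℓ, cycFrozen k ℓ (a : ZMod ℓ) with hPi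
  have hQ0 : Q ≠ 0 := hprod0 _ _
  have hPiQ : cycFrozen k ℓ (1 + k) * Q = Pi := by
    rw [hPi, ← prod_Icc_cycFrozen_add (by omega) (k : ZMod ℓ), hIcc, prod_insert (by simp), hQ, Nat.cast_one]
  have hPi0 : Pi ≠ 0 := by rw [← hPiQ]; exact mul_ne_zero (hF _) hQ0
  have hdiag : ∀ a : ℕ, psi k ℓ (gsvDiag k ℓ a) = cycFrozen k ℓ ((a : ZMod ℓ) - 1) := fun a => by
    rw [psi_gsvDiag]; congr 1; push_cast; ring
  have hout : ∀ a : ℕ, psi k ℓ (gsvOuter k ℓ a) = cycFrozen k ℓ ((a : ZMod ℓ) + k) := fun a => by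
    rw [psi_gsvOuter]; congr 1; push_cast; ring
  have hout1 : psi k ℓ (gsvOuter k ℓ 1) = cycFrozen k ℓ (1 + k) := by
    rw [psi_gsvOuter]; congr 1; push_cast; ring
  rcases hk.eq_or_lt with rfl | hk3
  · -- `k = 2`
    have hNℓ : numMutable 2 ℓ = ℓ - 1 := by simp [numMutable]
    have h5 : (numMutable 2 ℓ + 1 ≤ 1 + ℓ ∧ 1 + ℓ ≤ numMutable 2 ℓ + ℓ) ∧ True :=
      ⟨by omega, trivial⟩
    rw [if_pos h5, frozenFactor_of_le (i := 1 + ℓ) (by omega), div_one]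
    have e1 : cycX 2 ℓ (1 + ℓ) = cycFrozen 2 ℓ 2 := by
      rw [show 1 + ℓ = numMutable 2 ℓ + 2 by omega, cycX_numMutable_add (by omega)]
      norm_num
    set P₁ := ∏ a ∈ (Icc 1 ℓ).erase 2, cycFrozen 2 ℓ ((a : ZMod ℓ) - 1) with hP₁
    have hP₁0 : P₁ ≠ 0 := prod_ne_zero_iff.2 fun _ _ => hF _
    have hP₁Pi : P₁ * cycFrozen 2 ℓ 1 = Pi := by
      rw [hPi, ← prod_Icc_cycFrozen_add (by omega) (-1 : ZMod ℓ),
        ← mul_prod_erase (Icc 1 ℓ) _ (show 2 ∈ Icc 1 ℓ by rw [mem_Icc]; omega), mul_comm, hP₁]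
      simp only [sub_eq_add_neg]
      congr 2
      push_cast
      ring
    -- Here N = ℓ-1, so the factor stops at b = ℓ-2; the missing terms ℓ-1 and ℓ of Q have the
    -- residues 1 and 2 after the shift by k = 2.
    have hG2 : frozenFactor 2 ℓ (1 + 1) * (cycFrozen 2 ℓ 1 * cycFrozen 2 ℓ 2) = Q := by
      obtain ⟨e, rfl⟩ : ∃ e, ℓ = e + 3 := ⟨ℓ - 3, by omega⟩
      have hI : Icc 2 (e + 3) = Ico 2 (e + 2 + 1 + 1) := by
        ext x; simp only [mem_Icc, mem_Ico]; omega
      have h0 : ((e + 3 : ℕ) : ZMod (e + 3)) = 0 := ZMod.natCast_self _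
      rw [hQ, hI, prod_Ico_succ_top (by omega), prod_Ico_succ_top (by omega), frozenFactor, hNℓ,
        mul_assoc]
      congr 2
      · congr 1
        push_cast at h0 ⊢
        linear_combination -h0
      · congr 1
        push_cast at h0 ⊢
        linear_combination -h0
    have hp0 : psi 2 ℓ (gsvP 2 ℓ 1 0) = P₁ * Q := by
      have : gsvP 2 ℓ 1 0 = (∏ a ∈ (Icc 1 ℓ).erase 2, gsvDiag 2 ℓ a) *
        ∏ a ∈ Icc 2 ℓ, gsvOuter 2 ℓ a := by simp [gsvP]
      rw [this, psi_mul (prod_mem_laurentMonomials fun _ _ => gsvDiag_mem _)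
        (prod_mem_laurentMonomials fun _ _ => gsvOuter_mem _), psi_prod _ fun a => gsvDiag_mem _,
        psi_prod _ fun a => gsvOuter_mem _]
      simp only [hdiag, hout]
      rfl
    rw [e1, hp0]
    have c1 := hF 1
    have c2 := hF 2
    have hG20 := frozenFactor_ne_zero (k := 2) (ℓ := ℓ) (1 + 1)
    rcases (show s = 1 ∨ s = 2 by omega) with rfl | rfl
    · have hp1 : psi 2 ℓ (gsvP 2 ℓ 1 1) = cycZ 2 ℓ 1 * Pi := by
        have : gsvP 2 ℓ 1 1 = gsvC 2 ℓ 1 := by simp [gsvP]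
        rw [this, psi_gsvC (by omega)]
      rw [hp1, ← hP₁Pi, ← hG2]
      field_simp
    · have hp2 : psi 2 ℓ (gsvP 2 ℓ 1 2) = cycFrozen 2 ℓ (1 + (2 : ℕ)) * cycFrozen 2 ℓ 1 := by
        have : gsvP 2 ℓ 1 2 = gsvOuter 2 ℓ 1 * gsvDiag 2 ℓ 2 := by simp [gsvP]
        rw [this, psi_mul (gsvOuter_mem _) (gsvDiag_mem _), hout1, psi_gsvDiag]
        congr 2
        push_cast
        ring
      rw [hp2, cycZ_self, one_mul]
      have h4 : cycFrozen 2 ℓ (1 + (2 : ℕ)) *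
          (frozenFactor 2 ℓ (1 + 1) * (cycFrozen 2 ℓ 1 * cycFrozen 2 ℓ 2)) =
          P₁ * cycFrozen 2 ℓ 1 := by rw [hG2, hP₁Pi, hPiQ]
      have h5 : P₁ = cycFrozen 2 ℓ (1 + (2 : ℕ)) * frozenFactor 2 ℓ (1 + 1) * cycFrozen 2 ℓ 2 := by
        apply mul_right_cancel₀ c1
        rw [← h4]; ring
      have c3 := hF (1 + (2 : ℕ))
      rw [← hG2, h5]
      field_simp
  · -- `k ≥ 3`
    have hNℓ : ℓ + 1 ≤ numMutable k ℓ := by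
      rw [numMutable]
      calc ℓ + 1 ≤ 2 * (ℓ - 1) := by omega
        _ ≤ _ := Nat.mul_le_mul_right _ (by omega)
    rw [if_neg (by omega), inv_one, one_pow, mul_one]
    -- The quotient of the frozen factors at the two neighbours of vertex 1 is Q, so its s-th power
    -- cancels the powers of Q in the coefficients.
    have hG2 : frozenFactor k ℓ (1 + 1) = Q * frozenFactor k ℓ (1 + ℓ) := by
      have hI : Icc 2 ℓ = Ico 2 (1 + ℓ) := by
        ext x; simp only [mem_Icc, mem_Ico]; omega
      rw [frozenFactor, frozenFactor, hQ, hI, prod_Ico_consecutive _ (by omega) (by omega)]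
    rw [hG2, mul_div_assoc, div_self (frozenFactor_ne_zero _), mul_one]
    have hp0 : psi k ℓ (gsvP k ℓ 1 0) = Pi * Q ^ (k - 1) := by
      have : gsvP k ℓ 1 0 = (∏ a ∈ Icc 1 ℓ, gsvDiag k ℓ a) *
        ∏ a ∈ Icc 2 ℓ, gsvOuter k ℓ a ^ (k - 1) := by
        simp [gsvP, show k ≠ 2 by omega]
      rw [this, psi_mul (prod_mem_laurentMonomials fun _ _ => gsvDiag_mem _)
        (prod_mem_laurentMonomials fun _ _ => pow_mem_laurentMonomials (gsvOuter_mem _) _),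
        psi_prod _ fun a => gsvDiag_mem _,
        psi_prod _ fun a => pow_mem_laurentMonomials (gsvOuter_mem _) _]
      simp only [hdiag, psi_pow (gsvOuter_mem _), hout]
      rw [prod_pow, hPi, ← prod_Icc_cycFrozen_add (by omega) (-1 : ZMod ℓ)]
      simp only [sub_eq_add_neg]
      rfl
    rw [hp0]
    rcases hs'.2.eq_or_lt with rfl | hsk
    · have hp : gsvP s ℓ 1 s = gsvOuter s ℓ 1 := by
        simp [gsvP, show s ≠ 2 by omega, show s ≠ 0 by omega]
      rw [hp, hout1, cycZ_self, ← hPiQ]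
      obtain ⟨e, rfl⟩ : ∃ e, s = e + 1 := ⟨s - 1, by omega⟩
      have c3 := hF (1 + ((e + 1 : ℕ) : ZMod ℓ))
      rw [Nat.add_sub_cancel, pow_succ]
      field_simp
    · have hp : psi k ℓ (gsvP k ℓ 1 s) = cycZ k ℓ s * Pi * Q ^ (k - 1 - s) := by
        have : gsvP k ℓ 1 s = gsvC k ℓ (k - s) * ∏ a ∈ Icc 2 ℓ, gsvOuter k ℓ a ^ (k - 1 - s) := by
          simp [gsvP, show k ≠ 2 by omega, show s ≠ 0 by omega, hsk]
        rw [this, psi_mul (gsvC_mem _)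
          (prod_mem_laurentMonomials fun _ _ => pow_mem_laurentMonomials (gsvOuter_mem _) _),
          psi_prod _ fun a => pow_mem_laurentMonomials (gsvOuter_mem _) _,
          psi_gsvC (by omega), cycZ_symm (by omega)]
        simp only [psi_pow (gsvOuter_mem _), hout]
        rw [prod_pow]
      rw [hp]
      have hQpow : Q ^ (k - 1) = Q ^ (k - 1 - s) * Q ^ s := by
        rw [← pow_add]; congr 1; omega
      rw [hQpow]
      field_simp

theorem isQuasiHom_psi (hk : 2 ≤ k) (hkℓ : k < ℓ) :
    IsQuasiHom (numMutable k ℓ) (gsvCoeff k ℓ) (gsvSeed k ℓ) (cycCoeff k ℓ) (cycSeed k ℓ)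
      (psi k ℓ) where
  source := isSeedOver_gsvSeed (by omega)
  target := isSeedOver_cycSeed (by omega)
  mapsTo _ hf := (psi_ambient hf).2
  map_add _ hf _ hg :=
    fractionMap_add (eval_one_psiPoly k ℓ) (psi_ambient hf).1 (psi_ambient hg).1
  map_mul _ hf _ hg :=
    fractionMap_mul (eval_one_psiPoly k ℓ) (psi_ambient hf).1 (psi_ambient hg).1
  map_coeff _ hf := (psi_coeff hf).2
  equivalent := by
    intro i hi
    refine ⟨rfl, ?_, fun s hs => ?_⟩
    · change psi k ℓ (gsvX k ℓ i) / cycX k ℓ i ∈ cycCoeff k ℓ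
      rw [psi_gsvX hi, mul_div_cancel_left₀ _ (cycX_ne_zero i)]
      exact frozenFactor_mem i
    · change s ∈ Icc 1 (degree k i) at hs
      by_cases h1 : i = 1
      · subst h1
        rw [degree, if_pos rfl] at hs
        exact yhat_eq_one hk hkℓ hs
      · rw [degree, if_neg h1, mem_Icc] at hs
        obtain rfl : s = 1 := by omega
        have := (mem_Icc.1 hi).1
        exact yhat_eq_of_two_le hk (by omega) hi (by omega)

end Equivalence

/-! ### Evaluation at Plücker coordinates. -/

section Specialization

theorem eta_symm {k s : ℕ} (p : ℕ) (hs : s ≤ k) : eta k p (k - s) = eta k p s := by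
  rw [eta, eta, Nat.sub_sub_self hs, mul_comm]

theorem eta_min {k s : ℕ} (p : ℕ) (hs : s ≤ k) : eta k p (min s (k - s)) = eta k p s := by
  rcases min_choice s (k - s) with h | h <;> rw [h]
  exact eta_symm p hs

theorem eval_cycPoint_frozen {k n ℓ : ℕ} (p : ℕ) (X : Matrix (Fin k) (Fin n) ℂ) (j : ZMod ℓ) :
    MvPolynomial.eval (cycPoint ℓ p X) (MvPolynomial.X (.frozen j)) = frozenPlucker ℓ X j := by
  rw [MvPolynomial.eval_X]
  rfl

theorem resIcc_natCast {ℓ i : ℕ} (hi : i ∈ Icc 1 ℓ) : resIcc ℓ i = i := by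
  rw [mem_Icc] at hi
  rw [resIcc, Int.emod_eq_of_lt (by omega) (by omega)]
  omega

/-- One case for each kind of variable: the minor formula, the two frozen diagonals, and the
coefficient strings. Only the last restricts k to 2 or 3. -/
theorem eval_cycPoint_psiVar {k ℓ p n : ℕ} (hk : 2 ≤ k) (hkℓ : k < ℓ) (hp : k ≤ p) (hn : n = p * ℓ)
    (hk23 : k = 2 ∨ k = 3) {X : Matrix (Fin k) (Fin n) ℂ} (hX : X ∈ distinguished k n ℓ)
    (v : GSVVar k ℓ) :
    MvPolynomial.eval (cycPoint ℓ p X) (psiVar k ℓ v) = gsvPoint k ℓ (phi' X) v := by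
  have : NeZero ℓ := ⟨by omega⟩
  have hkn : k * ℓ ≤ n := hn ▸ Nat.mul_le_mul_right _ hp
  have hn0 : 0 < n := lt_of_lt_of_le (Nat.mul_pos (by omega) (by omega)) hkn
  have : NeZero n := ⟨hn0.ne'⟩
  have hper := plucker_image_add_of_mem_distinguished (by omega) hn hn0 hX
  have hfrozen : ∀ a : ℤ, plucker X (Icc (a - k + 1) a) = frozenPlucker ℓ X (a : ZMod ℓ) := fun a => by
    rw [← plucker_eq_frozenPlucker, plucker_frozen (by omega) hper]
  cases v with
  | x i =>
    rw [psiVar, map_mul, map_prod, gsvPoint,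
      initMinor_phi' hk (by omega) hkn hper i.2.1 i.2.2, MvPolynomial.eval_X]
    congr 1
    refine prod_congr rfl fun b _ => ?_
    rw [eval_cycPoint_frozen, plucker_eq_frozenPlucker]
    congr 1
    push_cast
    ring
  | diag j =>
    rw [psiVar, eval_cycPoint_frozen, gsvPoint, phi'_diag (by omega)]
    have h := hfrozen ((j.val : ℤ) - 1)
    rw [show (j.val : ℤ) - 1 - k + 1 = j.val - k by ring] at h
    rw [h]
    congr 1
    push_cast
    rw [ZMod.natCast_zmod_val]
  | outer j =>
    rw [psiVar, eval_cycPoint_frozen, gsvPoint]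
    have h := phi'_outer (by omega) X ((j.val : ℤ) + k + 1)
    rw [show (j.val : ℤ) + k + 1 - k - 1 = j.val by ring,
      show (j.val : ℤ) + k + 1 - 1 = j.val + k by ring,
      show (j.val : ℤ) + k + 1 - k = j.val + k - k + 1 by ring, hfrozen] at h
    rw [h]
    congr 1
    push_cast
    rw [ZMod.natCast_zmod_val]
  | c s =>
    obtain ⟨s, hs1, hs2⟩ := s
    rw [psiVar, map_mul, map_prod, gsvPoint,
      coeffString_phi' hkℓ hp hn hk23 hX (mem_Icc.2 ⟨hs1, hs2⟩)]
    congr 1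
    · change MvPolynomial.eval _ (zPoly k ℓ s) = eta k p s
      rw [zPoly, dif_pos ⟨by omega, by omega⟩, MvPolynomial.eval_X]
      exact eta_min p (by omega)
    · refine prod_congr rfl fun i hi => ?_
      rw [eval_cycPoint_frozen]
      have h := plucker_eq_frozenPlucker (ℓ := ℓ) X (i : ℤ)
      rw [resIcc_natCast hi] at h
      rw [h]
      push_cast
      rfl

end Specialization

end CyclicLocus

end

theorem proposition8p3 (k ℓ p n : ℕ) (hk : 2 ≤ k) (hkℓ : k < ℓ) (hp : k ≤ p) (hn : n = p * ℓ) :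
    -- for every `k`: cluster variables and frozen entries
    (∀ X ∈ distinguished k n ℓ,
      phi' X ∈ band k ℓ ∧
      (∀ i ∈ Finset.Icc 1 (numMutable k ℓ),
        initMinor k ℓ i (phi' X) = plucker X (initSet k ℓ i) *
          ∏ b ∈ Finset.Ico i (numMutable k ℓ),
            plucker X (initSet k ℓ (numMutable k ℓ + resIcc ℓ (b + k)))) ∧
      (∀ i : ℤ,
        phi' X i i = plucker X (initSet k ℓ (numMutable k ℓ + resIcc ℓ (i - 1))) ∧
        phi' X (i - k - 1) (i - 1) =
          plucker X (initSet k ℓ (numMutable k ℓ + resIcc ℓ (i - 1))))) ∧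
    (k = 2 ∨ k = 3 →
      -- coefficient strings
      (∀ X ∈ distinguished k n ℓ, ∀ s ∈ Finset.Icc 1 (k - 1),
        coeffString k ℓ s (phi' X) =
          eta k p s * ∏ i ∈ Finset.Icc 1 ℓ, plucker X (initSet k ℓ (numMutable k ℓ + i))) ∧
      -- the pullback realizes the quasi-homomorphism
      ∃ ψ : GSVField k ℓ → CycField k ℓ,
        PsiOnVariables k ℓ ψ ∧ PsiOnCoefficients k ℓ ψ ∧
        IsQuasiHom (numMutable k ℓ) (gsvCoeff k ℓ) (gsvSeed k ℓ) (cycCoeff k ℓ) (cycSeed k ℓ) ψ ∧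
        ∀ X ∈ distinguished k n ℓ, ∀ f ∈ ambient (numMutable k ℓ) (gsvCoeff k ℓ) (gsvSeed k ℓ),
          ∀ c : ℂ, HasValueAt (gsvPoint k ℓ (phi' X)) f c → HasValueAt (cycPoint ℓ p X) (ψ f) c) := by
  have hkn : k * ℓ ≤ n := hn ▸ Nat.mul_le_mul_right _ hp
  have hn0 : 0 < n := lt_of_lt_of_le (Nat.mul_pos (by omega) (by omega)) hkn
  have hkn' : k < n := lt_of_lt_of_le (by nlinarith) hkn
  have : NeZero n := ⟨hn0.ne'⟩
  refine ⟨fun X hX => ?_, fun hk23 => ⟨fun X hX s hs => coeffString_phi' hkℓ hp hn hk23 hX hs,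
    psi k ℓ, psiOnVariables (by omega), psiOnCoefficients, isQuasiHom_psi hk hkℓ,
    fun X hX f _ c hc => hasValueAt_psi (eval_cycPoint_psiVar hk hkℓ hp hn hk23 hX) hc⟩⟩
  have hper := plucker_image_add_of_mem_distinguished (by omega) hn hn0 hX
  refine ⟨phi'_mem_band (by omega) hkn' hper, fun i hi => ?_, fun i => ?_⟩
  · rw [Finset.mem_Icc] at hi
    exact initMinor_phi' hk (by omega) hkn hper hi.1 hi.2
  · rw [plucker_frozen (by omega) hper, phi'_diag (by omega), phi'_outer (by omega),
      show i - 1 - k + 1 = i - (k : ℤ) by ring]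
    exact ⟨rfl, rfl⟩
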